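/- Let $d\ge 2$ and let $\mathbb T^d=[0,2\pi]^d$ be the torus. For $f:\mathbb T^d\to\mathbb R$ write $\hat f(k)=(2\pi)^{-d}\int_{\mathbb T^d}f(x)e^{-ik\cdot x}\,dx$ for $k\in\mathbb Z^d$, let $\Lambda=(-\Delta)^{1/2}$ (so that $\Lambda^\gamma$ has Fourier symbol $|k|^\gamma$), and put $$\|\Lambda^re^{\tau\Lambda^{1/s}}f\|_{L^2}^2=\sum_{k\in\mathbb Z^d\setminus\{0\}}|k|^{2r}e^{2\tau|k|^{1/s}}|\hat f(k)|^2\in[0,\infty].$$ Let $T_{ij}$ ($1\le i,j\le d$) be Fourier multiplier operators with symbols $\widehat{T_{ij}}(k)$ which map real functions to real functions, i.e. $\widehat{T_{ij}}(-k)=\overline{\widehat{T_{ij}}(k)}$, and satisfy $\sum_{i,j}\partial_{x_i}\partial_{x_j}T_{ij}=0$, $\widehat{T_{ij}}(0)=0$ and $\sup_{k\ne0}|\widehat{T_{ij}}(k)|\le C_0$ for some $C_0>0$. Consider $$\partial_t\theta^\kappa+u^\kappa\cdot\nabla\theta^\kappa=-\kappa\Lambda^\gamma\theta^\kappa+S,\qquad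 u^\kappa_j=\sum_i\partial_{x_i}T_{ij}\theta^\kappa,\qquad \theta^\kappa(\cdot,0)=\theta_0.\tag{1}$$ A Gevrey-class $s$ solution of (1) on $[0,T_*)$ is a function $\theta$ such that $\theta(\cdot,t)$ is a continuous real function on $\mathbb T^d$ with zero mean for every $t\in[0,T_*)$, such that for every $t_1<T_*$ there is $\tau>0$ with $\sup_{0\le t\le t_1}\|\Lambda^re^{\tau\Lambda^{1/s}}\theta(\cdot,t)\|_{L^2}<\infty$, and such that (1) holds pointwise on $\mathbb T^d\times[0,T_*)$ (with a one-sided time derivative at $t=0$). **Theorem.** Let $s\ge1$, $r>\frac d2+\frac52$, $\tau_0>0$, $K_0>0$ and $C_*>0$. There is $T_*>0$, depending only on $d,s,r,C_*,\tau_0,K_0$, such that the following holds. Suppose that $$\sup_{k\in\mathbb Z^d\setminus\{0\}}|\widehat{\partial_{x_i}T_{ij}}(k)|\le C_*\qquad(1\le i,j\le d),$$ where $\widehat{\partial_{x_i}T_{ij}}(k)=i\,k_i\widehat{T_{ij}}(k)$ (with $i$ the imaginary unit in the first factor), let $\theta_0$ and $S=S(x)$ be continuous real functions on $\mathbb T^d$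 with zero mean and $$\|\Lambda^re^{\tau_0\Lambda^{1/s}}\theta_0\|_{L^2}\le K_0,\qquad \|\Lambda^re^{\tau_0\Lambda^{1/s}}S\|_{L^2}\le K_0,$$ and let $\gamma\in(0,2]$. Then for every $\kappa\ge0$ there is a unique Gevrey-class $s$ solution $\theta^\kappa$ of (1) on $[0,T_*)$. Moreover, there are $T\in(0,T_*)$ and a continuous function $\tau:[0,T]\to(0,\tau_0)$, both independent of $\kappa$, such that for every $t\in[0,T]$ $$\lim_{\kappa\to0^+}\|\Lambda^re^{\tau(t)\Lambda^{1/s}}(\theta^\kappa-\theta^0)(\cdot,t)\|_{L^2}=0.$$ -/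

import Mathlib

/-! Functions on the torus `[0,2π]^d` are functions `(Fin d → ℝ) → ℝ` that are `2π`-periodic in
each variable; frequencies are `k : Fin d → ℤ`. -/

namespace ActiveScalar

/-- The Euclidean length `|k|` of a frequency `k ∈ ℤ^d`. -/
noncomputable def freqNorm {d : ℕ} (k : Fin d → ℤ) : ℝ :=
  Real.sqrt (∑ i, (k i : ℝ) ^ 2)

/-- The character `x ↦ e^{i k·x}`. -/
noncomputable def character {d : ℕ} (k : Fin d → ℤ) (x : Fin d → ℝ) : ℂ :=
  Complex.exp (Complex.I * ((∑ i, (k i : ℝ) * x i : ℝ) : ℂ))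

/-- The Fourier coefficient `(2π)^{-d} ∫_{[0,2π]^d} f(x) e^{-i k·x} dx`. -/
noncomputable def fourierCoef {d : ℕ} (f : (Fin d → ℝ) → ℝ) (k : Fin d → ℤ) : ℂ :=
  (1 / (2 * (Real.pi : ℂ)) ^ d) *
    ∫ x in Set.Icc (fun _ : Fin d => (0 : ℝ)) (fun _ => 2 * Real.pi),
      (f x : ℂ) * character (-k) x

/-- A continuous function on the torus with zero average. -/
structure IsMeanZeroTorusFunction {d : ℕ} (f : (Fin d → ℝ) → ℝ) : Prop where
  continuous : Continuous f
  periodic : ∀ (x : Fin d → ℝ) (i : Fin d), f (x + Pi.single i (2 * Real.pi)) = f x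
  mean_zero : ∫ x in Set.Icc (fun _ : Fin d => (0 : ℝ)) (fun _ => 2 * Real.pi), f x = 0

/-- The Gevrey norm `‖Λ^r e^{τ Λ^{1/s}} f‖_{L²}`, the square root of
`∑_{k ≠ 0} |k|^{2r} e^{2τ|k|^{1/s}} |f̂(k)|²`, with values in `[0,∞]`. -/
noncomputable def gevreyNorm {d : ℕ} (s r τ : ℝ) (f : (Fin d → ℝ) → ℝ) : ENNReal :=
  (∑' k : {k : Fin d → ℤ // k ≠ 0},
    ENNReal.ofReal (freqNorm k.1 ^ (2 * r) * Real.exp (2 * τ * freqNorm k.1 ^ (1 / s)) *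
      ‖fourierCoef f k.1‖ ^ 2)) ^ (1 / 2 : ℝ)

/-- The Fourier multiplier with symbol `m`: `(m(D) f)(x) = ∑_k m(k) f̂(k) e^{i k·x}`. -/
noncomputable def fourierMultiplier {d : ℕ} (m : (Fin d → ℤ) → ℂ) (f : (Fin d → ℝ) → ℝ)
    (x : Fin d → ℝ) : ℂ :=
  ∑' k : Fin d → ℤ, m k * fourierCoef f k * character k x

/-- The fractional Laplacian `Λ^γ = (-Δ)^{γ/2}`, the multiplier with symbol `|k|^γ`. -/
noncomputable def fracLaplacian {d : ℕ} (γ : ℝ) (f : (Fin d → ℝ) → ℝ) (x : Fin d → ℝ) : ℂ :=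
  fourierMultiplier (fun k => ((freqNorm k ^ γ : ℝ) : ℂ)) f x

/-- The symbol `i k_i T̂_{ij}(k)` of the operator `∂_{x_i} T_{ij}`, where `T̂` is the matrix of the
symbols of the operators `T_{ij}`. -/
noncomputable def derivSymbol {d : ℕ} (T : Fin d → Fin d → (Fin d → ℤ) → ℂ) (i j : Fin d)
    (k : Fin d → ℤ) : ℂ :=
  Complex.I * (k i : ℂ) * T i j k

/-- The `j`-th component `u_j[f] = ∑_i ∂_{x_i} T_{ij} f` of the velocity. -/
noncomputable def velocity {d : ℕ} (T : Fin d → Fin d → (Fin d → ℤ) → ℂ)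
    (f : (Fin d → ℝ) → ℝ) (j : Fin d) (x : Fin d → ℝ) : ℂ :=
  ∑ i, fourierMultiplier (derivSymbol T i j) f x

/-- The standing assumptions on the symbols of the operators `T_{ij}`: they map real functions to
real functions, `∑_{i,j} ∂_{x_i} ∂_{x_j} T_{ij} = 0`, they vanish at frequency zero, and they are
bounded. -/
structure IsAdmissible {d : ℕ} (T : Fin d → Fin d → (Fin d → ℤ) → ℂ) : Prop where
  real : ∀ i j k, T i j (-k) = (starRingEnd ℂ) (T i j k)
  div_free : ∀ k : Fin d → ℤ, ∑ i, ∑ j, (k i : ℂ) * (k j : ℂ) * T i j k = 0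
  zero : ∀ i j, T i j 0 = 0
  bounded : ∃ C₀ : ℝ, 0 < C₀ ∧ ∀ i j k, k ≠ 0 → ‖T i j k‖ ≤ C₀

/-- `θ` is a (mean-zero, classical) Gevrey-class `s` solution on `[0,Tmax)` of
`∂_t θ + u[θ]·∇θ = -κ Λ^γ θ + S`, `θ(·,0) = θ₀`. On every compact subinterval of `[0,Tmax)` it is
bounded in a Gevrey norm with some positive radius. The equation holds at every point; the time
derivative at `t = 0` is one-sided. Only the values of `θ` at times in `[0,Tmax)` matter. -/
structure IsGevreySolution {d : ℕ} (T : Fin d → Fin d → (Fin d → ℤ) → ℂ) (s r γ κ : ℝ)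
    (θ₀ S : (Fin d → ℝ) → ℝ) (Tmax : ℝ) (θ : ℝ → (Fin d → ℝ) → ℝ) : Prop where
  torus : ∀ t ∈ Set.Ico 0 Tmax, IsMeanZeroTorusFunction (θ t)
  gevrey : ∀ t₁ < Tmax, ∃ τ > 0, ∃ M : NNReal, ∀ t ∈ Set.Icc 0 t₁, gevreyNorm s r τ (θ t) ≤ M
  initial : θ 0 = θ₀
  equation : ∀ t ∈ Set.Ico 0 Tmax, ∀ x : Fin d → ℝ,
    HasDerivWithinAt (fun t' => (θ t' x : ℂ))
      (-(∑ j, velocity T (θ t) j x * ((fderiv ℝ (θ t) x (Pi.single j 1) : ℝ) : ℂ))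
        - (κ : ℂ) * fracLaplacian γ (θ t) x + (S x : ℂ))
      (Set.Ico 0 Tmax) t

end ActiveScalar

/-! Everything is done on Fourier coefficients. Since `∂_{x_i} T_{ij}` is bounded by `C_*`, the
velocity is a real multiplier of order zero, and `u·∇` becomes a bilinear convolution with a kernel
`q(m,n)` of size at most `A|n|`. Incompressibility says `q(m,m+n) = q(m,n)`. Together with reality
this makes `Re ⟨φ, u[θ]·∇φ⟩` vanish (`re_tsum_eq_zero`), the only cancellation that is used.

Existence rests on a Gevrey energy estimate with a shrinking radius. Put `a = 1/s`. In the energy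
with weight `w(k) = |k|^R e^{τ|k|^a}` the cancellation leaves only `w(m+n) - w(n)`, and
`weight_commutator` shows that this difference, multiplied by `|n|`, loses just `a` derivatives in
total, `a/2` on each of two factors (`abs_re_sum_weight_convection_le`). If `τ(t) = τ₁ - Lt`, the
derivative of the weight produces `-L|k|^a` times the energy density, and a large constant `L`
absorbs the loss. Dissipation enters with a good sign and is dropped, so the time and the bounds do
not depend on `κ` or `γ`. This is carried out for Galerkin truncations in `exists_galerkin`.

The second pillar is `l2_stability`. For two families of coefficients under a common summable
majorant with one derivative to spare, the difference obeys a Gronwall estimate, again because the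
term transporting the difference cancels. It is used three times: the truncations are Cauchy
(`exists_spectralSolution`), solutions are unique (`IsGevreySolution.fourierCoef_eq`), and solutions
for `κ` and `0` differ by `O(√κ)` in each coefficient, because `κΛ^γθ` is a small forcing on Gevrey
functions. Interpolating this smallness with the uniform exponential decay gives the limit in a
Gevrey norm of smaller radius (`gevreyNorm_le_of_interpolation`).

The exact Sobolev exponent is immaterial. Half of the initial radius is given up to replace `|k|^r`
by a convenient integer power (`exists_sum_weight_le`), and half of the rest is given up to the
decay in time. Two translation lemmas, `IsGevreySolution.isSpectralSolution` and
`IsSpectralSolution.isGevreySolution`, connect the pointwise equation with the system for the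
coefficients. -/

namespace ActiveScalar

open Filter Topology

/-! ### Lattice frequencies and summability of powers of `|k|`. -/

section Frequencies

variable {d : ℕ}

theorem freqNorm_eq_norm (k : Fin d → ℤ) :
    freqNorm k = ‖(WithLp.toLp 2 (fun i => (k i : ℝ)) : EuclideanSpace ℝ (Fin d))‖ := by
  simp [freqNorm, EuclideanSpace.norm_eq]

theorem freqNorm_nonneg (k : Fin d → ℤ) : 0 ≤ freqNorm k := Real.sqrt_nonneg _

@[simp] theorem freqNorm_zero : freqNorm (0 : Fin d → ℤ) = 0 := by simp [freqNorm]

@[simp] theorem freqNorm_neg (k : Fin d → ℤ) : freqNorm (-k) = freqNorm k := by simp [freqNorm]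

theorem freqNorm_add_le (k l : Fin d → ℤ) : freqNorm (k + l) ≤ freqNorm k + freqNorm l := by
  simp only [freqNorm_eq_norm]
  refine le_trans (le_of_eq ?_) (norm_add_le _ _)
  congr 1
  ext i
  simp

theorem abs_le_freqNorm (k : Fin d → ℤ) (i : Fin d) : |(k i : ℝ)| ≤ freqNorm k := by
  rw [freqNorm_eq_norm]
  simpa using PiLp.norm_apply_le
    (WithLp.toLp 2 (fun i => (k i : ℝ)) : EuclideanSpace ℝ (Fin d)) i

theorem one_le_freqNorm {k : Fin d → ℤ} (hk : k ≠ 0) : 1 ≤ freqNorm k := by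
  obtain ⟨i, hi⟩ := Function.ne_iff.mp hk
  refine le_trans ?_ (abs_le_freqNorm k i)
  exact_mod_cast Int.one_le_abs hi

theorem freqNorm_pos {k : Fin d → ℤ} (hk : k ≠ 0) : 0 < freqNorm k :=
  lt_of_lt_of_le one_pos (one_le_freqNorm hk)

/-- The integer frequencies embed injectively in the lattice spanned by the standard basis of
Euclidean space, which has rank `d`; the general criterion for lattices applies. -/
theorem summable_freqNorm_rpow {p : ℝ} (hp : p < -(d : ℝ)) :
    Summable fun k : Fin d → ℤ => freqNorm k ^ p := by
  classical
  let b := (EuclideanSpace.basisFun (Fin d) ℝ).toBasis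
  let L : Submodule ℤ (EuclideanSpace ℝ (Fin d)) := Submodule.span ℤ (Set.range b)
  have hrank : Module.finrank ℤ L = d := by
    rw [ZLattice.rank ℝ L]; simp
  have hs := ZLattice.summable_norm_rpow L p (by rw [hrank]; exact hp)
  let e : (Fin d → ℤ) → L := fun k => ⟨WithLp.toLp 2 (fun i => (k i : ℝ)), by
    have : (WithLp.toLp 2 (fun i => (k i : ℝ)) : EuclideanSpace ℝ (Fin d)) = ∑ i, k i • b i := by
      ext j
      simp [b, Pi.single_apply]
    rw [this]
    exact Submodule.sum_mem _ fun i _ => Submodule.smul_mem _ _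
      (Submodule.subset_span (Set.mem_range_self i))⟩
  have he : Function.Injective e := by
    intro k l h
    have h' := congrArg (fun z : L => (z : EuclideanSpace ℝ (Fin d))) h
    funext i
    have := congrArg (fun z : EuclideanSpace ℝ (Fin d) => z i) h'
    simpa [e] using this
  refine (hs.comp_injective he).congr fun k => ?_
  simp [e, freqNorm_eq_norm]

end Frequencies

/-! ### Elementary inequalities for exponentials and the commutator of the Gevrey weight. -/

section Exponentials

theorem exists_rpow_le_mul_exp {a b : ℝ} (ha : 0 < a) (hb : 0 < b) (q : ℝ) :
    ∃ C : ℝ, 0 < C ∧ ∀ y : ℝ, 1 ≤ y → y ^ q ≤ C * Real.exp (b * y ^ a) := by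
  set n := ⌈q / a⌉₊
  refine ⟨n.factorial / b ^ n, by positivity, fun y hy => ?_⟩
  have hy0 : 0 < y := by linarith
  have h1 : y ^ q ≤ (y ^ a) ^ n := by
    rw [← Real.rpow_natCast, ← Real.rpow_mul hy0.le]
    refine Real.rpow_le_rpow_of_exponent_le hy ?_
    have := Nat.le_ceil (q / a)
    rw [div_le_iff₀ ha] at this
    linarith
  have h2 := Real.pow_div_factorial_le_exp (b * y ^ a) (by positivity) n
  rw [mul_pow, div_le_iff₀ (by positivity)] at h2
  rw [div_mul_eq_mul_div, le_div_iff₀ (by positivity)]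
  calc y ^ q * b ^ n ≤ (y ^ a) ^ n * b ^ n := by gcongr
    _ ≤ _ := by linarith

theorem summable_freqNorm_rpow_mul_exp {d : ℕ} {a b : ℝ} (ha : 0 < a) (hb : 0 < b) (q : ℝ) :
    Summable fun k : Fin d → ℤ => freqNorm k ^ q * Real.exp (-(b * freqNorm k ^ a)) := by
  obtain ⟨C, hC, h⟩ := exists_rpow_le_mul_exp ha hb (q + (d + 1))
  have hs := (summable_freqNorm_rpow (d := d) (p := -(d + 1)) (by linarith)).mul_left C
  -- The frequency `0` is left out of the comparison, because real powers of `0` follow conventions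
  -- that need not respect it.
  refine Summable.of_norm_bounded_eventually hs ?_
  refine (Set.finite_singleton (0 : Fin d → ℤ)).subset fun k hk => ?_
  by_contra hk0
  refine hk ?_
  have h1 := one_le_freqNorm hk0
  have hp := freqNorm_pos hk0
  have := h _ h1
  rw [Set.mem_ofPred_eq, Real.norm_of_nonneg (by positivity), Real.exp_neg, ← div_eq_mul_inv,
    div_le_iff₀ (Real.exp_pos _), Real.rpow_neg hp.le, ← div_eq_mul_inv, div_mul_eq_mul_div,
    le_div_iff₀ (by positivity), ← Real.rpow_add hp]
  exact this

theorem abs_exp_sub_exp_le (p q : ℝ) :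
    |Real.exp p - Real.exp q| ≤ |p - q| * Real.exp (max p q) := by
  wlog h : q ≤ p generalizing p q
  · rw [abs_sub_comm, abs_sub_comm p, max_comm]
    exact this q p (le_of_not_ge h)
  rw [max_eq_left h, abs_of_nonneg (by linarith [Real.exp_le_exp.mpr h]),
    abs_of_nonneg (by linarith)]
  have := Real.add_one_le_exp (q - p)
  have h2 : Real.exp q = Real.exp (q - p) * Real.exp p := by rw [← Real.exp_add]; ring_nf
  have h3 := Real.exp_pos p
  rw [h2]
  nlinarith

theorem rpow_add_le {a x y z : ℝ} (ha : 0 < a) (ha1 : a ≤ 1) (hx : 0 ≤ x) (hy : 0 ≤ y)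
    (hz : 0 ≤ z) (h : z ≤ x + y) : z ^ a ≤ x ^ a + y ^ a :=
  (Real.rpow_le_rpow hz h ha.le).trans (Real.rpow_add_le_add_rpow hx hy ha.le ha1)

/-- By homogeneity this is `|t^a - 1| ≤ |t - 1|` for `t = z/y`. It is the mean value bound for `y^a`
without any comparability between `y` and `z`. -/
theorem abs_rpow_sub_rpow_mul_le {a y z : ℝ} (ha : 0 < a) (ha1 : a ≤ 1) (hy : 0 < y)
    (hz : 0 < z) : |z ^ a - y ^ a| * y ≤ |z - y| * y ^ a := by
  have hya : 0 < y ^ a := by positivity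
  have key : z ^ a = (z / y) ^ a * y ^ a := by
    rw [← Real.mul_rpow (by positivity) hy.le]; congr 1; field_simp
  have key2 : z = (z / y) * y := by field_simp
  set t := z / y
  have ht : 0 < t := by positivity
  have h1 : |t ^ a - 1| ≤ |t - 1| := by
    rcases le_total 1 t with h | h
    · have := Real.rpow_le_rpow_of_exponent_le h ha1
      rw [Real.rpow_one] at this
      have h2 : 1 ≤ t ^ a := Real.one_le_rpow h ha.le
      rw [abs_of_nonneg (by linarith), abs_of_nonneg (by linarith)]; linarith
    · have := Real.rpow_le_rpow_of_exponent_ge ht h ha1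
      rw [Real.rpow_one] at this
      have h2 : t ^ a ≤ 1 := Real.rpow_le_one ht.le h ha.le
      rw [abs_of_nonpos (by linarith), abs_of_nonpos (by linarith)]; linarith
  have e1 : z ^ a - y ^ a = (t ^ a - 1) * y ^ a := by rw [key]; ring
  have e2 : z - y = (t - 1) * y := by rw [sub_mul, ← key2]; ring
  rw [e1, e2, abs_mul, abs_mul, abs_of_pos hya, abs_of_pos hy]
  calc _ = |t ^ a - 1| * (y ^ a * y) := by ring
    _ ≤ |t - 1| * (y ^ a * y) := by gcongr
    _ = _ := by ring

/-- The weight `y^R e^{τ y^a}`. -/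
noncomputable def weight (a : ℝ) (R : ℕ) (τ y : ℝ) : ℝ := y ^ R * Real.exp (τ * y ^ a)

theorem weight_nonneg (a : ℝ) (R : ℕ) (τ : ℝ) {y : ℝ} (hy : 0 ≤ y) : 0 ≤ weight a R τ y := by
  unfold weight; positivity

/-- Here `x`, `y`, `z` stand for `|m|`, `|n|`, `|m+n|`. If `x ≤ y`, the difference of weights gains
a factor `x/y` on the power and `x y^{a-1}` on the exponential, so multiplication by `y` costs at
most `y^a`; this is split evenly between `y` and `z`. If `y ≤ x`, no cancellation is needed, since
both weights are controlled by the one at `x`. The constant is the sum of those of the two cases. -/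
theorem weight_commutator {a τ₀ : ℝ} (ha : 0 < a) (ha1 : a ≤ 1) (R : ℕ)
    {τ x y z : ℝ} (hτ : 0 ≤ τ) (hττ : τ ≤ τ₀) (hx : 1 ≤ x) (hy : 1 ≤ y) (hz : 1 ≤ z)
    (hzxy : z ≤ x + y) (hyxz : y ≤ x + z) :
    |weight a R τ z - weight a R τ y| * y ≤
      (2 * (R * 2 ^ R + τ₀) + 2 * 2 ^ R) * (z ^ (a / 2) *
        (y ^ (a / 2) * weight a R τ y * (x ^ 2 * Real.exp (τ * x ^ a)) +
          x ^ (a / 2) * weight a R τ x * (y ^ 2 * Real.exp (τ * y ^ a)))) := by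
  have hx0 : 0 < x := by linarith
  have hy0 : 0 < y := by linarith
  have hz0 : 0 < z := by linarith
  have ha2 : 0 < a / 2 := by linarith
  have hτ₀ : 0 ≤ τ₀ := hτ.trans hττ
  set Ex := Real.exp (τ * x ^ a) with hEx
  set Ey := Real.exp (τ * y ^ a) with hEy
  set Ez := Real.exp (τ * z ^ a) with hEz
  have hEx1 : 1 ≤ Ex := Real.one_le_exp (by positivity)
  have hEy1 : 1 ≤ Ey := Real.one_le_exp (by positivity)
  have hEz0 : 0 < Ez := Real.exp_pos _
  have hzE : Ez ≤ Ex * Ey := by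
    rw [hEx, hEy, ← Real.exp_add, ← mul_add]
    exact Real.exp_le_exp.mpr
      (mul_le_mul_of_nonneg_left (rpow_add_le ha ha1 hx0.le hy0.le hz0.le hzxy) hτ)
  have hyE : Ey ≤ Ex * Ey := le_mul_of_one_le_left (by linarith) hEx1
  have hdiff : |z - y| ≤ x := abs_le.mpr ⟨by linarith, by linarith⟩
  have hx2 : 1 ≤ x ^ (a / 2) := Real.one_le_rpow hx ha2.le
  have hy2 : 1 ≤ y ^ (a / 2) := Real.one_le_rpow hy ha2.le
  have hz2 : 1 ≤ z ^ (a / 2) := Real.one_le_rpow hz ha2.le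
  have hwx : weight a R τ x = x ^ R * Ex := rfl
  have hwy : weight a R τ y = y ^ R * Ey := rfl
  have hwz : weight a R τ z = z ^ R * Ez := rfl
  rw [hwx, hwy, hwz]
  rcases le_total x y with hxy | hxy
  · have hya : y ^ a = y ^ (a / 2) * y ^ (a / 2) := by
      rw [← Real.rpow_add hy0]; congr 1; ring
    have hya1 : 1 ≤ y ^ a := Real.one_le_rpow hy ha.le
    -- Half of the loss is moved from `y` to `z` by subadditivity of the power; the price is a
    -- second factor `x`, which explains the `x ^ 2` in the conclusion.
    have hyb : y ^ (a / 2) ≤ 2 * (x * z ^ (a / 2)) := by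
      have h1 := rpow_add_le ha2 (by linarith) hx0.le hz0.le hy0.le hyxz
      have h2 : x ^ (a / 2) ≤ x := by
        simpa using Real.rpow_le_rpow_of_exponent_le hx (show a / 2 ≤ 1 by linarith)
      nlinarith
    have hpow : |z ^ R - y ^ R| * y ≤ x * (R * 2 ^ R * y ^ R) := by
      rcases Nat.eq_zero_or_pos R with hR | hR
      · subst hR; simp
      · have h1 := abs_pow_sub_pow_le z y R
        have h2 : max |z| |y| ≤ 2 * y := by
          rw [abs_of_pos hz0, abs_of_pos hy0]; exact max_le (by linarith) (by linarith)
        have h3 : max |z| |y| ^ (R - 1) ≤ (2 * y) ^ (R - 1) := by gcongr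
        have h4 : (2 * y) ^ (R - 1) * y ≤ 2 ^ R * y ^ R := by
          rw [← mul_pow]
          obtain ⟨n, rfl⟩ : ∃ n, R = n + 1 := ⟨R - 1, by omega⟩
          rw [Nat.add_sub_cancel, pow_succ]
          gcongr; linarith
        calc |z ^ R - y ^ R| * y ≤ (|z - y| * R * max |z| |y| ^ (R - 1)) * y := by gcongr
          _ ≤ (x * R * (2 * y) ^ (R - 1)) * y := by gcongr
          _ = x * (R * ((2 * y) ^ (R - 1) * y)) := by ring
          _ ≤ x * (R * (2 ^ R * y ^ R)) := by gcongr
          _ = _ := by ring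
    have hexp : |Ez - Ey| * y ≤ τ₀ * (x * y ^ a) * (Ex * Ey) := by
      have h1 := abs_exp_sub_exp_le (τ * z ^ a) (τ * y ^ a)
      have h2 : Real.exp (max (τ * z ^ a) (τ * y ^ a)) ≤ Ex * Ey := by
        rcases max_choice (τ * z ^ a) (τ * y ^ a) with h | h <;> rw [h] <;> assumption
      have h3 := abs_rpow_sub_rpow_mul_le ha ha1 hy0 hz0
      calc |Ez - Ey| * y
          ≤ (|τ * z ^ a - τ * y ^ a| * Real.exp (max (τ * z ^ a) (τ * y ^ a))) * y := by gcongr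
        _ = τ * (|z ^ a - y ^ a| * y) * Real.exp (max (τ * z ^ a) (τ * y ^ a)) := by
          rw [← mul_sub, abs_mul, abs_of_nonneg hτ]; ring
        _ ≤ τ₀ * (|z - y| * y ^ a) * (Ex * Ey) := by gcongr
        _ ≤ _ := by gcongr
    have hsplit : |z ^ R * Ez - y ^ R * Ey| ≤ |z ^ R - y ^ R| * Ez + y ^ R * |Ez - Ey| := by
      have : z ^ R * Ez - y ^ R * Ey = (z ^ R - y ^ R) * Ez + y ^ R * (Ez - Ey) := by ring
      rw [this]
      refine (abs_add_le _ _).trans (le_of_eq ?_)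
      rw [abs_mul, abs_mul, abs_of_pos hEz0, abs_of_pos (by positivity : (0 : ℝ) < y ^ R)]
    have hmain : |z ^ R * Ez - y ^ R * Ey| * y ≤
        2 * (R * 2 ^ R + τ₀) * (z ^ (a / 2) * (y ^ (a / 2) * (y ^ R * Ey) * (x ^ 2 * Ex))) := by
      calc |z ^ R * Ez - y ^ R * Ey| * y
          ≤ (|z ^ R - y ^ R| * Ez + y ^ R * |Ez - Ey|) * y := by gcongr
        _ = (|z ^ R - y ^ R| * y) * Ez + y ^ R * (|Ez - Ey| * y) := by ring
        _ ≤ (x * (R * 2 ^ R * y ^ R)) * (Ex * Ey) + y ^ R * (τ₀ * (x * y ^ a) * (Ex * Ey)) := by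
          gcongr
        _ = (R * 2 ^ R * 1 + τ₀ * y ^ a) * (x * y ^ R * (Ex * Ey)) := by ring
        _ ≤ (R * 2 ^ R * y ^ a + τ₀ * y ^ a) * (x * y ^ R * (Ex * Ey)) := by gcongr
        _ = (R * 2 ^ R + τ₀) * (y ^ (a / 2) * y ^ (a / 2)) * (x * y ^ R * (Ex * Ey)) := by
          rw [hya]; ring
        _ ≤ (R * 2 ^ R + τ₀) * ((2 * (x * z ^ (a / 2))) * y ^ (a / 2)) *
            (x * y ^ R * (Ex * Ey)) := by gcongr
        _ = _ := by ring
    refine hmain.trans ?_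
    gcongr
    · linarith [show (0 : ℝ) ≤ 2 * 2 ^ R by positivity]
    · exact le_add_of_nonneg_right (by positivity)
  · have h1 : z ^ R ≤ 2 ^ R * x ^ R := by
      rw [← mul_pow]; gcongr; linarith
    have h2 : y ^ R ≤ 2 ^ R * x ^ R := by
      rw [← mul_pow]; gcongr; linarith
    have habs : |z ^ R * Ez - y ^ R * Ey| ≤ 2 * 2 ^ R * (x ^ R * (Ex * Ey)) := by
      calc |z ^ R * Ez - y ^ R * Ey| ≤ z ^ R * Ez + y ^ R * Ey := by
            refine (abs_sub _ _).trans (le_of_eq ?_)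
            rw [abs_of_pos (by positivity), abs_of_pos (by positivity)]
        _ ≤ 2 ^ R * x ^ R * (Ex * Ey) + 2 ^ R * x ^ R * (Ex * Ey) := by gcongr
        _ = _ := by ring
    have hmain : |z ^ R * Ez - y ^ R * Ey| * y ≤
        2 * 2 ^ R * (z ^ (a / 2) * (x ^ (a / 2) * (x ^ R * Ex) * (y ^ 2 * Ey))) := by
      calc |z ^ R * Ez - y ^ R * Ey| * y ≤ 2 * 2 ^ R * (x ^ R * (Ex * Ey)) * y := by gcongr
        _ = 2 * 2 ^ R * (1 * (1 * (x ^ R * Ex) * (y * 1 * Ey))) := by ring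
        _ ≤ 2 * 2 ^ R * (z ^ (a / 2) * (x ^ (a / 2) * (x ^ R * Ex) * (y * y * Ey))) := by gcongr
        _ = _ := by ring
    refine hmain.trans ?_
    gcongr
    · have : (0 : ℝ) ≤ 2 * (R * 2 ^ R + τ₀) := by positivity
      linarith
    · exact le_add_of_nonneg_left (by positivity)

end Exponentials

end ActiveScalar

namespace ActiveScalar

open Filter Topology ComplexConjugate

/-! ### Transport kernels, the cancellation, and Young inequalities on the lattice. -/

section Kernels

variable {d : ℕ}

/-- The algebraic properties of the symbol `q(m,n) = ∑_j a_j(m) i n_j` of `u·∇`, where `u` is a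
divergence-free real multiplier of order zero. -/
structure IsTransportKernel (q : (Fin d → ℤ) → (Fin d → ℤ) → ℂ) (A : ℝ) : Prop where
  nonneg : 0 ≤ A
  neg_left : ∀ m n, q (-m) n = -conj (q m n)
  add_right : ∀ m n, q m (m + n) = q m n
  norm_le : ∀ m n, ‖q m n‖ ≤ A * freqNorm n

/-- The Fourier coefficients of `u[θ]·∇φ` in terms of those of `θ` and `φ`. -/
noncomputable def convection (q : (Fin d → ℤ) → (Fin d → ℤ) → ℂ) (θ φ : (Fin d → ℤ) → ℂ)
    (k : Fin d → ℤ) : ℂ :=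
  ∑' m, q m (k - m) * θ m * φ (k - m)

/-- The change of variables `(m, n) ↦ (m, m + n)`. -/
def shear (G : Type*) [AddCommGroup G] : G × G ≃ G × G where
  toFun p := (p.1, p.1 + p.2)
  invFun p := (p.1, p.2 - p.1)
  left_inv p := by simp
  right_inv p := by simp

/-- The change of variables `(k, m) ↦ (m, k - m)`. -/
def splitFreq (G : Type*) [AddCommGroup G] : G × G ≃ G × G where
  toFun p := (p.2, p.1 - p.2)
  invFun p := (p.1 + p.2, p.1)
  left_inv p := by simp
  right_inv p := by simp

/-- The involution `(m, n) ↦ (-m, m + n)`. -/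
def flipFreq (G : Type*) [AddCommGroup G] : G × G ≃ G × G where
  toFun p := (-p.1, p.1 + p.2)
  invFun p := (-p.1, p.1 + p.2)
  left_inv p := by simp
  right_inv p := by simp

variable {q : (Fin d → ℤ) → (Fin d → ℤ) → ℂ} {A : ℝ}

namespace IsTransportKernel

/-- This is `u·∇φ = div(uφ)`: the derivative may be placed on the output frequency, so that
convection makes sense for merely summable coefficients. -/
theorem norm_le_sub (hq : IsTransportKernel q A) (k m : Fin d → ℤ) :
    ‖q m (k - m)‖ ≤ A * freqNorm k := by
  rw [← hq.add_right, add_sub_cancel]; exact hq.norm_le m k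

/-- The involution `(m,n) ↦ (-m,m+n)` exchanges `n` with `m+n` and sends each summand to minus its
conjugate, so the sum is purely imaginary. Only `θ` must come from a real function; `φ` is
arbitrary. -/
theorem re_tsum_eq_zero (hq : IsTransportKernel q A) {θ : (Fin d → ℤ) → ℂ}
    (hθ : ∀ k, θ (-k) = conj (θ k)) (φ : (Fin d → ℤ) → ℂ) :
    (∑' p : (Fin d → ℤ) × (Fin d → ℤ), conj (φ (p.1 + p.2)) * (q p.1 p.2 * θ p.1 * φ p.2)).re
      = 0 := by
  set f : (Fin d → ℤ) × (Fin d → ℤ) → ℂ :=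
    fun p => conj (φ (p.1 + p.2)) * (q p.1 p.2 * θ p.1 * φ p.2)
  have h1 : ∀ p, f (flipFreq _ p) = -conj (f p) := by
    rintro ⟨m, n⟩
    simp only [f, flipFreq, Equiv.coe_fn_mk, neg_add_cancel_left, hq.neg_left, hq.add_right, hθ,
      map_mul, Complex.conj_conj]
    ring
  have h2 : ∑' p, f p = -conj (∑' p, f p) := by
    calc ∑' p, f p = ∑' p, f (flipFreq _ p) := ((flipFreq (Fin d → ℤ)).tsum_eq f).symm
      _ = -conj (∑' p, f p) := by rw [tsum_congr h1, tsum_neg, Complex.conj_tsum]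
  have h3 := congrArg Complex.re h2
  simp only [Complex.neg_re, Complex.conj_re] at h3
  linarith

end IsTransportKernel

theorem tsum_tsum_sub_eq {f : (Fin d → ℤ) × (Fin d → ℤ) → ℂ} (hf : Summable f) :
    Summable (fun k => ∑' m, f (m, k - m)) ∧ ∑' k, ∑' m, f (m, k - m) = ∑' p, f p := by
  have hs : Summable (fun p => f (splitFreq _ p)) := (splitFreq (Fin d → ℤ)).summable_iff.mpr hf
  refine ⟨hs.prod, ?_⟩
  rw [← (splitFreq (Fin d → ℤ)).tsum_eq f, hs.tsum_prod]
  rfl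

theorem summable_mul_shear {V X : (Fin d → ℤ) → ℝ} (hV0 : ∀ k, 0 ≤ V k) (hX0 : ∀ k, 0 ≤ X k)
    (hV : Summable V) (hX : Summable X) :
    Summable (fun p : (Fin d → ℤ) × (Fin d → ℤ) => V p.1 * X (p.1 + p.2)) ∧
      ∑' p : (Fin d → ℤ) × (Fin d → ℤ), V p.1 * X (p.1 + p.2) = (∑' k, V k) * ∑' k, X k := by
  have hs := hV.mul_of_nonneg hX hV0 hX0
  refine ⟨(shear (Fin d → ℤ)).summable_iff.mpr hs, ?_⟩
  rw [hV.tsum_mul_tsum hX hs]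
  exact (shear (Fin d → ℤ)).tsum_eq (fun p : (Fin d → ℤ) × (Fin d → ℤ) => V p.1 * X p.2)

/-- From `XX' ≤ (X² + X'²)/2` and invariance of the double sum under the shear: one factor in `ℓ¹`
and two in `ℓ²`. -/
theorem summable_young {V X : (Fin d → ℤ) → ℝ} (hV0 : ∀ k, 0 ≤ V k) (hX0 : ∀ k, 0 ≤ X k)
    (hV : Summable V) (hX : Summable fun k => X k ^ 2) :
    Summable (fun p : (Fin d → ℤ) × (Fin d → ℤ) => V p.1 * (X (p.1 + p.2) * X p.2)) ∧
      ∑' p : (Fin d → ℤ) × (Fin d → ℤ), V p.1 * (X (p.1 + p.2) * X p.2) ≤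
        (∑' k, V k) * ∑' k, X k ^ 2 := by
  obtain ⟨h1, h1'⟩ := summable_mul_shear hV0 (fun k => sq_nonneg (X k)) hV hX
  have h2 := hV.mul_of_nonneg hX hV0 (fun k => sq_nonneg (X k))
  have h2' := hV.tsum_mul_tsum hX h2
  have h3 := (h1.mul_left (1 / 2)).add (h2.mul_left (1 / 2))
  have hle : ∀ p : (Fin d → ℤ) × (Fin d → ℤ), V p.1 * (X (p.1 + p.2) * X p.2) ≤
      1 / 2 * (V p.1 * X (p.1 + p.2) ^ 2) + 1 / 2 * (V p.1 * X p.2 ^ 2) := fun p => by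
    nlinarith [mul_nonneg (hV0 p.1) (sq_nonneg (X (p.1 + p.2) - X p.2))]
  have hs := Summable.of_nonneg_of_le
    (fun p => mul_nonneg (hV0 _) (mul_nonneg (hX0 _) (hX0 _))) hle h3
  refine ⟨hs, (hs.tsum_le_tsum hle h3).trans (le_of_eq ?_)⟩
  rw [(h1.mul_left (1 / 2)).tsum_add (h2.mul_left (1 / 2)), tsum_mul_left, tsum_mul_left, h1',
    ← h2']
  ring

theorem summable_young_swap {V X : (Fin d → ℤ) → ℝ} (hV0 : ∀ k, 0 ≤ V k) (hX0 : ∀ k, 0 ≤ X k)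
    (hV : Summable V) (hX : Summable fun k => X k ^ 2) :
    Summable (fun p : (Fin d → ℤ) × (Fin d → ℤ) => V p.2 * (X (p.1 + p.2) * X p.1)) ∧
      ∑' p : (Fin d → ℤ) × (Fin d → ℤ), V p.2 * (X (p.1 + p.2) * X p.1) ≤
        (∑' k, V k) * ∑' k, X k ^ 2 := by
  obtain ⟨h1, h2⟩ := summable_young hV0 hX0 hV hX
  have e : (fun p : (Fin d → ℤ) × (Fin d → ℤ) => V p.2 * (X (p.1 + p.2) * X p.1)) =
      (fun p : (Fin d → ℤ) × (Fin d → ℤ) => V p.1 * (X (p.1 + p.2) * X p.2)) ∘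
        Equiv.prodComm _ _ := by
    funext p; simp [add_comm]
  rw [e]
  refine ⟨(Equiv.prodComm _ _).summable_iff.mpr h1, le_trans (le_of_eq ?_) h2⟩
  exact (Equiv.prodComm (Fin d → ℤ) (Fin d → ℤ)).tsum_eq
    (fun p : (Fin d → ℤ) × (Fin d → ℤ) => V p.1 * (X (p.1 + p.2) * X p.2))

end Kernels

/-! ### Bounds for the convection term under a summable majorant. -/

section Bounds

variable {d : ℕ} {q : (Fin d → ℤ) → (Fin d → ℤ) → ℂ} {A : ℝ} {D D' : (Fin d → ℤ) → ℝ}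
  {θ φ : (Fin d → ℤ) → ℂ}

theorem summable_convolution (hD0 : ∀ k, 0 ≤ D k) (hD : Summable D) (hD0' : ∀ k, 0 ≤ D' k)
    (hD' : Summable D') (k : Fin d → ℤ) :
    Summable (fun m => D m * D' (k - m)) ∧
      ∑' m, D m * D' (k - m) ≤ (∑' m, D m) * ∑' m, D' m := by
  have hle : ∀ m, D m * D' (k - m) ≤ D m * ∑' n, D' n := fun m =>
    mul_le_mul_of_nonneg_left (hD'.le_tsum _ fun n _ => hD0' n) (hD0 m)
  have hs := Summable.of_nonneg_of_le (fun m => mul_nonneg (hD0 m) (hD0' _)) hle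
    (hD.mul_right _)
  exact ⟨hs, (hs.tsum_le_tsum hle (hD.mul_right _)).trans (le_of_eq tsum_mul_right)⟩

theorem norm_convection_term_le (hq : IsTransportKernel q A)
    (hθ : ∀ k, ‖θ k‖ ≤ D k) (hφ : ∀ k, ‖φ k‖ ≤ D' k) (k m : Fin d → ℤ) :
    ‖q m (k - m) * θ m * φ (k - m)‖ ≤ A * freqNorm k * (D m * D' (k - m)) := by
  rw [norm_mul, norm_mul, mul_assoc]
  have := hq.norm_le_sub k m
  have h1 := hq.nonneg
  have h2 := freqNorm_nonneg k
  gcongr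
  · exact (norm_nonneg _).trans (hθ m)
  · exact hθ m
  · exact hφ _

theorem summable_convection (hq : IsTransportKernel q A) (hD : Summable D) (hD' : Summable D')
    (hθ : ∀ k, ‖θ k‖ ≤ D k) (hφ : ∀ k, ‖φ k‖ ≤ D' k) (k : Fin d → ℤ) :
    Summable fun m => q m (k - m) * θ m * φ (k - m) :=
  Summable.of_norm_bounded ((summable_convolution (fun k => (norm_nonneg _).trans (hθ k)) hD
    (fun k => (norm_nonneg _).trans (hφ k)) hD' k).1.mul_left _)
    (norm_convection_term_le hq hθ hφ k)

theorem norm_convection_le (hq : IsTransportKernel q A) (hD : Summable D) (hD' : Summable D')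
    (hθ : ∀ k, ‖θ k‖ ≤ D k) (hφ : ∀ k, ‖φ k‖ ≤ D' k) (k : Fin d → ℤ) :
    ‖convection q θ φ k‖ ≤ A * freqNorm k * ∑' m, D m * D' (k - m) := by
  have h := (summable_convolution (fun k => (norm_nonneg _).trans (hθ k)) hD
    (fun k => (norm_nonneg _).trans (hφ k)) hD' k).1
  refine (tsum_of_norm_bounded ((h.mul_left (A * freqNorm k)).hasSum)
    (norm_convection_term_le hq hθ hφ k)).trans (le_of_eq tsum_mul_left)

theorem norm_convection_le' (hq : IsTransportKernel q A) (hD : Summable D) (hD' : Summable D')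
    (hθ : ∀ k, ‖θ k‖ ≤ D k) (hφ : ∀ k, ‖φ k‖ ≤ D' k) (k : Fin d → ℤ) :
    ‖convection q θ φ k‖ ≤ A * freqNorm k * ((∑' m, D m) * ∑' m, D' m) :=
  (norm_convection_le hq hD hD' hθ hφ k).trans (mul_le_mul_of_nonneg_left
    (summable_convolution (fun k => (norm_nonneg _).trans (hθ k)) hD
    (fun k => (norm_nonneg _).trans (hφ k)) hD' k).2
    (mul_nonneg hq.nonneg (freqNorm_nonneg k)))

/-- The triangle inequality `|k| ≤ |m| + |k-m|` puts the derivative on one of the two factors. -/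
theorem summable_freqNorm_mul_convolution (hD0 : ∀ k, 0 ≤ D k) (hD : Summable D)
    (hD1 : Summable fun k => freqNorm k * D k) :
    Summable fun k => freqNorm k * ∑' m, D m * D (k - m) := by
  have hnn : ∀ k, 0 ≤ freqNorm k * D k := fun k => mul_nonneg (freqNorm_nonneg k) (hD0 k)
  have h1 := hD1.mul_of_nonneg hD hnn hD0
  have h2 := hD.mul_of_nonneg hD1 hD0 hnn
  have h3 : Summable (fun p : (Fin d → ℤ) × (Fin d → ℤ) =>
      freqNorm (p.1 + p.2) * (D p.1 * D p.2)) := by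
    refine Summable.of_nonneg_of_le (fun p => mul_nonneg (freqNorm_nonneg _)
      (mul_nonneg (hD0 _) (hD0 _))) (fun p => ?_) (h1.add h2)
    have := mul_le_mul_of_nonneg_right (freqNorm_add_le p.1 p.2)
      (mul_nonneg (hD0 p.1) (hD0 p.2))
    refine this.trans (le_of_eq (by ring))
  have h4 := ((splitFreq (Fin d → ℤ)).summable_iff.mpr h3).prod
  refine h4.congr fun k => ?_
  rw [← tsum_mul_left]
  refine tsum_congr fun m => ?_
  simp [splitFreq]

theorem convection_sub (hq : IsTransportKernel q A) (hD : Summable D) {c₁ c₂ : (Fin d → ℤ) → ℂ}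
    (h₁ : ∀ k, ‖c₁ k‖ ≤ D k) (h₂ : ∀ k, ‖c₂ k‖ ≤ D k) (k : Fin d → ℤ) :
    convection q c₁ c₁ k - convection q c₂ c₂ k =
      convection q (fun k => c₁ k - c₂ k) c₁ k + convection q c₂ (fun k => c₁ k - c₂ k) k := by
  have hδ : ∀ k, ‖c₁ k - c₂ k‖ ≤ 2 * D k := fun k =>
    (norm_sub_le _ _).trans (by linarith [h₁ k, h₂ k])
  unfold convection
  rw [← (summable_convection hq hD hD h₁ h₁ k).tsum_sub (summable_convection hq hD hD h₂ h₂ k),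
    ← (summable_convection hq (hD.mul_left 2) hD hδ h₁ k).tsum_add
      (summable_convection hq hD (hD.mul_left 2) h₂ hδ k)]
  exact tsum_congr fun m => by ring

/-- Oddness of `q` in the second variable, together with `neg_left`, gives `q(-m,-n) = conj q(m,n)`:
convection of real functions is real. -/
theorem conj_convection (hq : IsTransportKernel q A) (θ φ : (Fin d → ℤ) → ℂ)
    (hθ : ∀ k, θ (-k) = conj (θ k)) (hφ : ∀ k, φ (-k) = conj (φ k))
    (hneg : ∀ m n, q m (-n) = - q m n) (k : Fin d → ℤ) :
    convection q θ φ (-k) = conj (convection q θ φ k) := by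
  unfold convection
  rw [Complex.conj_tsum, ← (Equiv.neg (Fin d → ℤ)).tsum_eq]
  refine tsum_congr fun m => ?_
  have : -k - -m = -(k - m) := by abel
  simp only [Equiv.neg_apply, this, hneg, hq.neg_left, hθ, hφ, map_mul]
  ring

/-- The `L²` estimate for the difference of two transport terms. -/
theorem abs_re_tsum_convection_sub_le (hq : IsTransportKernel q A) (hD : Summable D)
    (hD1 : Summable fun k => freqNorm k * D k) {c₁ c₂ : (Fin d → ℤ) → ℂ}
    (h₁ : ∀ k, ‖c₁ k‖ ≤ D k) (h₂ : ∀ k, ‖c₂ k‖ ≤ D k) (hc₂ : ∀ k, c₂ (-k) = conj (c₂ k)) :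
    |(∑' k, conj (c₁ k - c₂ k) * (convection q c₁ c₁ k - convection q c₂ c₂ k)).re| ≤
      A * (∑' k, freqNorm k * D k) * ∑' k, ‖c₁ k - c₂ k‖ ^ 2 := by
  set δ : (Fin d → ℤ) → ℂ := fun k => c₁ k - c₂ k
  have hD0 : ∀ k, 0 ≤ D k := fun k => (norm_nonneg _).trans (h₁ k)
  have hδ : ∀ k, ‖δ k‖ ≤ 2 * D k := fun k =>
    (norm_sub_le _ _).trans (by linarith [h₁ k, h₂ k])
  have hδS : ∀ k, ‖δ k‖ ≤ 2 * ∑' k, D k := fun k => (hδ k).trans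
    (mul_le_mul_of_nonneg_left (hD.le_tsum _ fun n _ => hD0 n) two_pos.le)
  have hδ2 : Summable fun k => ‖δ k‖ ^ 2 := by
    refine Summable.of_nonneg_of_le (fun k => sq_nonneg _) (fun k => ?_)
      ((hD.mul_left 2).mul_left (2 * ∑' k, D k))
    rw [sq]
    exact mul_le_mul (hδS k) (hδ k) (norm_nonneg _) ((norm_nonneg _).trans (hδS k))
  have hnn : ∀ k, 0 ≤ freqNorm k * D k := fun k => mul_nonneg (freqNorm_nonneg k) (hD0 k)
  set f : (Fin d → ℤ) × (Fin d → ℤ) → ℂ :=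
    fun p => conj (δ (p.1 + p.2)) * (q p.1 p.2 * δ p.1 * c₁ p.2) with hf
  set g : (Fin d → ℤ) × (Fin d → ℤ) → ℂ :=
    fun p => conj (δ (p.1 + p.2)) * (q p.1 p.2 * c₂ p.1 * δ p.2) with hg
  have hA := hq.nonneg
  obtain ⟨hy1, hy2⟩ := summable_young_swap hnn (fun k => norm_nonneg (δ k)) hD1 hδ2
  have hfb : ∀ p, ‖f p‖ ≤ A * (freqNorm p.2 * D p.2 * (‖δ (p.1 + p.2)‖ * ‖δ p.1‖)) := fun p => by
    simp only [hf, norm_mul, RCLike.norm_conj]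
    have e1 := hq.norm_le p.1 p.2
    have e2 := h₁ p.2
    have e3 := freqNorm_nonneg p.2
    calc ‖δ (p.1 + p.2)‖ * (‖q p.1 p.2‖ * ‖δ p.1‖ * ‖c₁ p.2‖)
        ≤ ‖δ (p.1 + p.2)‖ * (A * freqNorm p.2 * ‖δ p.1‖ * D p.2) := by gcongr
      _ = _ := by ring
  have hfs : Summable f := Summable.of_norm_bounded (hy1.mul_left A) hfb
  -- This bound serves only to justify rearranging the sum; its size is irrelevant, since the real
  -- part of the sum of `g` is zero.
  have hgs : Summable g := by
    have := (hD.mul_of_nonneg hD1 hD0 hnn).mul_left (2 * (∑' k, D k) * A * 2)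
    refine Summable.of_norm_bounded this fun p => ?_
    simp only [hg, norm_mul, RCLike.norm_conj]
    have e1 := hq.norm_le p.1 p.2
    have e2 := h₂ p.1
    have e3 := freqNorm_nonneg p.2
    have e4 := hδ p.2
    have e5 := hδS (p.1 + p.2)
    have e6 := hD0 p.1
    calc ‖δ (p.1 + p.2)‖ * (‖q p.1 p.2‖ * ‖c₂ p.1‖ * ‖δ p.2‖)
        ≤ (2 * ∑' k, D k) * (A * freqNorm p.2 * D p.1 * (2 * D p.2)) := by
          gcongr
          exact (norm_nonneg _).trans e5
      _ = _ := by ring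
  obtain ⟨hf1, hf2⟩ := tsum_tsum_sub_eq hfs
  obtain ⟨hg1, hg2⟩ := tsum_tsum_sub_eq hgs
  have hsum : ∑' k, conj (δ k) * (convection q c₁ c₁ k - convection q c₂ c₂ k) =
      ∑' p, f p + ∑' p, g p := by
    rw [← hf2, ← hg2, ← hf1.tsum_add hg1]
    refine tsum_congr fun k => ?_
    rw [convection_sub hq hD h₁ h₂, mul_add]
    simp only [convection, ← tsum_mul_left, hf, hg, add_sub_cancel]
    rfl
  -- `g` is the transport of the difference by the second solution and drops out. In `f` the
  -- derivative falls on `c₁`, which has one to spare.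
  rw [hsum, Complex.add_re, hq.re_tsum_eq_zero hc₂ δ, add_zero]
  refine (Complex.abs_re_le_norm _).trans ?_
  refine (tsum_of_norm_bounded (hy1.mul_left A).hasSum hfb).trans ?_
  rw [tsum_mul_left, mul_assoc]
  exact mul_le_mul_of_nonneg_left hy2 hA

end Bounds

/-! ### The Gevrey energy estimate for the transport term. -/

section Gevrey

variable {d : ℕ} {q : (Fin d → ℤ) → (Fin d → ℤ) → ℂ} {A : ℝ}

/-- The energy estimate for the transport term in Gevrey classes; by the cancellation of the top
order part only `a` derivatives are lost in total. -/
theorem abs_re_sum_weight_convection_le (hq : IsTransportKernel q A) {a τ₀ τ : ℝ} (ha : 0 < a)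
    (ha1 : a ≤ 1) (R : ℕ) (hτ : 0 ≤ τ) (hττ : τ ≤ τ₀) {F : Finset (Fin d → ℤ)}
    (hF : (0 : Fin d → ℤ) ∉ F) {θ : (Fin d → ℤ) → ℂ} (hθF : ∀ k, k ∉ F → θ k = 0)
    (hθ : ∀ k, θ (-k) = conj (θ k)) :
    |(∑ k ∈ F, ((weight a R τ (freqNorm k) ^ 2 : ℝ) : ℂ) *
        (conj (θ k) * convection q θ θ k)).re| ≤
      A * (2 * (R * 2 ^ R + τ₀) + 2 * 2 ^ R) *
        (2 * ((∑ k ∈ F, freqNorm k ^ 2 * Real.exp (τ * freqNorm k ^ a) * ‖θ k‖) *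
          ∑ k ∈ F, freqNorm k ^ a * (weight a R τ (freqNorm k) ^ 2 * ‖θ k‖ ^ 2))) := by
  classical
  set w : (Fin d → ℤ) → ℝ := fun k => weight a R τ (freqNorm k) with hw
  have hw0 : ∀ k, 0 ≤ w k := fun k => weight_nonneg _ _ _ (freqNorm_nonneg k)
  set C : ℝ := 2 * (R * 2 ^ R + τ₀) + 2 * 2 ^ R with hC
  have hC0 : 0 ≤ C := by have := hτ.trans hττ; positivity
  have hA := hq.nonneg
  set φ : (Fin d → ℤ) → ℂ := fun k => (w k : ℂ) * θ k with hφ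
  set V : (Fin d → ℤ) → ℝ := fun k => freqNorm k ^ 2 * Real.exp (τ * freqNorm k ^ a) * ‖θ k‖
    with hV
  set Z : (Fin d → ℤ) → ℝ := fun k => freqNorm k ^ (a / 2) * w k * ‖θ k‖ with hZ
  have hV0 : ∀ k, 0 ≤ V k := fun k => by positivity
  have hZ0 : ∀ k, 0 ≤ Z k := fun k =>
    mul_nonneg (mul_nonneg (Real.rpow_nonneg (freqNorm_nonneg k) _) (hw0 k)) (norm_nonneg _)
  have hVF : ∀ k, k ∉ F → V k = 0 := fun k hk => by simp [hV, hθF k hk]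
  have hZF : ∀ k, k ∉ F → Z k ^ 2 = 0 := fun k hk => by simp [hZ, hθF k hk]
  have hVs : Summable V := summable_of_ne_finset_zero (s := F) (fun k hk => hVF k hk)
  have hZs : Summable fun k => Z k ^ 2 := summable_of_ne_finset_zero (s := F)
    (fun k hk => hZF k hk)
  have hVt : ∑' k, V k = ∑ k ∈ F, V k := tsum_eq_sum (fun k hk => hVF k hk)
  have hZt : ∑' k, Z k ^ 2 = ∑ k ∈ F, freqNorm k ^ a * (w k ^ 2 * ‖θ k‖ ^ 2) := by
    rw [tsum_eq_sum (s := F) (fun k hk => hZF k hk)]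
    refine Finset.sum_congr rfl fun k hk => ?_
    have hk0 : 0 < freqNorm k := freqNorm_pos (fun h => hF (h ▸ hk))
    have : freqNorm k ^ a = freqNorm k ^ (a / 2) * freqNorm k ^ (a / 2) := by
      rw [← Real.rpow_add hk0]; congr 1; ring
    rw [this]; simp only [hZ]; ring
  set f : (Fin d → ℤ) × (Fin d → ℤ) → ℂ := fun p =>
    (w (p.1 + p.2) : ℂ) ^ 2 * (conj (θ (p.1 + p.2)) * (q p.1 p.2 * θ p.1 * θ p.2)) with hf
  set g : (Fin d → ℤ) × (Fin d → ℤ) → ℂ := fun p =>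
    conj (φ (p.1 + p.2)) * (q p.1 p.2 * θ p.1 * φ p.2) with hg
  have hsupp : ∀ p : (Fin d → ℤ) × (Fin d → ℤ), p ∉ F ×ˢ F → θ p.1 = 0 ∨ θ p.2 = 0 := by
    intro p hp
    by_contra! h
    exact hp (Finset.mem_product.mpr ⟨by_contra fun h' => h.1 (hθF _ h'),
      by_contra fun h' => h.2 (hθF _ h')⟩)
  have hfs : Summable f := by
    refine summable_of_ne_finset_zero (s := F ×ˢ F) fun p hp => ?_
    rcases hsupp p hp with h | h <;> simp [hf, h]
  have hgs : Summable g := by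
    refine summable_of_ne_finset_zero (s := F ×ˢ F) fun p hp => ?_
    rcases hsupp p hp with h | h <;> simp [hg, hφ, h]
  have hsum : ∑ k ∈ F, ((w k ^ 2 : ℝ) : ℂ) * (conj (θ k) * convection q θ θ k) = ∑' p, f p := by
    rw [← (tsum_tsum_sub_eq hfs).2]
    refine (tsum_eq_sum (L := .unconditional _) (s := F)
      (f := fun k => ((w k ^ 2 : ℝ) : ℂ) * (conj (θ k) * convection q θ θ k)) ?_).symm.trans ?_
    · intro k hk; simp [hθF k hk]
    · refine tsum_congr fun k => ?_
      simp only [convection, hf, add_sub_cancel, tsum_mul_left]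
      push_cast
      rfl
  -- Subtracting `g`, the weighted form in which the weight sits on the transported factor, changes
  -- nothing in the real part and turns the weight into the commutator `w(m+n) - w(n)`.
  have hre : (∑' p, f p).re = (∑' p, (f p - g p)).re := by
    rw [hfs.tsum_sub hgs, Complex.sub_re, hq.re_tsum_eq_zero hθ φ, sub_zero]
  obtain ⟨hy1, hy1'⟩ := summable_young hV0 hZ0 hVs hZs
  obtain ⟨hy2, hy2'⟩ := summable_young_swap hV0 hZ0 hVs hZs
  have hb : ∀ p, ‖f p - g p‖ ≤
      A * C * (V p.1 * (Z (p.1 + p.2) * Z p.2) + V p.2 * (Z (p.1 + p.2) * Z p.1)) := by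
    intro p
    have hrhs : 0 ≤ A * C *
        (V p.1 * (Z (p.1 + p.2) * Z p.2) + V p.2 * (Z (p.1 + p.2) * Z p.1)) := by
      have e1 := hV0 p.1
      have e2 := hV0 p.2
      have e3 := hZ0 p.1
      have e4 := hZ0 p.2
      have e5 := hZ0 (p.1 + p.2)
      positivity
    have hfg : f p - g p = conj (φ (p.1 + p.2)) * (q p.1 p.2 * θ p.1 *
        (((w (p.1 + p.2) - w p.2 : ℝ) : ℂ) * θ p.2)) := by
      simp only [hf, hg, hφ, map_mul, Complex.conj_ofReal]; push_cast; ring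
    by_cases hz : θ p.1 = 0 ∨ θ p.2 = 0 ∨ θ (p.1 + p.2) = 0
    · have : f p - g p = 0 := by
        rw [hfg]; rcases hz with h | h | h <;> simp [h, hφ]
      rw [this, norm_zero]; exact hrhs
    · push Not at hz
      have hne : ∀ k, θ k ≠ 0 → k ≠ 0 := fun k hk h => hk (hθF k (h ▸ hF))
      have hcomm := weight_commutator ha ha1 R hτ hττ (one_le_freqNorm (hne _ hz.1))
        (one_le_freqNorm (hne _ hz.2.1)) (one_le_freqNorm (hne _ hz.2.2))
        (freqNorm_add_le p.1 p.2) (by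
          have := freqNorm_add_le (-p.1) (p.1 + p.2)
          rwa [neg_add_cancel_left, freqNorm_neg] at this)
      rw [hfg]
      simp only [norm_mul, RCLike.norm_conj, Complex.norm_real, hφ, Real.norm_eq_abs,
        abs_of_nonneg (hw0 _)]
      have e1 := hq.norm_le p.1 p.2
      have e2 := hw0 (p.1 + p.2)
      calc w (p.1 + p.2) * ‖θ (p.1 + p.2)‖ * (‖q p.1 p.2‖ * ‖θ p.1‖ *
            (|w (p.1 + p.2) - w p.2| * ‖θ p.2‖))
          ≤ w (p.1 + p.2) * ‖θ (p.1 + p.2)‖ * (A * freqNorm p.2 * ‖θ p.1‖ *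
            (|w (p.1 + p.2) - w p.2| * ‖θ p.2‖)) := by gcongr
        _ = A * w (p.1 + p.2) * ‖θ (p.1 + p.2)‖ * ‖θ p.1‖ * ‖θ p.2‖ *
            (|w (p.1 + p.2) - w p.2| * freqNorm p.2) := by ring
        _ ≤ A * w (p.1 + p.2) * ‖θ (p.1 + p.2)‖ * ‖θ p.1‖ * ‖θ p.2‖ *
            (C * (freqNorm (p.1 + p.2) ^ (a / 2) *
              (freqNorm p.2 ^ (a / 2) * w p.2 *
                  (freqNorm p.1 ^ 2 * Real.exp (τ * freqNorm p.1 ^ a)) +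
                freqNorm p.1 ^ (a / 2) * w p.1 *
                  (freqNorm p.2 ^ 2 * Real.exp (τ * freqNorm p.2 ^ a))))) :=
            mul_le_mul_of_nonneg_left hcomm (by positivity)
        _ = _ := by simp only [hV, hZ]; ring
  rw [hsum, hre]
  refine (Complex.abs_re_le_norm _).trans ?_
  refine (tsum_of_norm_bounded ((hy1.add hy2).mul_left (A * C)).hasSum hb).trans ?_
  rw [tsum_mul_left, hy1.tsum_add hy2, ← hZt, ← hVt]
  refine mul_le_mul_of_nonneg_left ?_ (mul_nonneg hA hC0)
  linarith

end Gevrey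

end ActiveScalar

namespace ActiveScalar

open Filter Topology ComplexConjugate Set

/-! ### Stability of the spectral equation in `ℓ²`. -/

section Stability

variable {d : ℕ} {q : (Fin d → ℤ) → (Fin d → ℤ) → ℂ} {A : ℝ}

/-- `L²` stability of `c' = -λ c - B(c,c) + S` under perturbations of the equation and of the
initial data that are bounded by `η`. -/
theorem l2_stability (hq : IsTransportKernel q A) {D η lam : (Fin d → ℤ) → ℝ} (hD : Summable D)
    (hD1 : Summable fun k => freqNorm k * D k) (hlam : ∀ k, 0 ≤ lam k)
    (hDlam : Summable fun k => lam k * D k) (hη : Summable η) {T : ℝ}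
    {c₁ c₂ e : ℝ → (Fin d → ℤ) → ℂ}
    (h₁ : ∀ t ∈ Icc 0 T, ∀ k, ‖c₁ t k‖ ≤ D k) (h₂ : ∀ t ∈ Icc 0 T, ∀ k, ‖c₂ t k‖ ≤ D k)
    (hreal : ∀ t ∈ Icc 0 T, ∀ k, c₂ t (-k) = conj (c₂ t k))
    (hcont : ∀ k, ContinuousOn (fun t => c₁ t k - c₂ t k) (Icc 0 T))
    (hderiv : ∀ t ∈ Ioo 0 T, ∀ k, HasDerivAt (fun t => c₁ t k - c₂ t k)
      (-(lam k * (c₁ t k - c₂ t k)) - (convection q (c₁ t) (c₁ t) k - convection q (c₂ t) (c₂ t) k)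
        + e t k) t)
    (he : ∀ t ∈ Ioo 0 T, ∀ k, ‖e t k‖ ≤ η k) (h0 : ∀ k, ‖c₁ 0 k - c₂ 0 k‖ ≤ η k) :
    ∀ t ∈ Icc 0 T, ∀ k, ‖c₁ t k - c₂ t k‖ ^ 2 ≤
      Real.exp (2 * A * (∑' k, freqNorm k * D k) * T) * ((2 + 4 * T) * ∑' k, D k) * ∑' k, η k := by
  intro t₀ ht₀ k₀
  have hT : 0 ≤ T := ht₀.1.trans ht₀.2
  have hD0 : ∀ k, 0 ≤ D k := fun k => (norm_nonneg _).trans (h₁ t₀ ht₀ k)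
  have hη0 : ∀ k, 0 ≤ η k := fun k => (norm_nonneg _).trans (h0 k)
  set Dt := ∑' k, D k with hDt
  set V := ∑' k, freqNorm k * D k with hV
  have hDle : ∀ k, D k ≤ Dt := fun k => hD.le_tsum _ fun n _ => hD0 n
  have hDt0 : 0 ≤ Dt := (hD0 k₀).trans (hDle k₀)
  have hA := hq.nonneg
  have hV0 : 0 ≤ V := tsum_nonneg fun k => mul_nonneg (freqNorm_nonneg k) (hD0 k)
  set δ : ℝ → (Fin d → ℤ) → ℂ := fun t k => c₁ t k - c₂ t k with hδdef
  set N : ℝ → (Fin d → ℤ) → ℂ :=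
    fun t k => convection q (c₁ t) (c₁ t) k - convection q (c₂ t) (c₂ t) k with hN
  have hδ : ∀ t ∈ Icc 0 T, ∀ k, ‖δ t k‖ ≤ 2 * D k := fun t ht k =>
    (norm_sub_le _ _).trans (by linarith [h₁ t ht k, h₂ t ht k])
  have hδ2 : ∀ t ∈ Icc 0 T, ∀ k, ‖δ t k‖ ^ 2 ≤ 4 * Dt * D k := fun t ht k => by
    have h := hδ t ht k
    have h' := hDle k
    have h'' := hD0 k
    nlinarith [norm_nonneg (δ t k)]
  have hδs : ∀ t ∈ Icc 0 T, Summable fun k => ‖δ t k‖ ^ 2 := fun t ht =>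
    Summable.of_nonneg_of_le (fun k => sq_nonneg _) (hδ2 t ht) (hD.mul_left _)
  have hNb : ∀ t ∈ Icc 0 T, ∀ k, ‖N t k‖ ≤ 2 * (A * freqNorm k * (Dt * Dt)) := fun t ht k => by
    refine (norm_sub_le _ _).trans ?_
    have e1 := norm_convection_le' hq hD hD (h₁ t ht) (h₁ t ht) k
    have e2 := norm_convection_le' hq hD hD (h₂ t ht) (h₂ t ht) k
    linarith
  set Y : ℝ → ℝ := fun t => ∑' k, ‖δ t k‖ ^ 2 with hY
  have hYcont : ContinuousOn Y (Icc 0 T) := by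
    refine continuousOn_tsum (fun k => ((hcont k).norm.pow 2)) (hD.mul_left (4 * Dt)) ?_
    intro k t ht
    rw [Real.norm_of_nonneg (sq_nonneg _)]
    exact hδ2 t ht k
  have hNs : ∀ t ∈ Icc 0 T, Summable fun k => conj (δ t k) * N t k := fun t ht => by
    refine Summable.of_norm_bounded (hD1.mul_left (4 * A * (Dt * Dt))) fun k => ?_
    rw [norm_mul, RCLike.norm_conj]
    have e1 := hδ t ht k
    have e2 := hNb t ht k
    calc ‖δ t k‖ * ‖N t k‖ ≤ (2 * D k) * (2 * (A * freqNorm k * (Dt * Dt))) := by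
          gcongr
          linarith [hD0 k]
      _ = _ := by ring
  have hes : ∀ t ∈ Ioo 0 T, Summable fun k => conj (δ t k) * e t k := fun t ht => by
    refine Summable.of_norm_bounded (hη.mul_left (2 * Dt)) fun k => ?_
    rw [norm_mul, RCLike.norm_conj]
    exact mul_le_mul ((hδ t (Ioo_subset_Icc_self ht) k).trans (by linarith [hDle k]))
      (he t ht k) (norm_nonneg _) (by positivity)
  have hls : ∀ t ∈ Icc 0 T, Summable fun k => lam k * ‖δ t k‖ ^ 2 := fun t ht => by
    refine Summable.of_nonneg_of_le (fun k => mul_nonneg (hlam k) (sq_nonneg _)) (fun k => ?_)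
      (hDlam.mul_left (4 * Dt))
    calc lam k * ‖δ t k‖ ^ 2 ≤ lam k * (4 * Dt * D k) :=
          mul_le_mul_of_nonneg_left (hδ2 t ht k) (hlam k)
      _ = _ := by ring
  set g' : ℝ → (Fin d → ℤ) → ℝ := fun t k =>
    -2 * (lam k * ‖δ t k‖ ^ 2) - 2 * (conj (δ t k) * N t k).re + 2 * (conj (δ t k) * e t k).re
    with hg'
  have hYderiv : ∀ t ∈ Ioo 0 T, HasDerivAt Y (∑' k, g' t k) t := by
    intro t ht
    have hsum : Summable fun k => 2 * (4 * Dt * (lam k * D k)) +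
        2 * (4 * A * (Dt * Dt) * (freqNorm k * D k)) + 2 * (2 * Dt * η k) :=
      (((hDlam.mul_left (4 * Dt)).mul_left 2).add
        ((hD1.mul_left (4 * A * (Dt * Dt))).mul_left 2)).add ((hη.mul_left (2 * Dt)).mul_left 2)
    refine hasDerivAt_tsum_of_isPreconnected hsum isOpen_Ioo isPreconnected_Ioo
      (g := fun k t => ‖δ t k‖ ^ 2) (g' := fun k t => g' t k) ?_ ?_ ht
      (hδs t (Ioo_subset_Icc_self ht)) ht
    · intro k t ht
      have h := (hderiv t ht k).norm_sq
      refine h.congr_deriv ?_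
      simp only [hg', Complex.inner, hδdef, hN]
      rw [← Complex.normSq_eq_norm_sq, Complex.normSq_apply]
      simp only [Complex.mul_re, Complex.add_re, Complex.sub_re, Complex.neg_re, Complex.add_im,
        Complex.sub_im, Complex.neg_im, Complex.mul_im, Complex.conj_re, Complex.conj_im,
        Complex.ofReal_re, Complex.ofReal_im]
      ring
    · intro k t ht
      have ht' := Ioo_subset_Icc_self ht
      have e1 := hδ t ht' k
      have e2 := hNb t ht' k
      have e3 := he t ht k
      have e4 := hδ2 t ht' k
      have e5 := hD0 k
      have e6 := hDle k
      have b1 : |lam k * ‖δ t k‖ ^ 2| ≤ 4 * Dt * (lam k * D k) := by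
        rw [abs_of_nonneg (mul_nonneg (hlam k) (sq_nonneg _))]
        calc lam k * ‖δ t k‖ ^ 2 ≤ lam k * (4 * Dt * D k) :=
              mul_le_mul_of_nonneg_left e4 (hlam k)
          _ = _ := by ring
      have b2 : |(conj (δ t k) * N t k).re| ≤ 4 * A * (Dt * Dt) * (freqNorm k * D k) := by
        refine (Complex.abs_re_le_norm _).trans ?_
        rw [norm_mul, RCLike.norm_conj]
        calc ‖δ t k‖ * ‖N t k‖ ≤ (2 * D k) * (2 * (A * freqNorm k * (Dt * Dt))) := by gcongr
          _ = _ := by ring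
      have b3 : |(conj (δ t k) * e t k).re| ≤ 2 * Dt * η k := by
        refine (Complex.abs_re_le_norm _).trans ?_
        rw [norm_mul, RCLike.norm_conj]
        exact mul_le_mul (by linarith) e3 (norm_nonneg _) (by positivity)
      rw [Real.norm_eq_abs, abs_le]
      rw [abs_le] at b1 b2 b3
      constructor <;> simp only [hg'] <;> linarith
  have hYle : ∀ t ∈ Ioo 0 T, ∑' k, g' t k ≤ 2 * A * V * Y t + 4 * Dt * ∑' k, η k := by
    intro t ht
    have ht' := Ioo_subset_Icc_self ht
    have s1 := (hls t ht').mul_left (-2)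
    have s2 : Summable fun k => 2 * (conj (δ t k) * N t k).re :=
      (Complex.hasSum_re (hNs t ht').hasSum).summable.mul_left 2
    have s3 : Summable fun k => 2 * (conj (δ t k) * e t k).re :=
      (Complex.hasSum_re (hes t ht).hasSum).summable.mul_left 2
    have hsplit : ∑' k, g' t k = -2 * ∑' k, lam k * ‖δ t k‖ ^ 2 -
        2 * (∑' k, conj (δ t k) * N t k).re + ∑' k, 2 * (conj (δ t k) * e t k).re := by
      simp only [hg']
      rw [(s1.sub s2).tsum_add s3, s1.tsum_sub s2, tsum_mul_left, tsum_mul_left,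
        ← Complex.re_tsum (hNs t ht')]
    rw [hsplit]
    -- Only the sign of the dissipation matters, so the final constant does not see `lam`; the
    -- summability of `lam k * D k` is needed just to differentiate term by term.
    have b1 : 0 ≤ ∑' k, lam k * ‖δ t k‖ ^ 2 :=
      tsum_nonneg fun k => mul_nonneg (hlam k) (sq_nonneg _)
    have b2 := abs_re_tsum_convection_sub_le hq hD hD1 (h₁ t ht') (h₂ t ht') (hreal t ht')
    have b3 : ∑' k, 2 * (conj (δ t k) * e t k).re ≤ 4 * Dt * ∑' k, η k := by
      rw [← tsum_mul_left]
      refine s3.tsum_le_tsum (fun k => ?_) (hη.mul_left _)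
      have : (conj (δ t k) * e t k).re ≤ 2 * Dt * η k := by
        refine (Complex.re_le_norm _).trans ?_
        rw [norm_mul, RCLike.norm_conj]
        exact mul_le_mul ((hδ t ht' k).trans (by linarith [hDle k]))
          (he t ht k) (norm_nonneg _) (by positivity)
      linarith
    have b4 := (abs_le.mp b2).1
    linarith
  set κ := 2 * A * V with hκ
  have hκ0 : 0 ≤ κ := by positivity
  set ε := 4 * Dt * ∑' k, η k with hε
  have hηt : 0 ≤ ∑' k, η k := tsum_nonneg hη0
  have hε0 : 0 ≤ ε := by positivity
  -- Gronwall with an integrating factor; since `exp (-(κ * t)) ≤ 1`, the source contributes at most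
  -- `ε` per unit of time.
  have hanti : AntitoneOn (fun t => Real.exp (-(κ * t)) * Y t - ε * t) (Icc 0 T) := by
    have hder : ∀ t ∈ Ioo 0 T, HasDerivAt (fun t => Real.exp (-(κ * t)) * Y t - ε * t)
        (Real.exp (-(κ * t)) * (-κ) * Y t + Real.exp (-(κ * t)) * (∑' k, g' t k) - ε) t := by
      intro t ht
      have h1 : HasDerivAt (fun t => Real.exp (-(κ * t))) (Real.exp (-(κ * t)) * (-κ)) t := by
        have := ((hasDerivAt_id t).const_mul κ).neg.exp
        simpa using this
      have := (h1.mul (hYderiv t ht)).sub ((hasDerivAt_id t).const_mul ε)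
      exact this.congr_deriv (by simp)
    refine antitoneOn_of_deriv_nonpos (convex_Icc 0 T) ?_ ?_ ?_
    · exact ((by fun_prop : Continuous fun t => Real.exp (-(κ * t))).continuousOn.mul hYcont).sub
        (by fun_prop)
    · rw [interior_Icc]
      exact fun t ht => (hder t ht).differentiableAt.differentiableWithinAt
    · rw [interior_Icc]
      intro t ht
      rw [(hder t ht).deriv]
      have h1 := hYle t ht
      have h2 : Real.exp (-(κ * t)) ≤ 1 :=
        Real.exp_le_one_iff.mpr (by have := ht.1.le; nlinarith)
      have h3 := Real.exp_pos (-(κ * t))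
      nlinarith [mul_le_mul_of_nonneg_left h1 h3.le]
  have hfin := hanti (left_mem_Icc.mpr hT) ht₀ ht₀.1
  simp only [mul_zero, neg_zero, Real.exp_zero, one_mul, sub_zero] at hfin
  have hY0 : Y 0 ≤ 2 * Dt * ∑' k, η k := by
    rw [← tsum_mul_left]
    refine (hδs 0 (left_mem_Icc.mpr hT)).tsum_le_tsum (fun k => ?_) (hη.mul_left _)
    rw [sq]
    exact mul_le_mul ((hδ 0 (left_mem_Icc.mpr hT) k).trans (by linarith [hDle k])) (h0 k)
      (norm_nonneg _) (by positivity)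
  have hYt : Real.exp (-(κ * t₀)) * Y t₀ ≤ (2 + 4 * T) * Dt * ∑' k, η k := by
    have : ε * t₀ ≤ ε * T := mul_le_mul_of_nonneg_left ht₀.2 hε0
    rw [hε] at this hfin
    linarith
  have hk : ‖δ t₀ k₀‖ ^ 2 ≤ Y t₀ := (hδs t₀ ht₀).le_tsum k₀ fun n _ => sq_nonneg _
  refine hk.trans ?_
  have hY2 : Y t₀ = Real.exp (κ * t₀) * (Real.exp (-(κ * t₀)) * Y t₀) := by
    rw [← mul_assoc, ← Real.exp_add]; simp
  rw [hY2, mul_assoc (Real.exp (κ * T))]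
  have hexp : Real.exp (κ * t₀) ≤ Real.exp (κ * T) :=
    Real.exp_le_exp.mpr (mul_le_mul_of_nonneg_left ht₀.2 hκ0)
  exact mul_le_mul hexp hYt (mul_nonneg (Real.exp_pos _).le (tsum_nonneg fun k => sq_nonneg _))
    (Real.exp_pos _).le

end Stability

/-! ### Global integral curves of a cut-off vector field. -/

section Ode

theorem hasDerivWithinAt_Ici_of_Icc {E : Type*} [NormedAddCommGroup E] [NormedSpace ℝ E]
    {f : ℝ → E} {f' : E} {a b t : ℝ} (ht : t ∈ Ico a b) (h : HasDerivWithinAt f f' (Icc a b) t) :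
    HasDerivWithinAt f f' (Ici t) t :=
  h.mono_of_mem_nhdsWithin (Icc_mem_nhdsGE_of_mem ht)

/-- A smooth vector field on a finite-dimensional space, cut off outside of a ball, has integral
curves on every time interval. -/
theorem exists_cutoff_integral_curve {E : Type*} [NormedAddCommGroup E] [NormedSpace ℝ E]
    [FiniteDimensional ℝ E] {f : E → E} (hf : ContDiff ℝ 1 f) (x₀ : E) {T : ℝ} (hT : 0 ≤ T)
    {r : ℝ} (hr : 0 < r) :
    ∃ (x : ℝ → E) (χ : E → ℝ), x 0 = x₀ ∧ (∀ y, ‖y‖ ≤ r → χ y = 1) ∧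
      ∀ t ∈ Icc 0 T, HasDerivWithinAt x (χ (x t) • f (x t)) (Icc 0 T) t := by
  let χ : ContDiffBump (0 : E) := ⟨r, r + 1, hr, by linarith⟩
  have hcd : ContDiff ℝ 1 (fun y => χ y • f y) := χ.contDiff.smul hf
  have hcs : HasCompactSupport (fun y => χ y • f y) := χ.hasCompactSupport.smul_right
  obtain ⟨K, hK⟩ := hcd.lipschitzWith_of_hasCompactSupport hcs one_ne_zero
  obtain ⟨M, hM⟩ := hcs.exists_bound_of_continuous hcd.continuous
  have hM0 : 0 ≤ M := (norm_nonneg _).trans (hM 0)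
  have : CompleteSpace E := FiniteDimensional.complete ℝ E
  -- The cut-off field is bounded by `M` everywhere, so a curve stays within `M * T` of its start
  -- and the local theorem already covers `[0,T]`.
  have hpl : IsPicardLindelof (fun (_ : ℝ) y => χ y • f y) (⟨0, left_mem_Icc.mpr hT⟩ : Icc 0 T)
      x₀ (⟨M * T, by positivity⟩) 0 ⟨M, hM0⟩ K :=
    { lipschitzOnWith := fun _ _ => hK.lipschitzOnWith
      continuousOn := fun _ _ => continuousOn_const
      norm_le := fun _ _ y _ => hM y
      mul_max_le := by simp [hT]; exact le_rfl }
  obtain ⟨x, hx0, hx⟩ := hpl.exists_eq_forall_mem_Icc_hasDerivWithinAt₀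
  refine ⟨x, χ, hx0, fun y hy => χ.one_of_mem_closedBall ?_, hx⟩
  simpa using hy

end Ode

/-! ### Galerkin approximations with uniform Gevrey bounds. -/

section Galerkin

variable {d : ℕ} {q : (Fin d → ℤ) → (Fin d → ℤ) → ℂ} {A : ℝ}

/-- Extension by zero of a finite family of Fourier coefficients. -/
noncomputable def extendZero (F : Finset (Fin d → ℤ)) (θ : F → ℂ) (k : Fin d → ℤ) : ℂ :=
  open Classical in if h : k ∈ F then θ ⟨k, h⟩ else 0

theorem extendZero_of_mem {F : Finset (Fin d → ℤ)} (θ : F → ℂ) {k : Fin d → ℤ} (h : k ∈ F) :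
    extendZero F θ k = θ ⟨k, h⟩ := by simp [extendZero, h]

theorem extendZero_of_notMem {F : Finset (Fin d → ℤ)} (θ : F → ℂ) {k : Fin d → ℤ} (h : k ∉ F) :
    extendZero F θ k = 0 := by simp [extendZero, h]

theorem contDiff_extendZero (F : Finset (Fin d → ℤ)) (k : Fin d → ℤ) :
    ContDiff ℝ 1 (fun θ : F → ℂ => extendZero F θ k) := by
  by_cases h : k ∈ F
  · simp only [extendZero_of_mem _ h]; fun_prop
  · simp only [extendZero_of_notMem _ h]; fun_prop

theorem contDiff_convection_extendZero (F : Finset (Fin d → ℤ)) (k : Fin d → ℤ) :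
    ContDiff ℝ 1 (fun θ : F → ℂ => convection q (extendZero F θ) (extendZero F θ) k) := by
  have : (fun θ : F → ℂ => convection q (extendZero F θ) (extendZero F θ) k) =
      fun θ => ∑ m ∈ F, q m (k - m) * extendZero F θ m * extendZero F θ (k - m) := by
    funext θ
    refine tsum_eq_sum (L := .unconditional _) fun m hm => ?_
    simp [extendZero_of_notMem _ hm]
  rw [this]
  refine ContDiff.sum fun m _ => ?_
  exact (contDiff_const.mul (contDiff_extendZero F m)).mul (contDiff_extendZero F (k - m))

/-- Cauchy–Schwarz with the weight `|k|^{-n}`: the `n` extra powers in the energy pay for passing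
from `ℓ²` to the `ℓ¹` factor of the energy estimate. -/
theorem sum_le_sqrt_mul_sqrt {F : Finset (Fin d → ℤ)} (hF : (0 : Fin d → ℤ) ∉ F) {n : ℕ} {σ : ℝ}
    (hσ0 : 0 ≤ σ) (hσ : ∑ k ∈ F, ((freqNorm k ^ n)⁻¹) ^ 2 ≤ σ ^ 2) (a τ : ℝ)
    (θ : (Fin d → ℤ) → ℂ) {X : ℝ} (hX0 : 0 ≤ X)
    (hX : ∑ k ∈ F, weight a (n + 2) τ (freqNorm k) ^ 2 * ‖θ k‖ ^ 2 ≤ X ^ 2) :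
    ∑ k ∈ F, freqNorm k ^ 2 * Real.exp (τ * freqNorm k ^ a) * ‖θ k‖ ≤ σ * X := by
  have h := Finset.sum_mul_sq_le_sq_mul_sq F (fun k => (freqNorm k ^ n)⁻¹)
    (fun k => weight a (n + 2) τ (freqNorm k) * ‖θ k‖)
  have e : ∑ k ∈ F, freqNorm k ^ 2 * Real.exp (τ * freqNorm k ^ a) * ‖θ k‖ =
      ∑ k ∈ F, (freqNorm k ^ n)⁻¹ * (weight a (n + 2) τ (freqNorm k) * ‖θ k‖) := by
    refine Finset.sum_congr rfl fun k hk => ?_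
    have hk0 : freqNorm k ≠ 0 := (freqNorm_pos (fun h => hF (h ▸ hk))).ne'
    simp only [weight, pow_add]
    field_simp
  rw [← e] at h
  refine le_of_sq_le_sq ?_ (mul_nonneg hσ0 hX0)
  refine h.trans ?_
  rw [mul_pow]
  simp only [mul_pow] at hX ⊢
  exact mul_le_mul hσ hX (Finset.sum_nonneg fun k _ => by positivity) (sq_nonneg _)

/-- The decay rate of the radius of analyticity that absorbs the transport term. -/
noncomputable def radiusSpeed (A τ₁ σ K : ℝ) (R : ℕ) : ℝ :=
  2 * (A * (2 * (R * 2 ^ R + τ₁) + 2 * 2 ^ R)) * σ * Real.sqrt (2 * K ^ 2 + 1) + 1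

theorem one_le_weight {a : ℝ} {R : ℕ} {τ y : ℝ} (hτ : 0 ≤ τ) (hy : 1 ≤ y) :
    1 ≤ weight a R τ y := by
  unfold weight
  exact one_le_mul_of_one_le_of_one_le (one_le_pow₀ hy)
    (Real.one_le_exp (mul_nonneg hτ (Real.rpow_nonneg (by linarith) _)))

theorem weight_mono {a : ℝ} {R : ℕ} {τ τ' y : ℝ} (h : τ ≤ τ') (hy : 0 ≤ y) :
    weight a R τ y ≤ weight a R τ' y := by
  unfold weight; gcongr

/-- The weighted energy, with its radius shrinking at speed `L`, stays under a linear barrier. Hence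
the cutoff is never active and the truncated system itself is solved on all of `[0,T]`. The bound
involves neither `F` nor `lam`. -/
theorem exists_galerkin (hq : IsTransportKernel q A) (hneg : ∀ m n, q m (-n) = - q m n)
    {a τ₁ : ℝ} (ha : 0 < a) (ha1 : a ≤ 1) (hτ₁ : 0 ≤ τ₁) {n : ℕ} {F : Finset (Fin d → ℤ)}
    (hF : (0 : Fin d → ℤ) ∉ F) (hFneg : ∀ k ∈ F, -k ∈ F) {lam : (Fin d → ℤ) → ℝ}
    (hlam : ∀ k, 0 ≤ lam k) (hlamneg : ∀ k, lam (-k) = lam k) {c₀ S : (Fin d → ℤ) → ℂ}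
    (hc₀ : ∀ k, c₀ (-k) = conj (c₀ k)) (hS : ∀ k, S (-k) = conj (S k)) {K : ℝ}
    (hc₀K : ∑ k ∈ F, weight a (n + 2) τ₁ (freqNorm k) ^ 2 * ‖c₀ k‖ ^ 2 ≤ K ^ 2)
    (hSK : ∑ k ∈ F, weight a (n + 2) τ₁ (freqNorm k) ^ 2 * ‖S k‖ ^ 2 ≤ K ^ 2) {σ : ℝ}
    (hσ0 : 0 ≤ σ) (hσ : ∑ k ∈ F, ((freqNorm k ^ n)⁻¹) ^ 2 ≤ σ ^ 2) {T : ℝ} (hT : 0 ≤ T)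
    (hT1 : T ≤ 1) (hLT : radiusSpeed A τ₁ σ K (n + 2) * T ≤ τ₁) :
    ∃ c : ℝ → (Fin d → ℤ) → ℂ, (∀ t, ∀ k ∉ F, c t k = 0) ∧ (∀ k ∈ F, c 0 k = c₀ k) ∧
      (∀ t ∈ Icc 0 T, ∀ k, c t (-k) = conj (c t k)) ∧
      (∀ t ∈ Icc 0 T, ∑ k ∈ F, weight a (n + 2) (τ₁ - radiusSpeed A τ₁ σ K (n + 2) * t)
        (freqNorm k) ^ 2 * ‖c t k‖ ^ 2 ≤ 2 * K ^ 2 + 1) ∧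
      ∀ k ∈ F, ∀ t ∈ Icc 0 T, HasDerivWithinAt (fun t => c t k)
        (-(lam k * c t k) - convection q (c t) (c t) k + S k) (Icc 0 T) t := by
  set L := radiusSpeed A τ₁ σ K (n + 2) with hL
  set K₁ := Real.sqrt (2 * K ^ 2 + 1) with hK₁
  have hK₁0 : 0 < K₁ := Real.sqrt_pos.mpr (by positivity)
  have hK₁sq : K₁ ^ 2 = 2 * K ^ 2 + 1 := Real.sq_sqrt (by positivity)
  set f : (F → ℂ) → (Fin d → ℤ) → ℂ := fun θ k =>
    -(lam k * extendZero F θ k) - convection q (extendZero F θ) (extendZero F θ) k + S k with hf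
  have hfc : ∀ k, ContDiff ℝ 1 (fun θ => f θ k) := fun k =>
    ((contDiff_const.mul (contDiff_extendZero F k)).neg.sub
      (contDiff_convection_extendZero F k)).add contDiff_const
  -- The field is symmetrised so that the reality condition is conserved by the flow trivially,
  -- without a uniqueness argument; on real data `g` coincides with `f`.
  set g : (F → ℂ) → (Fin d → ℤ) → ℂ := fun θ k => (f θ k + conj (f θ (-k))) / 2 with hg
  have hgc : ContDiff ℝ 1 (fun (θ : F → ℂ) (k : F) => g θ k) := by
    rw [contDiff_pi]
    intro k
    exact ((hfc k).add (Complex.conjCLE.contDiff.comp (hfc (-k)))).div_const 2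
  have hgneg : ∀ θ k, g θ (-k) = conj (g θ k) := fun θ k => by
    simp only [hg, neg_neg, map_div₀, map_add, Complex.conj_conj, map_ofNat, add_comm]
  obtain ⟨x, χ, hx0, hχ, hx⟩ := exists_cutoff_integral_curve hgc (fun k : F => c₀ k) hT hK₁0
  set c : ℝ → (Fin d → ℤ) → ℂ := fun t => extendZero F (x t) with hc
  have hcF : ∀ t, ∀ k ∉ F, c t k = 0 := fun t k hk => extendZero_of_notMem _ hk
  have hd : ∀ k ∈ F, ∀ t ∈ Icc 0 T, HasDerivWithinAt (fun t => c t k)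
      ((χ (x t) : ℂ) * g (x t) k) (Icc 0 T) t := by
    intro k hk t ht
    have h := hasDerivWithinAt_pi.mp (hx t ht) ⟨k, hk⟩
    simp only [hc, extendZero_of_mem _ hk]
    simpa using h
  have hc0 : ∀ k ∈ F, c 0 k = c₀ k := fun k hk => by
    simp only [hc, extendZero_of_mem _ hk, hx0]
  have hreal : ∀ t ∈ Icc 0 T, ∀ k, c t (-k) = conj (c t k) := by
    intro t ht k
    by_cases hk : k ∈ F
    · have hk' := hFneg k hk
      have hder : ∀ t ∈ Icc 0 T, HasDerivWithinAt (fun t => c t (-k) - conj (c t k)) 0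
          (Icc 0 T) t := by
        intro t ht
        refine ((hd _ hk' t ht).sub
          (Complex.conjCLE.hasFDerivAt.comp_hasDerivWithinAt t (hd k hk t ht))).congr_deriv ?_
        simp [hgneg]
      have := constant_of_has_deriv_right_zero
        (fun t ht => (hder t ht).continuousWithinAt)
        (fun t ht => hasDerivWithinAt_Ici_of_Icc ht (hder t (Ico_subset_Icc_self ht))) t ht
      rw [hc0 _ hk', hc0 _ hk, hc₀, sub_self] at this
      exact sub_eq_zero.mp this
    · have hk' : -k ∉ F := fun h => hk (by simpa using hFneg _ h)
      rw [hcF t _ hk, hcF t _ hk', map_zero]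
  have hgf : ∀ t ∈ Icc 0 T, ∀ k, g (x t) k = f (x t) k := by
    intro t ht k
    have : f (x t) (-k) = conj (f (x t) k) := by
      have e1 := hreal t ht
      have e2 := conj_convection hq _ _ e1 e1 hneg k
      simp only [hc] at e1 e2
      simp only [hf, map_add, map_sub, map_neg, map_mul, Complex.conj_ofReal, hlamneg, e1, e2, hS]
    simp only [hg, this, Complex.conj_conj]
    ring
  set C : ℝ := 2 * ((n + 2 : ℕ) * 2 ^ (n + 2) + τ₁) + 2 * 2 ^ (n + 2) with hC
  have hLdef : L = 2 * (A * C) * σ * K₁ + 1 := rfl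
  have hA := hq.nonneg
  have hC0 : 0 ≤ C := by positivity
  have hL0 : 0 ≤ L := by rw [hLdef]; positivity
  have hτle : ∀ t ∈ Icc 0 T, 0 ≤ τ₁ - L * t ∧ τ₁ - L * t ≤ τ₁ := fun t ht =>
    ⟨by nlinarith [ht.2], by nlinarith [ht.1]⟩
  set w : ℝ → (Fin d → ℤ) → ℝ := fun t k => weight a (n + 2) (τ₁ - L * t) (freqNorm k) with hw
  have hF1 : ∀ k ∈ F, 1 ≤ freqNorm k := fun k hk => one_le_freqNorm (fun h => hF (h ▸ hk))
  have hw1 : ∀ t ∈ Icc 0 T, ∀ k ∈ F, 1 ≤ w t k := fun t ht k hk =>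
    one_le_weight (hτle t ht).1 (hF1 k hk)
  have hwd : ∀ t k, HasDerivAt (fun t => w t k) (-(L * freqNorm k ^ a) * w t k) t := by
    intro t k
    have h1 : HasDerivAt (fun t => (τ₁ - L * t) * freqNorm k ^ a) (-(L * freqNorm k ^ a)) t := by
      have := (((hasDerivAt_id t).const_mul L).const_sub τ₁).mul_const (freqNorm k ^ a)
      exact this.congr_deriv (by simp)
    refine (h1.exp.const_mul (freqNorm k ^ (n + 2))).congr_deriv ?_
    simp only [hw, weight]; ring
  set u : ℝ → ℝ := fun t => ∑ k ∈ F, w t k ^ 2 * ‖c t k‖ ^ 2 with hu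
  set u' : ℝ → ℝ := fun t => ∑ k ∈ F, (2 * w t k * (-(L * freqNorm k ^ a) * w t k) * ‖c t k‖ ^ 2 +
    w t k ^ 2 * (2 * inner ℝ (c t k) ((χ (x t) : ℂ) * g (x t) k))) with hu'
  have hud : ∀ t ∈ Icc 0 T, HasDerivWithinAt u (u' t) (Icc 0 T) t := by
    intro t ht
    refine HasDerivWithinAt.fun_sum fun k hk => ?_
    have h1 : HasDerivWithinAt (fun t => w t k ^ 2) _ (Icc 0 T) t :=
      ((hwd t k).pow 2).hasDerivWithinAt
    refine (h1.mul (hd k hk t ht).norm_sq).congr_deriv ?_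
    simp
  -- The barrier stays below `2K² + 1` because `T ≤ 1`.
  have hBT : ∀ t ∈ Icc 0 T, K ^ 2 + (K ^ 2 + 1) * t ≤ 2 * K ^ 2 + 1 := fun t ht => by
    nlinarith [sq_nonneg K, ht.2]
  -- The weights are at least `1`, so the energy bounds every coefficient and keeps the curve in the
  -- ball where the cutoff is `1`.
  have hcut : ∀ t ∈ Icc 0 T, u t ≤ 2 * K ^ 2 + 1 → χ (x t) = 1 := by
    intro t ht hut
    refine hχ _ ((pi_norm_le_iff_of_nonneg hK₁0.le).mpr fun k => ?_)
    have h1 : w t k ^ 2 * ‖c t k‖ ^ 2 ≤ u t :=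
      Finset.single_le_sum (f := fun k => w t k ^ 2 * ‖c t k‖ ^ 2)
        (fun k _ => by positivity) k.2
    have h2 : ‖x t k‖ = ‖c t k‖ := by simp only [hc, extendZero_of_mem _ k.2]
    rw [h2]
    refine le_of_sq_le_sq ?_ hK₁0.le
    have h3 := hw1 t ht k k.2
    rw [hK₁sq]
    nlinarith [sq_nonneg ‖c t k‖, mul_le_mul h3 h3 zero_le_one (by linarith)]
  -- The comparison theorem asks for the strict inequality only at times when the energy touches the
  -- barrier, and there the cutoff is known to be inactive.
  have hbound : ∀ t ∈ Ico 0 T, u t = K ^ 2 + (K ^ 2 + 1) * t → u' t < K ^ 2 + 1 := by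
    intro t ht hut
    have ht' := Ico_subset_Icc_self ht
    have hutK : u t ≤ 2 * K ^ 2 + 1 := hut.le.trans (hBT t ht')
    have hχ1 := hcut t ht' hutK
    set Z : (Fin d → ℤ) → ℝ := fun k => freqNorm k ^ a * (w t k ^ 2 * ‖c t k‖ ^ 2) with hZ
    have hZ0 : 0 ≤ ∑ k ∈ F, Z k := Finset.sum_nonneg fun k _ =>
      mul_nonneg (Real.rpow_nonneg (freqNorm_nonneg k) _) (by positivity)
    have hterm : ∀ k ∈ F, 2 * w t k * (-(L * freqNorm k ^ a) * w t k) * ‖c t k‖ ^ 2 +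
        w t k ^ 2 * (2 * inner ℝ (c t k) ((χ (x t) : ℂ) * g (x t) k)) ≤
        (1 - 2 * L) * Z k + weight a (n + 2) τ₁ (freqNorm k) ^ 2 * ‖S k‖ ^ 2 -
          2 * (((w t k ^ 2 : ℝ) : ℂ) * (conj (c t k) * convection q (c t) (c t) k)).re := by
      intro k hk
      have e1 : inner ℝ (c t k) ((χ (x t) : ℂ) * g (x t) k) = -(lam k * ‖c t k‖ ^ 2) -
          (conj (c t k) * convection q (c t) (c t) k).re + (conj (c t k) * S k).re := by
        rw [hχ1, hgf t ht', ← Complex.normSq_eq_norm_sq, Complex.normSq_apply]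
        simp only [hf, Complex.inner]
        simp only [Complex.mul_re, Complex.add_re, Complex.sub_re, Complex.neg_re, Complex.add_im,
          Complex.sub_im, Complex.neg_im, Complex.mul_im, Complex.conj_re, Complex.conj_im,
          Complex.ofReal_re, Complex.ofReal_im, hc]
        ring
      have e2 : 2 * (conj (c t k) * S k).re ≤ ‖c t k‖ ^ 2 + ‖S k‖ ^ 2 := by
        have := Complex.re_le_norm (conj (c t k) * S k)
        rw [norm_mul, RCLike.norm_conj] at this
        nlinarith [sq_nonneg (‖c t k‖ - ‖S k‖)]
      have e3 : w t k ^ 2 * ‖S k‖ ^ 2 ≤ weight a (n + 2) τ₁ (freqNorm k) ^ 2 * ‖S k‖ ^ 2 := by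
        have h1 := weight_mono (a := a) (R := n + 2) (hτle t ht').2 (freqNorm_nonneg k)
        have h2 := hw1 t ht' k hk
        gcongr
      have e4 : w t k ^ 2 * ‖c t k‖ ^ 2 ≤ Z k :=
        le_mul_of_one_le_left (by positivity) (Real.one_le_rpow (hF1 k hk) ha.le)
      have e5 : 0 ≤ w t k ^ 2 * (lam k * ‖c t k‖ ^ 2) :=
        mul_nonneg (sq_nonneg _) (mul_nonneg (hlam k) (sq_nonneg _))
      have e6 : (((w t k ^ 2 : ℝ) : ℂ) * (conj (c t k) * convection q (c t) (c t) k)).re =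
          w t k ^ 2 * (conj (c t k) * convection q (c t) (c t) k).re := Complex.re_ofReal_mul _ _
      have e7 := mul_le_mul_of_nonneg_left e2 (sq_nonneg (w t k))
      have e8 : 2 * w t k * (-(L * freqNorm k ^ a) * w t k) * ‖c t k‖ ^ 2 = -2 * L * Z k := by
        simp only [hZ]; ring
      rw [e1, e6, e8]
      linarith
    have hsum : u' t ≤ (1 - 2 * L) * ∑ k ∈ F, Z k +
        ∑ k ∈ F, weight a (n + 2) τ₁ (freqNorm k) ^ 2 * ‖S k‖ ^ 2 -
          2 * (∑ k ∈ F, ((w t k ^ 2 : ℝ) : ℂ) *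
            (conj (c t k) * convection q (c t) (c t) k)).re := by
      refine (Finset.sum_le_sum hterm).trans (le_of_eq ?_)
      rw [Finset.sum_sub_distrib, Finset.sum_add_distrib, ← Finset.mul_sum, ← Finset.mul_sum,
        Complex.re_sum]
    have htri := abs_re_sum_weight_convection_le hq ha ha1 (n + 2) (hτle t ht').1 (hτle t ht').2 hF
      (hcF t) (hreal t ht')
    have hV := sum_le_sqrt_mul_sqrt hF hσ0 hσ a (τ₁ - L * t) (c t) hK₁0.le (hutK.trans hK₁sq.ge)
    have htri' : -(∑ k ∈ F, ((w t k ^ 2 : ℝ) : ℂ) *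
        (conj (c t k) * convection q (c t) (c t) k)).re ≤
        A * C * (2 * (σ * K₁ * ∑ k ∈ F, Z k)) := by
      refine (neg_le_abs _).trans (htri.trans ?_)
      refine mul_le_mul_of_nonneg_left ?_ (mul_nonneg hA hC0)
      exact mul_le_mul_of_nonneg_left (mul_le_mul_of_nonneg_right hV hZ0) two_pos.le
    -- In `-2L`, the part `-4ACσK₁` cancels the transport term exactly. The `+ 1` in `radiusSpeed`
    -- contributes `-2`, of which one unit absorbs the energy produced by Young's inequality on the
    -- source.
    have hfinal : u' t ≤ K ^ 2 - ∑ k ∈ F, Z k := by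
      refine hsum.trans ?_
      rw [hLdef]
      linarith
    linarith
  have hu0 : u 0 ≤ K ^ 2 + (K ^ 2 + 1) * 0 := by
    rw [mul_zero, add_zero]
    refine le_trans (le_of_eq (Finset.sum_congr rfl fun k hk => ?_)) hc₀K
    simp only [hw, mul_zero, sub_zero, hc0 k hk]
  have hule := image_le_of_deriv_right_lt_deriv_boundary
    (fun t ht => (hud t ht).continuousWithinAt)
    (fun t ht => hasDerivWithinAt_Ici_of_Icc ht (hud t (Ico_subset_Icc_self ht))) hu0
    (B := fun t => K ^ 2 + (K ^ 2 + 1) * t) (B' := fun _ => K ^ 2 + 1)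
    (fun t => (((hasDerivAt_id t).const_mul (K ^ 2 + 1)).const_add (K ^ 2)).congr_deriv
      (by simp)) hbound
  have huK : ∀ t ∈ Icc 0 T, u t ≤ 2 * K ^ 2 + 1 := fun t ht => (hule ht).trans (hBT t ht)
  refine ⟨c, hcF, hc0, hreal, huK, fun k hk t ht => (hd k hk t ht).congr_deriv ?_⟩
  rw [hcut t ht (huK t ht), hgf t ht, Complex.ofReal_one, one_mul]

end Galerkin

/-! ### Solutions of the spectral problem as limits of Galerkin approximations. -/

section Spectral

variable {d : ℕ} {q : (Fin d → ℤ) → (Fin d → ℤ) → ℂ} {A : ℝ}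

/-- `c` is a family of Fourier coefficients, bounded by `D`, of a real mean-zero solution of
`∂_t θ + u[θ]·∇θ = -λ θ + S` on `[0,T]`, where `λ` is a Fourier multiplier. -/
structure IsSpectralSolution (q : (Fin d → ℤ) → (Fin d → ℤ) → ℂ) (lam : (Fin d → ℤ) → ℝ)
    (c₀ S : (Fin d → ℤ) → ℂ) (T : ℝ) (D : (Fin d → ℤ) → ℝ) (c : ℝ → (Fin d → ℤ) → ℂ) : Prop where
  norm_le : ∀ t ∈ Icc 0 T, ∀ k, ‖c t k‖ ≤ D k
  real : ∀ t ∈ Icc 0 T, ∀ k, c t (-k) = conj (c t k)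
  zero_mode : ∀ t ∈ Icc 0 T, c t 0 = 0
  initial : ∀ k, c 0 k = c₀ k
  continuousOn : ∀ k, ContinuousOn (fun t => c t k) (Icc 0 T)
  deriv : ∀ t ∈ Ioo 0 T, ∀ k, HasDerivAt (fun t => c t k)
    (-(lam k * c t k) - convection q (c t) (c t) k + S k) t

theorem IsSpectralSolution.mono {lam : (Fin d → ℤ) → ℝ} {c₀ S : (Fin d → ℤ) → ℂ} {T T' : ℝ}
    {D D' : (Fin d → ℤ) → ℝ} {c : ℝ → (Fin d → ℤ) → ℂ} (h : IsSpectralSolution q lam c₀ S T D c)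
    (hD : ∀ k, D k ≤ D' k) (hT : T' ≤ T) : IsSpectralSolution q lam c₀ S T' D' c where
  norm_le t ht k := (h.norm_le t ⟨ht.1, ht.2.trans hT⟩ k).trans (hD k)
  real t ht := h.real t ⟨ht.1, ht.2.trans hT⟩
  zero_mode t ht := h.zero_mode t ⟨ht.1, ht.2.trans hT⟩
  initial := h.initial
  continuousOn k := (h.continuousOn k).mono (Icc_subset_Icc_right hT)
  deriv t ht := h.deriv t ⟨ht.1, ht.2.trans_le hT⟩

/-- Solutions depend continuously on the symbol of the dissipation. -/
theorem IsSpectralSolution.norm_sub_sq_le (hq : IsTransportKernel q A)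
    {lam₁ lam₂ : (Fin d → ℤ) → ℝ} {c₀ S : (Fin d → ℤ) → ℂ} {T : ℝ} {D : (Fin d → ℤ) → ℝ}
    {c₁ c₂ : ℝ → (Fin d → ℤ) → ℂ} (h₁ : IsSpectralSolution q lam₁ c₀ S T D c₁)
    (h₂ : IsSpectralSolution q lam₂ c₀ S T D c₂) (hD : Summable D)
    (hD1 : Summable fun k => freqNorm k * D k) (hlam₂ : ∀ k, 0 ≤ lam₂ k)
    (hDlam₂ : Summable fun k => lam₂ k * D k)
    (hη : Summable fun k => |lam₁ k - lam₂ k| * D k) :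
    ∀ t ∈ Icc 0 T, ∀ k, ‖c₁ t k - c₂ t k‖ ^ 2 ≤
      Real.exp (2 * A * (∑' k, freqNorm k * D k) * T) * ((2 + 4 * T) * ∑' k, D k) *
        ∑' k, |lam₁ k - lam₂ k| * D k := by
  intro t ht
  have hD0 : ∀ k, 0 ≤ D k := fun k => (norm_nonneg _).trans (h₁.norm_le t ht k)
  -- The second symbol is kept as the dissipation of the difference, and `(lam₁ - lam₂) c₁` is
  -- treated as a forcing.
  refine l2_stability hq hD hD1 hlam₂ hDlam₂ hη h₁.norm_le h₂.norm_le h₂.real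
    (e := fun t k => -((lam₁ k - lam₂ k : ℝ) * c₁ t k))
    (fun k => (h₁.continuousOn k).sub (h₂.continuousOn k)) ?_ ?_ ?_ t ht
  · intro t ht k
    refine ((h₁.deriv t ht k).sub (h₂.deriv t ht k)).congr_deriv ?_
    push_cast; ring
  · intro t ht k
    rw [norm_neg, norm_mul, Complex.norm_real, Real.norm_eq_abs]
    exact mul_le_mul_of_nonneg_left (h₁.norm_le t (Ioo_subset_Icc_self ht) k) (abs_nonneg _)
  · intro k
    rw [h₁.initial, h₂.initial, sub_self, norm_zero]
    exact mul_nonneg (abs_nonneg _) (hD0 k)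

/-- Each convection coefficient is continuous for the sup norm of the coefficients under a common
majorant; this passes the nonlinearity to the limit, uniformly in time. -/
theorem norm_convection_sub_le (hq : IsTransportKernel q A) {D : (Fin d → ℤ) → ℝ}
    (hD : Summable D) {c₁ c₂ : (Fin d → ℤ) → ℂ}
    (h₁ : ∀ k, ‖c₁ k‖ ≤ D k) (h₂ : ∀ k, ‖c₂ k‖ ≤ D k) {ε : ℝ} (hε : ∀ k, ‖c₁ k - c₂ k‖ ≤ ε)
    (k : Fin d → ℤ) :
    ‖convection q c₁ c₁ k - convection q c₂ c₂ k‖ ≤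
      A * freqNorm k * (2 * ∑' k, D k) * ε := by
  unfold convection
  rw [← (summable_convection hq hD hD h₁ h₁ k).tsum_sub (summable_convection hq hD hD h₂ h₂ k)]
  have hD' : HasSum (fun m => D (k - m)) (∑' k, D k) :=
    (Equiv.subLeft k).hasSum_iff.mpr hD.hasSum
  have hs := ((hD'.mul_left ε).add (hD.hasSum.mul_right ε)).mul_left (A * freqNorm k)
  refine (tsum_of_norm_bounded hs fun m => ?_).trans (le_of_eq (by ring))
  have e : q m (k - m) * c₁ m * c₁ (k - m) - q m (k - m) * c₂ m * c₂ (k - m) =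
      q m (k - m) * ((c₁ m - c₂ m) * c₁ (k - m) + c₂ m * (c₁ (k - m) - c₂ (k - m))) := by ring
  rw [e, norm_mul]
  have hε0 : 0 ≤ ε := (norm_nonneg _).trans (hε m)
  have hD0 : 0 ≤ D m := (norm_nonneg _).trans (h₂ m)
  refine mul_le_mul (hq.norm_le_sub k m) ((norm_add_le _ _).trans ?_) (norm_nonneg _)
    (mul_nonneg hq.nonneg (freqNorm_nonneg k))
  rw [norm_mul, norm_mul]
  exact add_le_add (mul_le_mul (hε m) (h₁ _) (norm_nonneg _) hε0)
    (mul_le_mul (h₂ m) (hε _) (norm_nonneg _) hD0)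

/-- The frequencies with all components in `[-N, N]`. -/
noncomputable def freqBox (d N : ℕ) : Finset (Fin d → ℤ) :=
  Finset.Icc (fun _ => -(N : ℤ)) (fun _ => (N : ℤ))

theorem mem_freqBox {N : ℕ} {k : Fin d → ℤ} : k ∈ freqBox d N ↔ ∀ i, |k i| ≤ N := by
  simp only [freqBox, Finset.mem_Icc, Pi.le_def, abs_le, forall_and]

theorem freqBox_mono {M N : ℕ} (h : M ≤ N) : freqBox d M ⊆ freqBox d N := fun k hk => by
  rw [mem_freqBox] at hk ⊢
  exact fun i => (hk i).trans (by exact_mod_cast h)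

theorem tendsto_freqBox : Tendsto (freqBox d) atTop atTop := by
  refine tendsto_atTop_finset_of_monotone (fun _ _ h => freqBox_mono h) fun k => ?_
  refine ⟨(∑ i, |k i|).toNat, mem_freqBox.mpr fun i => ?_⟩
  rw [Int.toNat_of_nonneg (Finset.sum_nonneg fun i _ => abs_nonneg _)]
  exact Finset.single_le_sum (f := fun i => |k i|) (fun i _ => abs_nonneg _) (Finset.mem_univ i)

/-- The bound `M e^{-τ|k|^a}` for Fourier coefficients. -/
noncomputable def gevreyDecay (M τ a : ℝ) (k : Fin d → ℤ) : ℝ :=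
  M * Real.exp (-(τ * freqNorm k ^ a))

theorem gevreyDecay_nonneg {M τ a : ℝ} (hM : 0 ≤ M) (k : Fin d → ℤ) :
    0 ≤ gevreyDecay M τ a k := mul_nonneg hM (Real.exp_pos _).le

theorem summable_rpow_mul_gevreyDecay {a τ : ℝ} (ha : 0 < a) (hτ : 0 < τ) (M p : ℝ) :
    Summable fun k : Fin d → ℤ => freqNorm k ^ p * gevreyDecay M τ a k := by
  refine ((summable_freqNorm_rpow_mul_exp (d := d) ha hτ p).mul_left M).congr fun k => ?_
  simp only [gevreyDecay]; ring

theorem summable_gevreyDecay {a τ : ℝ} (ha : 0 < a) (hτ : 0 < τ) (M : ℝ) :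
    Summable (gevreyDecay M τ a : (Fin d → ℤ) → ℝ) := by
  simpa using summable_rpow_mul_gevreyDecay (d := d) ha hτ M 0

theorem summable_freqNorm_mul_gevreyDecay {a τ : ℝ} (ha : 0 < a) (hτ : 0 < τ) (M : ℝ) :
    Summable fun k : Fin d → ℤ => freqNorm k * gevreyDecay M τ a k := by
  simpa using summable_rpow_mul_gevreyDecay (d := d) ha hτ M 1

theorem norm_le_gevreyDecay_of_sum {a τ τ' : ℝ} {n : ℕ} {F : Finset (Fin d → ℤ)}
    (hF : (0 : Fin d → ℤ) ∉ F) (hττ : τ' ≤ τ) {θ : (Fin d → ℤ) → ℂ} {M : ℝ} (hM : 0 ≤ M)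
    (h : ∑ k ∈ F, weight a n τ (freqNorm k) ^ 2 * ‖θ k‖ ^ 2 ≤ M ^ 2) {k : Fin d → ℤ}
    (hk : k ∈ F) : ‖θ k‖ ≤ gevreyDecay M τ' a k := by
  have h1 : weight a n τ (freqNorm k) ^ 2 * ‖θ k‖ ^ 2 ≤ M ^ 2 :=
    (Finset.single_le_sum (f := fun k => weight a n τ (freqNorm k) ^ 2 * ‖θ k‖ ^ 2)
      (fun k _ => by positivity) hk).trans h
  rw [← mul_pow] at h1
  have h2 := le_of_sq_le_sq h1 hM
  have hk1 : 1 ≤ freqNorm k := one_le_freqNorm fun h => hF (h ▸ hk)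
  have h3 : Real.exp (τ' * freqNorm k ^ a) ≤ weight a n τ (freqNorm k) := by
    unfold weight
    refine le_trans ?_ (le_mul_of_one_le_left (Real.exp_pos _).le (one_le_pow₀ hk1))
    exact Real.exp_le_exp.mpr (mul_le_mul_of_nonneg_right hττ
      (Real.rpow_nonneg (freqNorm_nonneg k) _))
  have h4 := (mul_le_mul_of_nonneg_right h3 (norm_nonneg (θ k))).trans h2
  rw [gevreyDecay, Real.exp_neg, ← div_eq_mul_inv, le_div_iff₀ (Real.exp_pos _)]
  linarith

/-- The truncations share the majorant `D`, since half of the radius survives up to `T`. Each solves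
the full equation up to an error supported outside its box, so stability makes them uniformly
Cauchy, and the derivatives converge uniformly as well. -/
theorem exists_spectralSolution (hq : IsTransportKernel q A) (hneg : ∀ m n, q m (-n) = - q m n)
    {a τ₁ : ℝ} (ha : 0 < a) (ha1 : a ≤ 1) (hτ₁ : 0 < τ₁) {n : ℕ} {lam : (Fin d → ℤ) → ℝ}
    (hlam : ∀ k, 0 ≤ lam k) (hlamneg : ∀ k, lam (-k) = lam k) {c₀ S : (Fin d → ℤ) → ℂ}
    (hc₀ : ∀ k, c₀ (-k) = conj (c₀ k)) (hS : ∀ k, S (-k) = conj (S k)) (hc₀0 : c₀ 0 = 0)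
    (hS0 : S 0 = 0) {K : ℝ}
    (hc₀K : ∀ F : Finset (Fin d → ℤ), (0 : Fin d → ℤ) ∉ F →
      ∑ k ∈ F, weight a (n + 2) τ₁ (freqNorm k) ^ 2 * ‖c₀ k‖ ^ 2 ≤ K ^ 2)
    (hSK : ∀ F : Finset (Fin d → ℤ), (0 : Fin d → ℤ) ∉ F →
      ∑ k ∈ F, weight a (n + 2) τ₁ (freqNorm k) ^ 2 * ‖S k‖ ^ 2 ≤ K ^ 2) {σ : ℝ}
    (hσ0 : 0 ≤ σ) (hσ : ∀ F : Finset (Fin d → ℤ), (0 : Fin d → ℤ) ∉ F →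
      ∑ k ∈ F, ((freqNorm k ^ n)⁻¹) ^ 2 ≤ σ ^ 2) {T : ℝ} (hT : 0 ≤ T)
    (hT1 : T ≤ 1) (hLT : radiusSpeed A τ₁ σ K (n + 2) * T ≤ τ₁ / 2)
    (hDlam : Summable fun k : Fin d → ℤ =>
      lam k * gevreyDecay (Real.sqrt (2 * K ^ 2 + 1)) (τ₁ / 2) a k) :
    ∃ c, IsSpectralSolution q lam c₀ S T
      (gevreyDecay (Real.sqrt (2 * K ^ 2 + 1)) (τ₁ / 2) a) c := by
  classical
  set K₁ := Real.sqrt (2 * K ^ 2 + 1) with hK₁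
  have hK₁0 : 0 ≤ K₁ := Real.sqrt_nonneg _
  have hK₁sq : K₁ ^ 2 = 2 * K ^ 2 + 1 := Real.sq_sqrt (by positivity)
  have hτ₂ : 0 < τ₁ / 2 := by linarith
  set D : (Fin d → ℤ) → ℝ := gevreyDecay K₁ (τ₁ / 2) a with hDdef
  have hD0 : ∀ k, 0 ≤ D k := gevreyDecay_nonneg hK₁0
  have hD : Summable D := summable_gevreyDecay ha hτ₂ _
  have hD1 : Summable fun k => freqNorm k * D k := summable_freqNorm_mul_gevreyDecay ha hτ₂ _
  have hA := hq.nonneg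
  set F : ℕ → Finset (Fin d → ℤ) := fun N => (freqBox d N).erase 0 with hFdef
  have hF0 : ∀ N, (0 : Fin d → ℤ) ∉ F N := fun N => Finset.notMem_erase _ _
  have hFmono : ∀ {M N}, M ≤ N → F M ⊆ F N := fun h => Finset.erase_subset_erase _ (freqBox_mono h)
  have hFneg : ∀ N, ∀ k ∈ F N, -k ∈ F N := fun N k hk => by
    simp only [hFdef, Finset.mem_erase, mem_freqBox, ne_eq, neg_eq_zero, Pi.neg_apply,
      abs_neg] at hk ⊢
    exact hk
  have hbox : ∀ N k, k ∈ freqBox d N → k = 0 ∨ k ∈ F N := fun N k hk => by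
    by_cases h : k = 0
    · exact Or.inl h
    · exact Or.inr (Finset.mem_erase.mpr ⟨h, hk⟩)
  choose c hcF hc0 hcreal hcK hcd using fun N : ℕ =>
    exists_galerkin hq hneg ha ha1 hτ₁.le (n := n) (hF0 N) (hFneg N) hlam hlamneg hc₀ hS
      (hc₀K _ (hF0 N)) (hSK _ (hF0 N)) hσ0 (hσ _ (hF0 N)) hT hT1 (hLT.trans (by linarith))
  set L := radiusSpeed A τ₁ σ K (n + 2) with hL
  have hcz : ∀ N t, c N t 0 = 0 := fun N t => hcF N t 0 (hF0 N)
  have hL0 : 0 ≤ L := by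
    rw [hL, radiusSpeed]; positivity
  have hcD : ∀ N, ∀ t ∈ Icc 0 T, ∀ k, ‖c N t k‖ ≤ D k := by
    intro N t ht k
    by_cases hk : k ∈ F N
    · refine norm_le_gevreyDecay_of_sum (hF0 N) ?_ hK₁0 ((hcK N t ht).trans hK₁sq.ge) hk
      have := mul_le_mul_of_nonneg_left ht.2 hL0
      linarith
    · rw [hcF N t k hk, norm_zero]; exact hD0 k
  have hKK : K ^ 2 ≤ K₁ ^ 2 := by rw [hK₁sq]; nlinarith [sq_nonneg K]
  have hSD : ∀ k, ‖S k‖ ≤ D k := by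
    intro k
    by_cases hk : k = 0
    · rw [hk, hS0, norm_zero]; exact hD0 0
    · have : (0 : Fin d → ℤ) ∉ ({k} : Finset (Fin d → ℤ)) := by simpa using Ne.symm hk
      exact norm_le_gevreyDecay_of_sum this (by linarith) hK₁0 ((hSK _ this).trans hKK)
        (Finset.mem_singleton_self k)
  have hconv0 : ∀ θ : (Fin d → ℤ) → ℂ, (∀ k, ‖θ k‖ ≤ D k) → convection q θ θ 0 = 0 := by
    intro θ hθ
    have := norm_convection_le' hq hD hD hθ hθ 0
    rw [freqNorm_zero, mul_zero, zero_mul] at this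
    exact norm_le_zero_iff.mp this
  -- One majorant for both defects: half of `H` dominates a truncation error, so that the difference
  -- of two errors fits under `H`, and `2 * D k` dominates the difference of two initial values.
  set H : (Fin d → ℤ) → ℝ := fun k => 2 * (A * (freqNorm k * ∑' m, D m * D (k - m)) + D k) with hH
  have hHs : Summable H :=
    (((summable_freqNorm_mul_convolution hD0 hD hD1).mul_left A).add hD).mul_left 2
  have hH0 : ∀ k, 0 ≤ H k := fun k => by
    have h1 : 0 ≤ ∑' m, D m * D (k - m) := tsum_nonneg fun m => mul_nonneg (hD0 _) (hD0 _)
    have h2 := freqNorm_nonneg k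
    have h3 := hD0 k
    simp only [hH]; positivity
  set η : ℕ → (Fin d → ℤ) → ℝ := fun P => Set.indicator {k | k ∉ freqBox d P} H with hη
  have hηs : ∀ P, Summable (η P) := fun P => hHs.indicator _
  have hη0 : ∀ P k, 0 ≤ η P k := fun P k => Set.indicator_nonneg (fun k _ => hH0 k) k
  have hηlim : Tendsto (fun P => ∑' k, η P k) atTop (𝓝 0) := by
    have h := (tendsto_tsum_compl_atTop_zero H).comp (tendsto_freqBox (d := d))
    refine h.congr fun P => ?_
    exact tsum_subtype {k | k ∉ freqBox d P} H
  -- Outside `F N` the coefficients vanish identically, so the defect there is the part of the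
  -- equation that was cut away.
  set err : ℕ → ℝ → (Fin d → ℤ) → ℂ := fun N t k =>
    if k ∈ F N then 0 else convection q (c N t) (c N t) k - S k with herr
  have hcd' : ∀ N, ∀ t ∈ Icc 0 T, ∀ k, HasDerivWithinAt (fun t => c N t k)
      (-(lam k * c N t k) - convection q (c N t) (c N t) k + S k + err N t k) (Icc 0 T) t := by
    intro N t ht k
    by_cases hk : k ∈ F N
    · refine (hcd N k hk t ht).congr_deriv ?_
      simp only [herr, hk, if_true, add_zero]
    · have : (fun t => c N t k) = fun _ => 0 := funext fun t => hcF N t k hk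
      rw [this]
      refine (hasDerivWithinAt_const _ _ _).congr_deriv ?_
      simp only [herr, hk, if_false, hcF N t k hk]
      ring
  have hccont : ∀ N k, ContinuousOn (fun t => c N t k) (Icc 0 T) := fun N k t ht =>
    (hcd' N t ht k).continuousWithinAt
  have herrb : ∀ P N, P ≤ N → ∀ t ∈ Icc 0 T, ∀ k, ‖err N t k‖ ≤ η P k / 2 := by
    intro P N hPN t ht k
    by_cases hk : k ∈ F N
    · simp only [herr, hk, if_true, norm_zero]; exact div_nonneg (hη0 P k) two_pos.le
    · simp only [herr, hk, if_false]
      by_cases hkP : k ∈ freqBox d P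
      · rcases hbox P k hkP with h | h
        · rw [h, hconv0 _ (hcD N t ht), hS0, sub_zero, norm_zero]
          exact div_nonneg (hη0 P 0) two_pos.le
        · exact absurd (hFmono hPN h) hk
      · have : η P k = H k := Set.indicator_of_mem (s := {k | k ∉ freqBox d P}) hkP H
        rw [this]
        refine (norm_sub_le _ _).trans ?_
        have e1 := norm_convection_le hq hD hD (hcD N t ht) (hcD N t ht) k
        have e2 := hSD k
        simp only [hH]
        linarith
  have hinit : ∀ P M N, P ≤ M → P ≤ N → ∀ k, ‖c M 0 k - c N 0 k‖ ≤ η P k := by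
    intro P M N hM hN k
    by_cases hkP : k ∈ freqBox d P
    · rcases hbox P k hkP with h | h
      · rw [h, hcz, hcz, sub_zero, norm_zero]; exact hη0 P 0
      · rw [hc0 M k (hFmono hM h), hc0 N k (hFmono hN h), sub_self, norm_zero]; exact hη0 P k
    · have : η P k = H k := Set.indicator_of_mem (s := {k | k ∉ freqBox d P}) hkP H
      rw [this]
      refine (norm_sub_le _ _).trans ?_
      have e1 := hcD M 0 (left_mem_Icc.mpr hT) k
      have e2 := hcD N 0 (left_mem_Icc.mpr hT) k
      have e3 : 0 ≤ A * (freqNorm k * ∑' m, D m * D (k - m)) :=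
        mul_nonneg hA (mul_nonneg (freqNorm_nonneg k)
          (tsum_nonneg fun m => mul_nonneg (hD0 _) (hD0 _)))
      simp only [hH]
      linarith
  set Cst := Real.exp (2 * A * (∑' k, freqNorm k * D k) * T) * ((2 + 4 * T) * ∑' k, D k) with hCst
  set ε : ℕ → ℝ := fun P => Real.sqrt (Cst * ∑' k, η P k) with hε
  have hεlim : Tendsto ε atTop (𝓝 0) := by
    have := (hηlim.const_mul Cst).sqrt
    simpa using this
  have hcauchy : ∀ P M N, P ≤ M → P ≤ N → ∀ t ∈ Icc 0 T, ∀ k, ‖c M t k - c N t k‖ ≤ ε P := by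
    intro P M N hM hN t ht k
    refine Real.le_sqrt_of_sq_le ?_
    refine l2_stability hq hD hD1 hlam hDlam (hηs P) (e := fun t k => err M t k - err N t k)
      (hcD M) (hcD N) (hcreal N) (fun k => (hccont M k).sub (hccont N k)) ?_ ?_
      (hinit P M N hM hN) t ht k
    · intro t ht k
      have hnhds : Icc 0 T ∈ 𝓝 t := Icc_mem_nhds ht.1 ht.2
      have ht' := Ioo_subset_Icc_self ht
      refine (((hcd' M t ht' k).hasDerivAt hnhds).sub
        ((hcd' N t ht' k).hasDerivAt hnhds)).congr_deriv ?_
      ring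
    · intro t ht k
      have ht' := Ioo_subset_Icc_self ht
      refine (norm_sub_le _ _).trans ?_
      linarith [herrb P M hM t ht' k, herrb P N hN t ht' k]
  have hex : ∀ t k, ∃ z, t ∈ Icc 0 T → Tendsto (fun N => c N t k) atTop (𝓝 z) := by
    intro t k
    by_cases ht : t ∈ Icc 0 T
    · have : CauchySeq fun N => c N t k :=
        cauchySeq_of_le_tendsto_0 ε (fun M N P hM hN => by
          rw [dist_eq_norm]; exact hcauchy P M N hM hN t ht k) hεlim
      obtain ⟨z, hz⟩ := cauchySeq_tendsto_of_complete this
      exact ⟨z, fun _ => hz⟩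
    · exact ⟨0, fun h => absurd h ht⟩
  choose b hb using hex
  have hbε : ∀ P, ∀ t ∈ Icc 0 T, ∀ k, ‖c P t k - b t k‖ ≤ ε P := by
    intro P t ht k
    refine le_of_tendsto ((tendsto_const_nhds.sub (hb t k ht)).norm) ?_
    filter_upwards [eventually_ge_atTop P] with N hN
    exact hcauchy P P N le_rfl hN t ht k
  have hbD : ∀ t ∈ Icc 0 T, ∀ k, ‖b t k‖ ≤ D k := fun t ht k =>
    le_of_tendsto (hb t k ht).norm (Eventually.of_forall fun N => hcD N t ht k)
  have hunif : ∀ k, TendstoUniformlyOn (fun N t => c N t k) (fun t => b t k) atTop (Icc 0 T) := by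
    intro k
    rw [Metric.tendstoUniformlyOn_iff]
    intro e he
    filter_upwards [hεlim.eventually_lt_const he] with N hN t ht
    rw [dist_comm, dist_eq_norm]
    exact (hbε N t ht k).trans_lt hN
  refine ⟨b, hbD, ?_, ?_, ?_, ?_, ?_⟩
  · intro t ht k
    refine tendsto_nhds_unique (hb t (-k) ht) ?_
    refine ((Complex.continuous_conj.tendsto _).comp (hb t k ht)).congr fun N => ?_
    exact (hcreal N t ht k).symm
  · intro t ht
    exact tendsto_nhds_unique (hb t 0 ht) (by simp only [hcz]; exact tendsto_const_nhds)
  · intro k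
    refine tendsto_nhds_unique (hb 0 k (left_mem_Icc.mpr hT)) ?_
    by_cases hk : k = 0
    · subst hk
      simp only [hcz, hc₀0]; exact tendsto_const_nhds
    · refine tendsto_const_nhds.congr' ?_
      obtain ⟨P, hP⟩ := (tendsto_freqBox (d := d)).eventually
        (eventually_ge_atTop ({k} : Finset (Fin d → ℤ))) |>.exists
      filter_upwards [eventually_ge_atTop P] with N hN
      have : k ∈ F N := hFmono hN (Finset.mem_erase.mpr ⟨hk, hP (Finset.mem_singleton_self k)⟩)
      exact (hc0 N k this).symm
  · intro k
    exact (hunif k).continuousOn (Eventually.of_forall fun N => hccont N k).frequently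
  · intro t ht k
    refine hasDerivAt_of_tendstoUniformlyOn (l := atTop) (f := fun N t => c N t k)
      (f' := fun N t => -(lam k * c N t k) - convection q (c N t) (c N t) k + S k + err N t k)
      (g' := fun t => -(lam k * b t k) - convection q (b t) (b t) k + S k) isOpen_Ioo
      ?_ ?_ ?_ ht
    · rw [Metric.tendstoUniformlyOn_iff]
      intro e he
      have hlim : Tendsto (fun N => lam k * ε N + A * freqNorm k * (2 * ∑' k, D k) * ε N +
          (∑' k, η N k) / 2) atTop (𝓝 0) := by
        have := ((hεlim.const_mul (lam k)).add
          (hεlim.const_mul (A * freqNorm k * (2 * ∑' k, D k)))).add (hηlim.div_const 2)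
        simpa using this
      filter_upwards [hlim.eventually_lt_const he] with N hN t ht
      have ht' := Ioo_subset_Icc_self ht
      refine lt_of_le_of_lt ?_ hN
      rw [dist_comm, dist_eq_norm]
      have e1 : -(lam k * c N t k) - convection q (c N t) (c N t) k + S k + err N t k -
          (-(lam k * b t k) - convection q (b t) (b t) k + S k) =
          -(lam k * (c N t k - b t k)) -
            (convection q (c N t) (c N t) k - convection q (b t) (b t) k) + err N t k := by ring
      rw [e1]
      refine (norm_add_le _ _).trans (add_le_add ((norm_sub_le _ _).trans (add_le_add ?_ ?_)) ?_)
      · rw [norm_neg, norm_mul, Complex.norm_real, Real.norm_of_nonneg (hlam k)]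
        exact mul_le_mul_of_nonneg_left (hbε N t ht' k) (hlam k)
      · exact norm_convection_sub_le hq hD (hcD N t ht') (hbD t ht') (hbε N t ht') k
      · refine (herrb N N le_rfl t ht' k).trans ?_
        have := (hηs N).le_tsum k fun j _ => hη0 N j
        linarith
    · refine Eventually.of_forall fun N t ht => ?_
      exact (hcd' N t (Ioo_subset_Icc_self ht) k).hasDerivAt (Icc_mem_nhds ht.1 ht.2)
    · exact fun t ht => hb t k (Ioo_subset_Icc_self ht)

end Spectral

end ActiveScalar

namespace ActiveScalar

open Filter Topology ComplexConjugate Set MeasureTheory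

/-! ### Fourier series on the torus of period `2π`. -/

section FourierSeries

variable {d : ℕ}

/-- The Fourier coefficient of a complex-valued function on the torus. -/
noncomputable def torusCoef (f : (Fin d → ℝ) → ℂ) (k : Fin d → ℤ) : ℂ :=
  (1 / (2 * (Real.pi : ℂ)) ^ d) *
    ∫ x in Icc (fun _ : Fin d => (0 : ℝ)) (fun _ => 2 * Real.pi), f x * character (-k) x

theorem fourierCoef_eq_torusCoef (f : (Fin d → ℝ) → ℝ) :
    fourierCoef f = torusCoef (fun x => (f x : ℂ)) := rfl

@[simp] theorem norm_character (k : Fin d → ℤ) (x : Fin d → ℝ) : ‖character k x‖ = 1 := by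
  rw [character, mul_comm, Complex.norm_exp_ofReal_mul_I]

theorem character_add (k l : Fin d → ℤ) (x : Fin d → ℝ) :
    character (k + l) x = character k x * character l x := by
  simp only [character, ← Complex.exp_add, ← mul_add, ← Complex.ofReal_add,
    ← Finset.sum_add_distrib, ← add_mul, Pi.add_apply, Int.cast_add]

theorem conj_character (k : Fin d → ℤ) (x : Fin d → ℝ) :
    conj (character k x) = character (-k) x := by
  simp only [character, ← Complex.exp_conj, map_mul, Complex.conj_I, Complex.conj_ofReal,
    Pi.neg_apply, Int.cast_neg, neg_mul, Finset.sum_neg_distrib, Complex.ofReal_neg, mul_neg]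

@[fun_prop]
theorem continuous_character (k : Fin d → ℤ) : Continuous (character k) := by
  unfold character; fun_prop

theorem character_zero (x : Fin d → ℝ) : character (0 : Fin d → ℤ) x = 1 := by
  simp [character]

theorem character_add_period (k : Fin d → ℤ) (x : Fin d → ℝ) (i : Fin d) :
    character k (x + Pi.single i (2 * Real.pi)) = character k x := by
  have e : ∑ j, (k j : ℝ) * (x + Pi.single i (2 * Real.pi) : Fin d → ℝ) j =
      (∑ j, (k j : ℝ) * x j) + k i * (2 * Real.pi) := by
    simp [mul_add, Finset.sum_add_distrib, Pi.single_apply]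
  rw [character, e, character]
  push_cast
  rw [mul_add, Complex.exp_add]
  have : Complex.I * ((k i : ℂ) * (2 * Real.pi)) = k i * (2 * Real.pi * Complex.I) := by ring
  rw [this, Complex.exp_int_mul_two_pi_mul_I, mul_one]

theorem mFourier_coe_eq_character (k : Fin d → ℤ) (y : Fin d → ℝ) :
    UnitAddTorus.mFourier k (fun i => (y i : UnitAddCircle)) =
      character k ((2 * Real.pi) • y) := by
  simp only [UnitAddTorus.mFourier, ContinuousMap.coe_mk, fourier_coe_apply, character,
    ← Complex.exp_sum]
  congr 1
  push_cast
  rw [Finset.mul_sum]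
  refine Finset.sum_congr rfl fun i _ => ?_
  simp only [Pi.smul_apply, smul_eq_mul]
  push_cast
  ring

open scoped Pointwise in
-- The dilation by `2π` carries the unit cell to `[0,2π]^d`; its Jacobian is the normalising
-- constant, and half-open and closed cubes differ by a null set.
theorem torusCoef_eq_mFourierCoeff {f : (Fin d → ℝ) → ℂ} {F : UnitAddTorus (Fin d) → ℂ}
    (h : ∀ y : Fin d → ℝ, F (fun i => (y i : UnitAddCircle)) = f ((2 * Real.pi) • y))
    (k : Fin d → ℤ) : torusCoef f k = UnitAddTorus.mFourierCoeff F k := by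
  have hπ : 0 < 2 * Real.pi := by positivity
  rw [UnitAddTorus.mFourierCoeff_eq_integral F k 0]
  simp only [mFourier_coe_eq_character, h, smul_eq_mul]
  rw [Measure.setIntegral_comp_smul_of_pos volume
    (fun x => character (-k) x * f x) _ hπ]
  have hset : (2 * Real.pi) • {x : Fin d → ℝ | ∀ i, x i ∈
      Ioc ((0 : Fin d → ℝ) i) ((0 : Fin d → ℝ) i + 1)} =
      Set.univ.pi fun _ => Ioc 0 (2 * Real.pi) := by
    ext x
    rw [mem_smul_set_iff_inv_smul_mem₀ hπ.ne']
    simp only [Pi.zero_apply, zero_add, mem_ofPred_eq, Pi.smul_apply, smul_eq_mul, mem_Ioc,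
      mem_univ_pi]
    refine forall_congr' fun i => and_congr ?_ ?_
    · rw [mul_pos_iff_of_pos_left (by positivity)]
    · rw [inv_mul_le_iff₀ hπ, mul_one]
  have hae : (Set.univ.pi fun _ : Fin d => Ioc 0 (2 * Real.pi)) =ᵐ[volume]
      Icc (fun _ : Fin d => (0 : ℝ)) (fun _ => 2 * Real.pi) := by
    rw [volume_pi]; exact Measure.univ_pi_Ioc_ae_eq_Icc
  rw [hset, setIntegral_congr_set hae, torusCoef]
  simp only [Module.finrank_fintype_fun_eq_card, Fintype.card_fin, Complex.real_smul]
  push_cast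
  rw [one_div]
  congr 1
  exact integral_congr_ae (Eventually.of_forall fun x => mul_comm _ _)

theorem torusCoef_character (m k : Fin d → ℤ) :
    torusCoef (character m) k = if m = k then 1 else 0 := by
  rw [torusCoef_eq_mFourierCoeff (F := UnitAddTorus.mFourier m)
    (fun y => mFourier_coe_eq_character m y)]
  have h := (orthonormal_iff_ite.mp (UnitAddTorus.orthonormal_mFourier (d := Fin d))) k m
  rw [ContinuousMap.inner_toLp] at h
  rw [UnitAddTorus.mFourierCoeff]
  simp only [eq_comm (a := m)]
  rw [← h]
  refine integral_congr_ae (Eventually.of_forall fun x => ?_)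
  simp only [smul_eq_mul, UnitAddTorus.mFourier_neg]
  first | rfl | exact mul_comm _ _

theorem periodic_int {β : Type*} {f : (Fin d → ℝ) → β}
    (hf : ∀ (x : Fin d → ℝ) (i : Fin d), f (x + Pi.single i (2 * Real.pi)) = f x)
    (n : Fin d → ℤ) (x : Fin d → ℝ) : f (x + (2 * Real.pi) • fun i => (n i : ℝ)) = f x := by
  have h : ∀ s : Finset (Fin d),
      Function.Periodic f (∑ i ∈ s, n i • (Pi.single i (2 * Real.pi) : Fin d → ℝ)) := by
    intro s
    induction s using Finset.induction_on with
    | empty => intro x; simp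
    | insert i s hi ih =>
      rw [Finset.sum_insert hi]
      exact Function.Periodic.add_period (Function.Periodic.zsmul (fun x => hf x i) (n i)) ih
  rw [← h Finset.univ x]
  congr 2
  funext j
  simp [Pi.single_apply, mul_comm]

/-- Fourier inversion for continuous periodic functions with summable coefficients. -/
theorem hasSum_torusCoef {f : (Fin d → ℝ) → ℂ} (hf : Continuous f)
    (hper : ∀ (x : Fin d → ℝ) (i : Fin d), f (x + Pi.single i (2 * Real.pi)) = f x)
    (hs : Summable (torusCoef f)) (x : Fin d → ℝ) :
    HasSum (fun k => torusCoef f k * character k x) (f x) := by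
  -- `f` is pushed to the quotient torus through representatives in `[0,1)`; these jump, so
  -- continuity of `F` is recovered below from periodicity and the quotient map.
  let F : UnitAddTorus (Fin d) → ℂ := fun z =>
    f ((2 * Real.pi) • fun i => ((AddCircle.equivIco 1 0 (z i)).1 : ℝ))
  have hF : ∀ y : Fin d → ℝ, F (fun i => (y i : UnitAddCircle)) = f ((2 * Real.pi) • y) := by
    intro y
    have h : ∀ i, ∃ n : ℤ, y i = ((AddCircle.equivIco 1 0 (y i : UnitAddCircle)).1 : ℝ) + n := by
      intro i
      refine ⟨⌊y i⌋, ?_⟩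
      rw [AddCircle.coe_equivIco_mk_apply, div_one, mul_one, Int.fract_add_floor]
    choose n hn using h
    have e : (2 * Real.pi) • y =
        ((2 * Real.pi) • fun i => ((AddCircle.equivIco 1 0 (y i : UnitAddCircle)).1 : ℝ)) +
          (2 * Real.pi) • fun i => (n i : ℝ) := by
      rw [← smul_add]
      congr 1
      funext i
      exact hn i
    rw [e, periodic_int hper]
  have hq : IsOpenQuotientMap (Pi.map fun (_ : Fin d) (y : ℝ) => (y : UnitAddCircle)) :=
    IsOpenQuotientMap.piMap fun _ => QuotientAddGroup.isOpenQuotientMap_mk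
  have hFc : Continuous F := by
    rw [hq.isQuotientMap.continuous_iff]
    have : F ∘ (Pi.map fun (_ : Fin d) (y : ℝ) => (y : UnitAddCircle)) =
        fun y => f ((2 * Real.pi) • y) := funext hF
    rw [this]
    fun_prop
  have hco : ∀ k, torusCoef f k = UnitAddTorus.mFourierCoeff F k :=
    torusCoef_eq_mFourierCoeff hF
  have hs' : Summable (UnitAddTorus.mFourierCoeff (⟨F, hFc⟩ : C(UnitAddTorus (Fin d), ℂ))) :=
    hs.congr hco
  have h := UnitAddTorus.hasSum_mFourier_series_apply_of_summable hs'
    (fun i => (((2 * Real.pi)⁻¹ • x) i : UnitAddCircle))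
  simp only [ContinuousMap.coe_mk, mFourier_coe_eq_character, hF, smul_eq_mul, ← hco] at h
  rwa [smul_inv_smul₀ (by positivity)] at h

/-- Coefficients of a uniformly convergent trigonometric series. -/
theorem torusCoef_tsum {c : (Fin d → ℤ) → ℂ} (hc : Summable fun k => ‖c k‖) (k : Fin d → ℤ) :
    torusCoef (fun x => ∑' m, c m * character m x) k = c k := by
  have hcont : ∀ m, Continuous fun x => c m * character m x * character (-k) x := fun m =>
    (continuous_const.mul (continuous_character m)).mul (continuous_character (-k))
  set μ := (volume : Measure (Fin d → ℝ)).restrict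
    (Icc (fun _ : Fin d => (0 : ℝ)) (fun _ => 2 * Real.pi)) with hμ
  have hbd : ∀ m, ∀ᵐ x ∂μ, ‖c m * character m x * character (-k) x‖ ≤ ‖c m‖ := fun m =>
    Eventually.of_forall fun x => by rw [norm_mul, norm_mul, norm_character, norm_character,
      mul_one, mul_one]
  have hs : ∀ x, Summable fun m => c m * character m x := fun x =>
    Summable.of_norm_bounded hc fun m => by rw [norm_mul, norm_character, mul_one]
  have hsm : ∀ x, HasSum (fun m => c m * character m x * character (-k) x)
      ((∑' m, c m * character m x) * character (-k) x) := fun x => (hs x).hasSum.mul_right _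
  have hint : Integrable (fun _ : Fin d → ℝ => ∑' m, ‖c m‖) μ :=
    integrableOn_const isCompact_Icc.measure_lt_top.ne
  have h := hasSum_integral_of_dominated_convergence (fun m _ => ‖c m‖)
    (fun m => (hcont m).aestronglyMeasurable) hbd (Eventually.of_forall fun _ => hc) hint
    (Eventually.of_forall hsm)
  have h2 := h.mul_left (1 / (2 * (Real.pi : ℂ)) ^ d)
  have e : ∀ m, 1 / (2 * (Real.pi : ℂ)) ^ d *
      ∫ x in Icc (fun _ : Fin d => (0 : ℝ)) (fun _ => 2 * Real.pi),
        c m * character m x * character (-k) x = if m = k then c k else 0 := by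
    intro m
    simp only [mul_assoc (c m), integral_const_mul]
    have := torusCoef_character m k
    rw [torusCoef] at this
    rw [mul_left_comm, this]
    split_ifs with h
    · rw [h, mul_one]
    · rw [mul_zero]
  rw [torusCoef]
  refine HasSum.unique (f := fun m => if m = k then c k else 0) ?_ (hasSum_ite_eq k (c k))
  rw [← funext e]
  exact h2

theorem continuous_tsum_character {c : (Fin d → ℤ) → ℂ} (hc : Summable fun k => ‖c k‖) :
    Continuous fun x => ∑' k, c k * character k x :=
  continuous_tsum (fun k => by fun_prop) hc fun k x => by simp

theorem conj_tsum_character {c : (Fin d → ℤ) → ℂ} (hc : ∀ k, c (-k) = conj (c k))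
    (x : Fin d → ℝ) : conj (∑' k, c k * character k x) = ∑' k, c k * character k x := by
  rw [Complex.conj_tsum, ← (Equiv.neg (Fin d → ℤ)).tsum_eq]
  refine tsum_congr fun k => ?_
  simp [hc, conj_character]

theorem fourierCoef_neg (f : (Fin d → ℝ) → ℝ) (k : Fin d → ℤ) :
    fourierCoef f (-k) = conj (fourierCoef f k) := by
  simp only [fourierCoef, map_mul, map_div₀, map_one, map_pow, Complex.conj_ofReal, map_ofNat,
    ← integral_conj, conj_character]

theorem IsMeanZeroTorusFunction.fourierCoef_zero {f : (Fin d → ℝ) → ℝ}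
    (hf : IsMeanZeroTorusFunction f) : fourierCoef f 0 = 0 := by
  have h := hf.mean_zero
  simp only [fourierCoef, neg_zero, character_zero, mul_one]
  rw [integral_complex_ofReal, h]
  simp

theorem IsMeanZeroTorusFunction.hasSum {f : (Fin d → ℝ) → ℝ}
    (hf : IsMeanZeroTorusFunction f) (hs : Summable (fourierCoef f)) (x : Fin d → ℝ) :
    HasSum (fun k => fourierCoef f k * character k x) (f x : ℂ) :=
  hasSum_torusCoef (f := fun x => (f x : ℂ)) (Complex.continuous_ofReal.comp hf.continuous)
    (fun x i => by rw [hf.periodic]) hs x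

/-- Synthesis of a real mean-zero torus function from its Fourier coefficients. -/
theorem isMeanZeroTorusFunction_tsum {c : (Fin d → ℤ) → ℂ} (hc : Summable fun k => ‖c k‖)
    (hreal : ∀ k, c (-k) = conj (c k)) (h0 : c 0 = 0) :
    IsMeanZeroTorusFunction (fun x => (∑' k, c k * character k x).re) ∧
      (∀ x, (((∑' k, c k * character k x).re : ℝ) : ℂ) = ∑' k, c k * character k x) ∧
      fourierCoef (fun x => (∑' k, c k * character k x).re) = c := by
  have hre : ∀ x, (((∑' k, c k * character k x).re : ℝ) : ℂ) = ∑' k, c k * character k x :=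
    fun x => Complex.conj_eq_iff_re.mp (conj_tsum_character hreal x)
  have hco : fourierCoef (fun x => (∑' k, c k * character k x).re) = c := by
    funext k
    rw [fourierCoef_eq_torusCoef]
    simp only [hre]
    exact torusCoef_tsum hc k
  refine ⟨⟨Complex.continuous_re.comp (continuous_tsum_character hc), fun x i => ?_, ?_⟩,
    hre, hco⟩
  · simp only [character_add_period]
  · have h := congrFun hco 0
    rw [h0, fourierCoef] at h
    simp only [neg_zero, character_zero, mul_one] at h
    rw [integral_complex_ofReal] at h
    have hne : (1 / (2 * (Real.pi : ℂ)) ^ d) ≠ 0 := by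
      have : (Real.pi : ℂ) ≠ 0 := by exact_mod_cast Real.pi_ne_zero
      exact one_div_ne_zero (pow_ne_zero _ (mul_ne_zero two_ne_zero this))
    exact_mod_cast (mul_eq_zero.mp h).resolve_left hne

/-- Termwise differentiation of a Fourier series. -/
theorem IsMeanZeroTorusFunction.hasSum_fderiv {f : (Fin d → ℝ) → ℝ}
    (hf : IsMeanZeroTorusFunction f) (hs : Summable fun k => ‖fourierCoef f k‖)
    (hs1 : Summable fun k => freqNorm k * ‖fourierCoef f k‖) (x : Fin d → ℝ) (j : Fin d) :
    ((fderiv ℝ f x (Pi.single j 1) : ℝ) : ℂ) =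
      ∑' k, Complex.I * (k j : ℂ) * fourierCoef f k * character k x := by
  set c := fourierCoef f
  let ell : (Fin d → ℤ) → ((Fin d → ℝ) →L[ℝ] ℝ) := fun k =>
    ∑ i, (k i : ℝ) • ContinuousLinearMap.proj (R := ℝ) (φ := fun _ : Fin d => ℝ) i
  have hell : ∀ k y, ell k y = ∑ i, (k i : ℝ) * y i := fun k y => by
    simp [ell]
  let g' : (Fin d → ℤ) → (Fin d → ℝ) → ((Fin d → ℝ) →L[ℝ] ℂ) := fun k y =>
    (c k * character k y * Complex.I) • (Complex.ofRealCLM.comp (ell k))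
  have hg' : ∀ k y, HasFDerivAt (fun y => c k * character k y) (g' k y) y := by
    intro k y
    have h1 : HasFDerivAt (fun y => ((∑ i, (k i : ℝ) * y i : ℝ) : ℂ))
        (Complex.ofRealCLM.comp (ell k)) y := by
      have := (Complex.ofRealCLM.comp (ell k)).hasFDerivAt (x := y)
      refine this.congr_of_eventuallyEq (Eventually.of_forall fun z => ?_)
      simp [hell]
    have h2 := ((h1.const_mul Complex.I).cexp).const_mul (c k)
    refine h2.congr_fderiv ?_
    ext v
    simp only [g', character, smul_apply, smul_eq_mul]
    ring
  have hnell : ∀ k, ‖ell k‖ ≤ d * freqNorm k := by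
    intro k
    refine ContinuousLinearMap.opNorm_le_bound _
      (mul_nonneg (Nat.cast_nonneg _) (freqNorm_nonneg k)) fun y => ?_
    rw [hell]
    refine (norm_sum_le _ _).trans ?_
    refine (Finset.sum_le_card_nsmul _ _ (freqNorm k * ‖y‖) fun i _ => ?_).trans ?_
    · rw [norm_mul]
      exact mul_le_mul (abs_le_freqNorm k i) (norm_le_pi_norm y i) (norm_nonneg _)
        (freqNorm_nonneg k)
    · simp [mul_assoc]
  have hbound : ∀ k y, ‖g' k y‖ ≤ d * (freqNorm k * ‖c k‖) := by
    intro k y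
    simp only [g', norm_smul, norm_mul, norm_character, Complex.norm_I, mul_one]
    have h1 : ‖Complex.ofRealCLM.comp (ell k)‖ ≤ ‖ell k‖ := by
      refine (ContinuousLinearMap.opNorm_comp_le _ _).trans ?_
      rw [Complex.ofRealCLM_norm, one_mul]
    calc ‖c k‖ * ‖Complex.ofRealCLM.comp (ell k)‖ ≤ ‖c k‖ * (d * freqNorm k) :=
          mul_le_mul_of_nonneg_left (h1.trans (hnell k)) (norm_nonneg _)
      _ = _ := by ring
  have hsum := hs1.mul_left (d : ℝ)
  have hsx : Summable fun k => c k * character k x := Summable.of_norm (by simpa using hs)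
  have hder : HasFDerivAt (fun y => ∑' k, c k * character k y) (∑' k, g' k x) x :=
    hasFDerivAt_tsum hsum hg' hbound hsx x
  have hfx : (fun y => ∑' k, c k * character k y) = fun y => (f y : ℂ) :=
    funext fun y => (hf.hasSum hs.of_norm y).tsum_eq
  rw [hfx] at hder
  have hfd : HasFDerivAt f (Complex.reCLM.comp (∑' k, g' k x)) x := by
    have := Complex.reCLM.hasFDerivAt.comp x hder
    exact this
  have hgs : Summable fun k => g' k x := Summable.of_norm_bounded hsum fun k => hbound k x
  have h3 : (∑' k, g' k x) (Pi.single j 1) = ((fderiv ℝ f x (Pi.single j 1) : ℝ) : ℂ) := by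
    have h4 : HasFDerivAt (fun y => (f y : ℂ)) (Complex.ofRealCLM.comp (fderiv ℝ f x)) x :=
      Complex.ofRealCLM.hasFDerivAt.comp x hfd.differentiableAt.hasFDerivAt
    rw [hder.unique h4]
    simp
  have h5 := (ContinuousLinearMap.apply ℝ ℂ (Pi.single j (1 : ℝ) : Fin d → ℝ)).map_tsum hgs
  simp only [ContinuousLinearMap.apply_apply] at h5
  rw [← h3, h5]
  refine tsum_congr fun k => ?_
  simp only [g', smul_apply, ContinuousLinearMap.comp_apply, hell,
    Complex.ofRealCLM_apply, smul_eq_mul]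
  simp [Pi.single_apply]
  ring

end FourierSeries

/-! ### The equation on the Fourier side. -/

section Symbols

variable {d : ℕ} {T : Fin d → Fin d → (Fin d → ℤ) → ℂ} {Cstar : ℝ}

/-- The symbol of `u·∇` for the velocity `u_j = ∑_i ∂_{x_i} T_{ij} θ`. -/
noncomputable def transportKernel (T : Fin d → Fin d → (Fin d → ℤ) → ℂ) (m n : Fin d → ℤ) : ℂ :=
  ∑ j, (∑ i, derivSymbol T i j m) * (Complex.I * (n j : ℂ))

theorem norm_derivSymbol_le (hCpos : 0 ≤ Cstar)
    (hC : ∀ i j k, k ≠ 0 → ‖derivSymbol T i j k‖ ≤ Cstar) (i j : Fin d) (k : Fin d → ℤ) :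
    ‖derivSymbol T i j k‖ ≤ Cstar := by
  by_cases hk : k = 0
  · simpa [hk, derivSymbol] using hCpos
  · exact hC i j k hk

theorem norm_sum_derivSymbol_le (hCpos : 0 ≤ Cstar)
    (hC : ∀ i j k, k ≠ 0 → ‖derivSymbol T i j k‖ ≤ Cstar) (j : Fin d) (k : Fin d → ℤ) :
    ‖∑ i, derivSymbol T i j k‖ ≤ d * Cstar := by
  refine (norm_sum_le _ _).trans ((Finset.sum_le_card_nsmul _ _ Cstar fun i _ =>
    norm_derivSymbol_le hCpos hC i j k).trans ?_)
  simp

/-- `add_right` is the divergence condition: `q` is additive in its second variable and `q(m,m)` is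
minus the sum that `div_free` annihilates. `neg_left` is the reality of the symbols. -/
theorem isTransportKernel_transportKernel (hT : IsAdmissible T) (hCpos : 0 ≤ Cstar)
    (hC : ∀ i j k, k ≠ 0 → ‖derivSymbol T i j k‖ ≤ Cstar) :
    IsTransportKernel (transportKernel T) (d * (d * Cstar)) where
  nonneg := by positivity
  neg_left m n := by
    simp only [transportKernel, derivSymbol, hT.real, map_sum, map_mul, Complex.conj_I,
      ← Finset.sum_neg_distrib, Pi.neg_apply]
    refine Finset.sum_congr rfl fun j _ => ?_
    rw [Finset.sum_mul, Finset.sum_mul, ← Finset.sum_neg_distrib]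
    refine Finset.sum_congr rfl fun i _ => ?_
    push_cast
    simp only [map_intCast]
    ring
  add_right m n := by
    simp only [transportKernel, Pi.add_apply, Int.cast_add, mul_add, Finset.sum_add_distrib]
    have h := hT.div_free m
    have : ∑ j, (∑ i, derivSymbol T i j m) * (Complex.I * (m j : ℂ)) =
        -∑ i, ∑ j, (m i : ℂ) * (m j : ℂ) * T i j m := by
      rw [Finset.sum_comm, ← Finset.sum_neg_distrib]
      refine Finset.sum_congr rfl fun j _ => ?_
      rw [Finset.sum_mul, ← Finset.sum_neg_distrib]
      refine Finset.sum_congr rfl fun i _ => ?_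
      simp only [derivSymbol]
      linear_combination (m i : ℂ) * (m j : ℂ) * T i j m * Complex.I_mul_I
    rw [this, h, neg_zero, zero_add]
  norm_le m n := by
    refine (norm_sum_le _ _).trans ((Finset.sum_le_card_nsmul _ _ (d * Cstar * freqNorm n)
      fun j _ => ?_).trans ?_)
    · rw [norm_mul, norm_mul, Complex.norm_I, one_mul, Complex.norm_intCast]
      exact mul_le_mul (norm_sum_derivSymbol_le hCpos hC j m) (abs_le_freqNorm n j)
        (abs_nonneg _) (by positivity)
    · simp only [Finset.card_univ, Fintype.card_fin, nsmul_eq_mul]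
      exact le_of_eq (by ring)

theorem transportKernel_neg_right (m n : Fin d → ℤ) :
    transportKernel T m (-n) = -transportKernel T m n := by
  simp [transportKernel, Finset.sum_neg_distrib]

variable {f S : (Fin d → ℝ) → ℝ} {D : (Fin d → ℤ) → ℝ}

theorem velocity_eq_tsum (hCpos : 0 ≤ Cstar)
    (hC : ∀ i j k, k ≠ 0 → ‖derivSymbol T i j k‖ ≤ Cstar)
    (hs : Summable fun k => ‖fourierCoef f k‖) (j : Fin d) (x : Fin d → ℝ) :
    velocity T f j x =
      ∑' k, (∑ i, derivSymbol T i j k) * fourierCoef f k * character k x := by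
  have h : ∀ i, Summable fun k => derivSymbol T i j k * fourierCoef f k * character k x :=
    fun i => Summable.of_norm_bounded (hs.mul_left Cstar) fun k => by
      rw [norm_mul, norm_mul, norm_character, mul_one]
      exact mul_le_mul_of_nonneg_right (norm_derivSymbol_le hCpos hC i j k) (norm_nonneg _)
  simp only [velocity, fourierMultiplier]
  rw [← Summable.tsum_finsetSum fun i _ => h i]
  simp only [Finset.sum_mul]

/-- The series for velocity and gradient converge absolutely, so their products can be regrouped
along `m + n = k`. -/
theorem sum_velocity_mul_fderiv (hT : IsAdmissible T) (hCpos : 0 ≤ Cstar)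
    (hC : ∀ i j k, k ≠ 0 → ‖derivSymbol T i j k‖ ≤ Cstar) (hf : IsMeanZeroTorusFunction f)
    (hs : Summable fun k => ‖fourierCoef f k‖)
    (hs1 : Summable fun k => freqNorm k * ‖fourierCoef f k‖) (x : Fin d → ℝ) :
    HasSum (fun k => convection (transportKernel T) (fourierCoef f) (fourierCoef f) k *
      character k x)
      (∑ j, velocity T f j x * ((fderiv ℝ f x (Pi.single j 1) : ℝ) : ℂ)) := by
  set c := fourierCoef f with hc
  have hq := isTransportKernel_transportKernel hT hCpos hC
  have h1 : ∀ j, Summable fun k => ‖(∑ i, derivSymbol T i j k) * c k * character k x‖ :=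
    fun j => Summable.of_nonneg_of_le (fun _ => norm_nonneg _) (fun k => by
      rw [norm_mul, norm_mul, norm_character, mul_one]
      exact mul_le_mul_of_nonneg_right (norm_sum_derivSymbol_le hCpos hC j k) (norm_nonneg _))
      (hs.mul_left (d * Cstar))
  have h2 : ∀ j : Fin d, Summable fun k => ‖Complex.I * (k j : ℂ) * c k * character k x‖ :=
    fun j => Summable.of_nonneg_of_le (fun _ => norm_nonneg _) (fun k => by
      rw [norm_mul, norm_mul, norm_mul, norm_character, mul_one, Complex.norm_I, one_mul,
        Complex.norm_intCast]
      exact mul_le_mul_of_nonneg_right (abs_le_freqNorm k j) (norm_nonneg _)) hs1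
  set g : (Fin d → ℤ) × (Fin d → ℤ) → ℂ := fun p =>
    transportKernel T p.1 p.2 * c p.1 * c p.2 * character (p.1 + p.2) x with hg
  have hgj : ∀ p, g p = ∑ j, ((∑ i, derivSymbol T i j p.1) * c p.1 * character p.1 x) *
      (Complex.I * (p.2 j : ℂ) * c p.2 * character p.2 x) := by
    intro p
    simp only [hg, transportKernel, character_add, Finset.sum_mul]
    refine Finset.sum_congr rfl fun j _ => Finset.sum_congr rfl fun i _ => by ring
  have hjs := fun j => summable_mul_of_summable_norm (h1 j) (h2 j)
  have hgs : Summable g := by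
    rw [funext hgj]
    exact summable_sum fun j _ => hjs j
  have e1 : ∑ j, velocity T f j x * ((fderiv ℝ f x (Pi.single j 1) : ℝ) : ℂ) = ∑' p, g p := by
    rw [tsum_congr hgj, Summable.tsum_finsetSum fun j _ => hjs j]
    refine Finset.sum_congr rfl fun j _ => ?_
    rw [velocity_eq_tsum hCpos hC hs, hf.hasSum_fderiv hs hs1,
      tsum_mul_tsum_of_summable_norm (h1 j) (h2 j)]
  obtain ⟨h3, h4⟩ := tsum_tsum_sub_eq hgs
  have e2 : ∀ k, ∑' m, g (m, k - m) = convection (transportKernel T) c c k * character k x := by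
    intro k
    simp only [hg, add_sub_cancel, convection, tsum_mul_right]
  rw [e1, ← h4]
  simp only [e2] at h3 ⊢
  exact h3.hasSum

/-- The right-hand side of the equation as a Fourier series. -/
theorem hasSum_rhs (hT : IsAdmissible T) (hCpos : 0 ≤ Cstar)
    (hC : ∀ i j k, k ≠ 0 → ‖derivSymbol T i j k‖ ≤ Cstar) (hf : IsMeanZeroTorusFunction f)
    (hS : IsMeanZeroTorusFunction S) {γ κ : ℝ} (hs : Summable fun k => ‖fourierCoef f k‖)
    (hs1 : Summable fun k => freqNorm k * ‖fourierCoef f k‖)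
    (hsγ : Summable fun k => freqNorm k ^ γ * ‖fourierCoef f k‖)
    (hSs : Summable (fourierCoef S)) (x : Fin d → ℝ) :
    HasSum (fun k => (-(((κ * freqNorm k ^ γ : ℝ) : ℂ) * fourierCoef f k) -
        convection (transportKernel T) (fourierCoef f) (fourierCoef f) k + fourierCoef S k) *
          character k x)
      (-(∑ j, velocity T f j x * ((fderiv ℝ f x (Pi.single j 1) : ℝ) : ℂ))
        - (κ : ℂ) * fracLaplacian γ f x + (S x : ℂ)) := by
  have h1 := sum_velocity_mul_fderiv hT hCpos hC hf hs hs1 x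
  have h2 : Summable fun k => ((freqNorm k ^ γ : ℝ) : ℂ) * fourierCoef f k * character k x :=
    Summable.of_norm_bounded hsγ fun k => by
      rw [norm_mul, norm_mul, norm_character, mul_one, Complex.norm_real,
        Real.norm_of_nonneg (Real.rpow_nonneg (freqNorm_nonneg k) _)]
  have h3 := hS.hasSum hSs x
  have h4 := ((h1.neg).sub (h2.hasSum.mul_left (κ : ℂ))).add h3
  convert! h4 using 2 with k
  push_cast
  ring

end Symbols

/-! ### Passing between the Gevrey norm and bounds on coefficients. -/

section GevreyNorm

variable {d : ℕ}

theorem sum_le_of_gevreyNorm_le {s r τ M : ℝ} {f : (Fin d → ℝ) → ℝ} (hM : 0 ≤ M)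
    (h : gevreyNorm s r τ f ≤ ENNReal.ofReal M) {F : Finset (Fin d → ℤ)}
    (hF : (0 : Fin d → ℤ) ∉ F) :
    ∑ k ∈ F, freqNorm k ^ (2 * r) * Real.exp (2 * τ * freqNorm k ^ (1 / s)) *
      ‖fourierCoef f k‖ ^ 2 ≤ M ^ 2 := by
  classical
  set g : (Fin d → ℤ) → ℝ := fun k =>
    freqNorm k ^ (2 * r) * Real.exp (2 * τ * freqNorm k ^ (1 / s)) * ‖fourierCoef f k‖ ^ 2
  have hg : ∀ k, 0 ≤ g k := fun k => mul_nonneg (mul_nonneg (Real.rpow_nonneg (freqNorm_nonneg k) _)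
    (Real.exp_pos _).le) (sq_nonneg _)
  have h1 : ∑' k : {k : Fin d → ℤ // k ≠ 0}, ENNReal.ofReal (g k.1) ≤ ENNReal.ofReal (M ^ 2) := by
    have h2 := ENNReal.rpow_le_rpow h (show (0 : ℝ) ≤ 2 by norm_num)
    rw [gevreyNorm, ← ENNReal.rpow_mul, ENNReal.ofReal_rpow_of_nonneg hM (by norm_num)] at h2
    rw [show (1 / 2 : ℝ) * 2 = 1 by norm_num, ENNReal.rpow_one, Real.rpow_two] at h2
    exact h2
  have h3 : ∑ k ∈ F, ENNReal.ofReal (g k) ≤ ENNReal.ofReal (M ^ 2) := by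
    refine le_trans ?_ h1
    have hne : ∀ k ∈ F, k ≠ 0 := fun k hk h => hF (h ▸ hk)
    rw [← Finset.sum_subtype_of_mem (fun k => ENNReal.ofReal (g k)) hne]
    exact ENNReal.sum_le_tsum _
  rw [← ENNReal.ofReal_sum_of_nonneg fun k _ => hg k] at h3
  exact (ENNReal.ofReal_le_ofReal_iff (sq_nonneg M)).mp h3

theorem gevreyNorm_le_of_summable {s r τ : ℝ} {f : (Fin d → ℝ) → ℝ} {u : (Fin d → ℤ) → ℝ}
    (hu : Summable u) (h : ∀ k, freqNorm k ^ (2 * r) * Real.exp (2 * τ * freqNorm k ^ (1 / s)) *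
      ‖fourierCoef f k‖ ^ 2 ≤ u k) :
    gevreyNorm s r τ f ≤ ENNReal.ofReal (Real.sqrt (∑' k, u k)) := by
  have hu0 : ∀ k, 0 ≤ u k := fun k => by
    refine le_trans (mul_nonneg (mul_nonneg ?_ (Real.exp_pos _).le) (sq_nonneg _)) (h k)
    exact Real.rpow_nonneg (freqNorm_nonneg k) _
  have h1 : ∑' k : {k : Fin d → ℤ // k ≠ 0}, ENNReal.ofReal (freqNorm k.1 ^ (2 * r) *
      Real.exp (2 * τ * freqNorm k.1 ^ (1 / s)) * ‖fourierCoef f k.1‖ ^ 2) ≤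
      ENNReal.ofReal (∑' k, u k) := by
    rw [ENNReal.ofReal_tsum_of_nonneg hu0 hu]
    have hle : ∀ k : {k : Fin d → ℤ // k ≠ 0}, ENNReal.ofReal (freqNorm k.1 ^ (2 * r) *
        Real.exp (2 * τ * freqNorm k.1 ^ (1 / s)) * ‖fourierCoef f k.1‖ ^ 2) ≤
        ENNReal.ofReal (u k.1) := fun k => ENNReal.ofReal_le_ofReal (h k.1)
    refine (ENNReal.tsum_le_tsum hle).trans ?_
    exact ENNReal.tsum_comp_le_tsum_of_injective Subtype.val_injective
      (fun k => ENNReal.ofReal (u k))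
  have h2 : 0 ≤ ∑' k, u k := tsum_nonneg hu0
  have h3 : ENNReal.ofReal (Real.sqrt (∑' k, u k)) =
      ENNReal.ofReal (∑' k, u k) ^ (1 / 2 : ℝ) := by
    rw [Real.sqrt_eq_rpow, ENNReal.ofReal_rpow_of_nonneg h2 (by norm_num)]
  rw [h3]
  exact ENNReal.rpow_le_rpow h1 (by norm_num)

theorem norm_fourierCoef_le_gevreyDecay {s r τ M : ℝ} {f : (Fin d → ℝ) → ℝ} (hr : 0 ≤ r)
    (hf : IsMeanZeroTorusFunction f) (hM : 0 ≤ M)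
    (h : gevreyNorm s r τ f ≤ ENNReal.ofReal M) (k : Fin d → ℤ) :
    ‖fourierCoef f k‖ ≤ gevreyDecay M τ (1 / s) k := by
  by_cases hk : k = 0
  · rw [hk, hf.fourierCoef_zero, norm_zero]; exact gevreyDecay_nonneg hM 0
  have hF : (0 : Fin d → ℤ) ∉ ({k} : Finset (Fin d → ℤ)) := by simpa using Ne.symm hk
  have h1 := sum_le_of_gevreyNorm_le hM h hF
  rw [Finset.sum_singleton] at h1
  have h2 : 1 ≤ freqNorm k ^ (2 * r) := Real.one_le_rpow (one_le_freqNorm hk) (by linarith)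
  have h3 : Real.exp (2 * τ * freqNorm k ^ (1 / s)) = Real.exp (τ * freqNorm k ^ (1 / s)) ^ 2 := by
    rw [sq, ← Real.exp_add]; ring_nf
  rw [h3, mul_assoc, ← mul_pow] at h1
  have h4 := le_of_sq_le_sq ((le_mul_of_one_le_left (sq_nonneg _) h2).trans h1) hM
  rw [gevreyDecay, Real.exp_neg, ← div_eq_mul_inv, le_div_iff₀ (Real.exp_pos _)]
  linarith

end GevreyNorm

/-! ### One-sided derivatives at the initial time. -/

section Calculus

/-- Only `t = 0` needs an argument: there the one-sided derivative is the limit of the interior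
derivatives. -/
theorem hasDerivWithinAt_Ico_of_continuousOn {E : Type*} [NormedAddCommGroup E] [NormedSpace ℝ E]
    {f f' : ℝ → E} {T : ℝ} (hf : ContinuousOn f (Icc 0 T)) (hf' : ContinuousOn f' (Icc 0 T))
    (h : ∀ t ∈ Ioo 0 T, HasDerivAt f (f' t) t) :
    ∀ t ∈ Ico 0 T, HasDerivWithinAt f (f' t) (Ico 0 T) t := by
  intro t ht
  rcases ht.1.eq_or_lt with h0 | h0
  · subst h0
    refine HasDerivWithinAt.mono ?_ Ico_subset_Ici_self
    have hmem : Ioo (0 : ℝ) T ∈ 𝓝[>] 0 := Ioo_mem_nhdsGT ht.2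
    refine hasDerivWithinAt_Ici_of_tendsto_deriv (s := Ioo 0 T)
      (fun t ht => (h t ht).differentiableAt.differentiableWithinAt)
      ((hf 0 (Ico_subset_Icc_self ht)).mono Ioo_subset_Icc_self) hmem ?_
    have h1 : Tendsto f' (𝓝[>] 0) (𝓝 (f' 0)) := by
      refine ((hf' 0 (Ico_subset_Icc_self ht)).mono Ioo_subset_Icc_self).tendsto.mono_left ?_
      exact nhdsWithin_le_of_mem hmem
    refine h1.congr' ?_
    filter_upwards [hmem] with t ht
    exact (h t ht).deriv.symm
  · exact (h t ⟨h0, ht.2⟩).hasDerivWithinAt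

end Calculus

/-! ### Uniform bounds and continuity of the right-hand side. -/

section Equivalence

variable {d : ℕ} {q : (Fin d → ℤ) → (Fin d → ℤ) → ℂ} {A : ℝ} {lam : (Fin d → ℤ) → ℝ}
  {c₀ S : (Fin d → ℤ) → ℂ} {T : ℝ} {D : (Fin d → ℤ) → ℝ} {c : ℝ → (Fin d → ℤ) → ℂ}

theorem norm_rhs_le (hq : IsTransportKernel q A) (hlam : ∀ k, 0 ≤ lam k) (hD : Summable D)
    {θ : (Fin d → ℤ) → ℂ} (hθ : ∀ k, ‖θ k‖ ≤ D k) (k : Fin d → ℤ) :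
    ‖-(lam k * θ k) - convection q θ θ k + S k‖ ≤
      lam k * D k + A * (freqNorm k * ∑' m, D m * D (k - m)) + ‖S k‖ := by
  refine (norm_add_le _ _).trans (add_le_add_left ((norm_sub_le _ _).trans (add_le_add ?_ ?_)) _)
  · rw [norm_neg, norm_mul, Complex.norm_real, Real.norm_of_nonneg (hlam k)]
    exact mul_le_mul_of_nonneg_left (hθ k) (hlam k)
  · exact (norm_convection_le hq hD hD hθ hθ k).trans (le_of_eq (by ring))

theorem summable_rhs_bound (hD0 : ∀ k, 0 ≤ D k) (hD : Summable D)
    (hD1 : Summable fun k => freqNorm k * D k) (hDlam : Summable fun k => lam k * D k)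
    (hS : Summable fun k => ‖S k‖) :
    Summable fun k => lam k * D k + A * (freqNorm k * ∑' m, D m * D (k - m)) + ‖S k‖ :=
  (hDlam.add ((summable_freqNorm_mul_convolution hD0 hD hD1).mul_left A)).add hS

theorem IsSpectralSolution.continuousOn_rhs (hq : IsTransportKernel q A)
    (h : IsSpectralSolution q lam c₀ S T D c) (hD0 : ∀ k, 0 ≤ D k) (hD : Summable D)
    (k : Fin d → ℤ) :
    ContinuousOn (fun t => -(lam k * c t k) - convection q (c t) (c t) k + S k) (Icc 0 T) := by
  refine ((continuousOn_const.mul (h.continuousOn k)).neg.sub ?_).add continuousOn_const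
  refine continuousOn_tsum (fun m => ?_)
    ((summable_convolution hD0 hD hD0 hD k).1.mul_left (A * freqNorm k)) fun m t ht =>
      norm_convection_term_le hq (h.norm_le t ht) (h.norm_le t ht) k m
  exact (continuousOn_const.mul (h.continuousOn m)).mul (h.continuousOn (k - m))

end Equivalence

/-! ### Equivalence of pointwise and spectral solutions. -/

section Solutions

variable {d : ℕ} {T : Fin d → Fin d → (Fin d → ℤ) → ℂ} {Cstar : ℝ} {s r γ κ Tmax : ℝ}
  {θ₀ S : (Fin d → ℝ) → ℝ}

/-- The symbol of `κ Λ^γ`. -/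
noncomputable def dissipation (κ γ : ℝ) (k : Fin d → ℤ) : ℝ := κ * freqNorm k ^ γ

theorem dissipation_nonneg (hκ : 0 ≤ κ) (k : Fin d → ℤ) : 0 ≤ dissipation κ γ k :=
  mul_nonneg hκ (Real.rpow_nonneg (freqNorm_nonneg k) _)

theorem summable_dissipation_mul_gevreyDecay {a τ : ℝ} (ha : 0 < a) (hτ : 0 < τ) (M : ℝ) :
    Summable fun k : Fin d → ℤ => dissipation κ γ k * gevreyDecay M τ a k := by
  refine ((summable_rpow_mul_gevreyDecay (d := d) ha hτ M γ).mul_left κ).congr fun k => ?_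
  simp only [dissipation]; ring

/-- The Fourier coefficients of a Gevrey-class solution solve the spectral problem. -/
theorem IsGevreySolution.isSpectralSolution {θ : ℝ → (Fin d → ℝ) → ℝ}
    (hθ : IsGevreySolution T s r γ κ θ₀ S Tmax θ) (hT : IsAdmissible T) (hCpos : 0 ≤ Cstar)
    (hC : ∀ i j k, k ≠ 0 → ‖derivSymbol T i j k‖ ≤ Cstar) (hs : 0 < s) (hr : 0 ≤ r)
    (hκ : 0 ≤ κ) (hS : IsMeanZeroTorusFunction S) (hSs : Summable fun k => ‖fourierCoef S k‖)
    {t₁ : ℝ} (ht₁ : t₁ < Tmax) :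
    ∃ M τ : ℝ, 0 ≤ M ∧ 0 < τ ∧ IsSpectralSolution (transportKernel T) (dissipation κ γ)
      (fourierCoef θ₀) (fourierCoef S) t₁ (gevreyDecay M τ (1 / s))
      (fun t => fourierCoef (θ t)) := by
  obtain ⟨τ, hτ, M, hM⟩ := hθ.gevrey t₁ ht₁
  have ha : 0 < 1 / s := by positivity
  have hM0 : (0 : ℝ) ≤ M := M.2
  have hq := isTransportKernel_transportKernel hT hCpos hC
  have hsub : Icc 0 t₁ ⊆ Ico 0 Tmax := fun t ht => ⟨ht.1, ht.2.trans_lt ht₁⟩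
  set D : (Fin d → ℤ) → ℝ := gevreyDecay M τ (1 / s) with hDdef
  have hD0 : ∀ k, 0 ≤ D k := gevreyDecay_nonneg hM0
  have hD : Summable D := summable_gevreyDecay ha hτ _
  have hD1 : Summable fun k => freqNorm k * D k := summable_freqNorm_mul_gevreyDecay ha hτ _
  have hDγ : Summable fun k => freqNorm k ^ γ * D k := summable_rpow_mul_gevreyDecay ha hτ _ _
  have hDlam : Summable fun k => dissipation κ γ k * D k :=
    summable_dissipation_mul_gevreyDecay ha hτ _
  have hlam : ∀ k : Fin d → ℤ, 0 ≤ dissipation κ γ k := dissipation_nonneg hκ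
  have hb : ∀ t ∈ Icc 0 t₁, ∀ k, ‖fourierCoef (θ t) k‖ ≤ D k := fun t ht k =>
    norm_fourierCoef_le_gevreyDecay hr (hθ.torus t (hsub ht)) hM0
      (by rw [ENNReal.ofReal_coe_nnreal]; exact hM t ht) k
  have hbs : ∀ t ∈ Icc 0 t₁, Summable fun k => ‖fourierCoef (θ t) k‖ := fun t ht =>
    Summable.of_nonneg_of_le (fun _ => norm_nonneg _) (hb t ht) hD
  have hbs1 : ∀ t ∈ Icc 0 t₁, Summable fun k => freqNorm k * ‖fourierCoef (θ t) k‖ :=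
    fun t ht => Summable.of_nonneg_of_le
      (fun k => mul_nonneg (freqNorm_nonneg k) (norm_nonneg _))
      (fun k => mul_le_mul_of_nonneg_left (hb t ht k) (freqNorm_nonneg k)) hD1
  have hbsγ : ∀ t ∈ Icc 0 t₁, Summable fun k => freqNorm k ^ γ * ‖fourierCoef (θ t) k‖ :=
    fun t ht => Summable.of_nonneg_of_le
      (fun k => mul_nonneg (Real.rpow_nonneg (freqNorm_nonneg k) _) (norm_nonneg _))
      (fun k => mul_le_mul_of_nonneg_left (hb t ht k)
        (Real.rpow_nonneg (freqNorm_nonneg k) _)) hDγ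
  set G : ℝ → (Fin d → ℤ) → ℂ := fun t k => -(dissipation κ γ k * fourierCoef (θ t) k) -
    convection (transportKernel T) (fourierCoef (θ t)) (fourierCoef (θ t)) k + fourierCoef S k
    with hG
  have hGb : ∀ t ∈ Icc 0 t₁, ∀ k, ‖G t k‖ ≤ _ := fun t ht k =>
    norm_rhs_le (S := fourierCoef S) hq hlam hD (hb t ht) k
  set U : (Fin d → ℤ) → ℝ := fun k => dissipation κ γ k * D k +
    d * (d * Cstar) * (freqNorm k * ∑' m, D m * D (k - m)) + ‖fourierCoef S k‖ with hU
  have hUs : Summable U := summable_rhs_bound hD0 hD hD1 hDlam hSs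
  have hGs : ∀ t ∈ Icc 0 t₁, Summable fun k => ‖G t k‖ := fun t ht =>
    Summable.of_nonneg_of_le (fun _ => norm_nonneg _) (hGb t ht) hUs
  have heq : ∀ t ∈ Icc 0 t₁, ∀ x, HasDerivWithinAt (fun t' => (θ t' x : ℂ))
      (∑' k, G t k * character k x) (Ico 0 Tmax) t := by
    intro t ht x
    have h1 := hasSum_rhs (κ := κ) hT hCpos hC (hθ.torus t (hsub ht)) hS (hbs t ht) (hbs1 t ht)
      (hbsγ t ht) hSs.of_norm x
    exact (hθ.equation t (hsub ht) x).congr_deriv h1.tsum_eq.symm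
  have hnorm : ∀ t ∈ Icc 0 t₁, ∀ x, ‖(θ t x : ℂ)‖ ≤ ∑' k, D k := by
    intro t ht x
    rw [← ((hθ.torus t (hsub ht)).hasSum (hbs t ht).of_norm x).tsum_eq]
    exact tsum_of_norm_bounded hD.hasSum fun k => by
      rw [norm_mul, norm_character, mul_one]; exact hb t ht k
  set μ := (volume : Measure (Fin d → ℝ)).restrict
    (Icc (fun _ : Fin d => (0 : ℝ)) (fun _ => 2 * Real.pi)) with hμ
  have hint : ∀ b : ℝ, Integrable (fun _ : Fin d → ℝ => b) μ := fun b =>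
    integrableOn_const isCompact_Icc.measure_lt_top.ne
  have hFc : ∀ t ∈ Icc 0 t₁, ∀ k, Continuous fun x => (θ t x : ℂ) * character (-k) x :=
    fun t ht k => (Complex.continuous_ofReal.comp (hθ.torus t (hsub ht)).continuous).mul
      (continuous_character _)
  refine ⟨M, τ, hM0, hτ, hb, fun t _ k => fourierCoef_neg _ k,
    fun t ht => (hθ.torus t (hsub ht)).fourierCoef_zero, fun k => by rw [hθ.initial], ?_, ?_⟩
  · intro k t ht
    refine ContinuousWithinAt.mul continuousWithinAt_const ?_
    refine continuousWithinAt_of_dominated (bound := fun _ => ∑' k, D k) ?_ ?_ (hint _) ?_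
    · filter_upwards [self_mem_nhdsWithin] with t ht
      exact (hFc t ht k).aestronglyMeasurable
    · filter_upwards [self_mem_nhdsWithin] with t ht
      refine Eventually.of_forall fun x => ?_
      rw [norm_mul, norm_character, mul_one]
      exact hnorm t ht x
    · refine Eventually.of_forall fun x => ?_
      exact (((heq t ht x).continuousWithinAt).mono hsub).mul continuousWithinAt_const
  · intro t ht k
    have ht' := Ioo_subset_Icc_self ht
    -- The pointwise equation is integrated against a character. The uniform Gevrey bound makes `θ`
    -- and its time derivative bounded by constants, which are integrable on the cube.
    have hder := (hasDerivAt_integral_of_dominated_loc_of_deriv_le (μ := μ)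
      (F := fun t x => (θ t x : ℂ) * character (-k) x)
      (F' := fun t x => (∑' k, G t k * character k x) * character (-k) x)
      (bound := fun _ => ∑' k, U k) (Ioo_mem_nhds ht.1 ht.2) ?_ ?_ ?_ ?_ (hint _) ?_).2
    · have h2 := hder.const_mul (1 / (2 * (Real.pi : ℂ)) ^ d)
      refine h2.congr_deriv ?_
      exact torusCoef_tsum (hGs t ht') k
    · filter_upwards [Ioo_mem_nhds ht.1 ht.2] with t ht
      exact (hFc t (Ioo_subset_Icc_self ht) k).aestronglyMeasurable
    · exact (hint (∑' k, D k)).mono' (hFc t ht' k).aestronglyMeasurable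
        (Eventually.of_forall fun x => by
          rw [norm_mul, norm_character, mul_one]; exact hnorm t ht' x)
    · exact ((continuous_tsum_character (hGs t ht')).mul
        (continuous_character _)).aestronglyMeasurable
    · refine Eventually.of_forall fun x t ht => ?_
      rw [norm_mul, norm_character, mul_one]
      exact tsum_of_norm_bounded hUs.hasSum fun k => by
        rw [norm_mul, norm_character, mul_one]; exact hGb t (Ioo_subset_Icc_self ht) k
    · refine Eventually.of_forall fun x t ht => ?_
      have hnhds : Ico 0 Tmax ∈ 𝓝 t := Ico_mem_nhds ht.1 (ht.2.trans ht₁)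
      exact ((heq t (Ioo_subset_Icc_self ht) x).hasDerivAt hnhds).mul_const _

/-- The Fourier series of a spectral solution is a Gevrey-class solution. -/
theorem IsSpectralSolution.isGevreySolution {c : ℝ → (Fin d → ℤ) → ℂ} {M τ : ℝ} (hM : 0 ≤ M)
    (hτ : 0 < τ) (h : IsSpectralSolution (transportKernel T) (dissipation κ γ)
      (fourierCoef θ₀) (fourierCoef S) Tmax (gevreyDecay M τ (1 / s)) c)
    (hTmax : 0 ≤ Tmax) (hT : IsAdmissible T) (hCpos : 0 ≤ Cstar)
    (hC : ∀ i j k, k ≠ 0 → ‖derivSymbol T i j k‖ ≤ Cstar) (hs : 0 < s)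
    (hκ : 0 ≤ κ) (hS : IsMeanZeroTorusFunction S) (hSs : Summable fun k => ‖fourierCoef S k‖)
    (hθ₀ : IsMeanZeroTorusFunction θ₀) :
    IsGevreySolution T s r γ κ θ₀ S Tmax (fun t x => (∑' k, c t k * character k x).re) ∧
      ∀ t ∈ Icc 0 Tmax, fourierCoef (fun x => (∑' k, c t k * character k x).re) = c t := by
  have ha : 0 < 1 / s := by positivity
  have hq := isTransportKernel_transportKernel hT hCpos hC
  set D : (Fin d → ℤ) → ℝ := gevreyDecay M τ (1 / s) with hDdef
  have hD0 : ∀ k, 0 ≤ D k := gevreyDecay_nonneg hM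
  have hD : Summable D := summable_gevreyDecay ha hτ _
  have hD1 : Summable fun k => freqNorm k * D k := summable_freqNorm_mul_gevreyDecay ha hτ _
  have hDγ : Summable fun k => freqNorm k ^ γ * D k := summable_rpow_mul_gevreyDecay ha hτ _ _
  have hDlam : Summable fun k => dissipation κ γ k * D k :=
    summable_dissipation_mul_gevreyDecay ha hτ _
  have hlam : ∀ k : Fin d → ℤ, 0 ≤ dissipation κ γ k := dissipation_nonneg hκ
  have hcs : ∀ t ∈ Icc 0 Tmax, Summable fun k => ‖c t k‖ := fun t ht =>
    Summable.of_nonneg_of_le (fun _ => norm_nonneg _) (h.norm_le t ht) hD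
  have hsyn := fun t (ht : t ∈ Icc 0 Tmax) =>
    isMeanZeroTorusFunction_tsum (hcs t ht) (h.real t ht) (h.zero_mode t ht)
  have hco := fun t (ht : t ∈ Icc 0 Tmax) => (hsyn t ht).2.2
  refine ⟨⟨fun t ht => (hsyn t (Ico_subset_Icc_self ht)).1, ?_, ?_, ?_⟩, hco⟩
  · intro t₁ ht₁
    have hsum := (summable_rpow_mul_gevreyDecay (d := d) ha (show 0 < τ by linarith) (M * M)
      (2 * r))
    -- With radius `τ / 2` the squared norm carries `e^{τ|k|^a}`, while the squared majorant carries
    -- `e^{-2τ|k|^a}`, so a full `e^{-τ|k|^a}` is left to sum.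
    refine ⟨τ / 2, by positivity, Real.toNNReal (Real.sqrt (∑' k, freqNorm k ^ (2 * r) *
      gevreyDecay (M * M) τ (1 / s) (k : Fin d → ℤ))), fun t ht => ?_⟩
    have ht' : t ∈ Icc 0 Tmax := ⟨ht.1, ht.2.trans ht₁.le⟩
    refine gevreyNorm_le_of_summable hsum fun k => ?_
    rw [hco t ht', mul_assoc]
    refine mul_le_mul_of_nonneg_left ?_ (Real.rpow_nonneg (freqNorm_nonneg k) _)
    have h1 := h.norm_le t ht' k
    have h2 : ‖c t k‖ ^ 2 ≤ D k ^ 2 := by gcongr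
    calc Real.exp (2 * (τ / 2) * freqNorm k ^ (1 / s)) * ‖c t k‖ ^ 2
        ≤ Real.exp (2 * (τ / 2) * freqNorm k ^ (1 / s)) * D k ^ 2 := by gcongr
      _ = gevreyDecay (M * M) τ (1 / s) k := by
        simp only [hDdef, gevreyDecay]
        have e : Real.exp (2 * (τ / 2) * freqNorm k ^ (1 / s)) *
            Real.exp (-(τ * freqNorm k ^ (1 / s))) = 1 := by
          rw [← Real.exp_add]; ring_nf; exact Real.exp_zero
        linear_combination M ^ 2 * Real.exp (-(τ * freqNorm k ^ (1 / s))) * e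
  · funext x
    have h0 : c 0 = fourierCoef θ₀ := funext h.initial
    have hs0 := hcs 0 (left_mem_Icc.mpr hTmax)
    rw [h0] at hs0 ⊢
    rw [(hθ₀.hasSum hs0.of_norm x).tsum_eq, Complex.ofReal_re]
  · intro t ht x
    set G : ℝ → (Fin d → ℤ) → ℂ := fun t k => -(dissipation κ γ k * c t k) -
      convection (transportKernel T) (c t) (c t) k + fourierCoef S k with hG
    have hGb : ∀ t ∈ Icc 0 Tmax, ∀ k, ‖G t k‖ ≤ _ := fun t ht k =>
      norm_rhs_le (S := fourierCoef S) hq hlam hD (h.norm_le t ht) k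
    set U : (Fin d → ℤ) → ℝ := fun k => dissipation κ γ k * D k +
      d * (d * Cstar) * (freqNorm k * ∑' m, D m * D (k - m)) + ‖fourierCoef S k‖ with hU
    have hUs : Summable U := summable_rhs_bound hD0 hD hD1 hDlam hSs
    have hder := hasDerivWithinAt_Ico_of_continuousOn (T := Tmax)
      (f := fun t => ∑' k, c t k * character k x) (f' := fun t => ∑' k, G t k * character k x)
      ?_ ?_ ?_ t ht
    · have ht' := Ico_subset_Icc_self ht
      have hm := (hsyn t ht').1
      have hb : ∀ k, ‖fourierCoef (fun x => (∑' k, c t k * character k x).re) k‖ ≤ D k := by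
        rw [hco t ht']; exact h.norm_le t ht'
      have h1 := hasSum_rhs (κ := κ) (γ := γ) hT hCpos hC hm hS
        (Summable.of_nonneg_of_le (fun _ => norm_nonneg _) hb hD)
        (Summable.of_nonneg_of_le (fun k => mul_nonneg (freqNorm_nonneg k) (norm_nonneg _))
          (fun k => mul_le_mul_of_nonneg_left (hb k) (freqNorm_nonneg k)) hD1)
        (Summable.of_nonneg_of_le
          (fun k => mul_nonneg (Real.rpow_nonneg (freqNorm_nonneg k) _) (norm_nonneg _))
          (fun k => mul_le_mul_of_nonneg_left (hb k)
            (Real.rpow_nonneg (freqNorm_nonneg k) _)) hDγ) hSs.of_norm x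
      rw [← h1.tsum_eq]
      have e : ∀ t' ∈ Ico 0 Tmax, ((∑' k, c t' k * character k x).re : ℂ) =
          ∑' k, c t' k * character k x := fun t' ht' =>
        (hsyn t' (Ico_subset_Icc_self ht')).2.1 x
      refine (hder.congr e (e t ht)).congr_deriv ?_
      refine tsum_congr fun k => ?_
      rw [hco t ht']
      rfl
    · refine continuousOn_tsum (fun k => (h.continuousOn k).mul continuousOn_const) hD
        fun k t ht => ?_
      rw [norm_mul, norm_character, mul_one]; exact h.norm_le t ht k
    · refine continuousOn_tsum (fun k => (h.continuousOn_rhs hq hD0 hD k).mul continuousOn_const)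
        hUs fun k t ht => ?_
      rw [norm_mul, norm_character, mul_one]; exact hGb t ht k
    · intro t ht
      refine hasDerivAt_tsum_of_isPreconnected hUs isOpen_Ioo isPreconnected_Ioo
        (g := fun k t => c t k * character k x) (g' := fun k t => G t k * character k x)
        (fun k t ht => (h.deriv t ht k).mul_const _) (fun k t ht => ?_) ht
        (Summable.of_norm_bounded (hcs t (Ioo_subset_Icc_self ht)) fun k => by
          rw [norm_mul, norm_character, mul_one]) ht
      rw [norm_mul, norm_character, mul_one]; exact hGb t (Ioo_subset_Icc_self ht) k

end Solutions

/-! ### Uniform time of existence, uniqueness, and interpolation. -/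

section WellPosedness

variable {d : ℕ} {T : Fin d → Fin d → (Fin d → ℤ) → ℂ} {Cstar s r γ κ Tmax : ℝ}
  {θ₀ S : (Fin d → ℝ) → ℝ}

theorem summable_inv_freqNorm_pow_sq : Summable fun k : Fin d → ℤ =>
    ((freqNorm k ^ (d + 1))⁻¹) ^ 2 := by
  refine (summable_freqNorm_rpow (d := d) (p := -((2 * (d + 1) : ℕ) : ℝ)) ?_).congr fun k => ?_
  · push_cast; linarith [(Nat.cast_nonneg d : (0 : ℝ) ≤ d)]
  · rw [Real.rpow_neg (freqNorm_nonneg k), Real.rpow_natCast, inv_pow, ← pow_mul, mul_comm 2]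

/-- Half of the radius pays for any polynomial weight. -/
theorem exists_sum_weight_le {a r τ : ℝ} (ha : 0 < a) (hr : 0 ≤ r) (hτ : 0 < τ) (R : ℕ) :
    ∃ C : ℝ, 0 < C ∧ ∀ (d : ℕ) (F : Finset (Fin d → ℤ)), (0 : Fin d → ℤ) ∉ F →
      ∀ (θ : (Fin d → ℤ) → ℂ) (M : ℝ),
      ∑ k ∈ F, freqNorm k ^ (2 * r) * Real.exp (2 * τ * freqNorm k ^ a) * ‖θ k‖ ^ 2 ≤ M ^ 2 →
      ∑ k ∈ F, weight a R (τ / 2) (freqNorm k) ^ 2 * ‖θ k‖ ^ 2 ≤ (C * M) ^ 2 := by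
  -- The squared weight of radius `τ / 2` is `|k|^{2R} e^{τ|k|^a}`. The remaining `e^{τ|k|^a}`
  -- dominates the polynomial, and `|k|^{2r} ≥ 1` is thrown away.
  obtain ⟨C, hC, h⟩ := exists_rpow_le_mul_exp ha hτ ((2 * R : ℕ) : ℝ)
  refine ⟨Real.sqrt C, Real.sqrt_pos.mpr hC, fun d F hF θ M hM => ?_⟩
  rw [mul_pow, Real.sq_sqrt hC.le]
  refine le_trans ?_ (mul_le_mul_of_nonneg_left hM hC.le)
  rw [Finset.mul_sum]
  refine Finset.sum_le_sum fun k hk => ?_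
  have hk1 : 1 ≤ freqNorm k := one_le_freqNorm fun h => hF (h ▸ hk)
  have h1 := h _ hk1
  rw [Real.rpow_natCast] at h1
  have h2 : 1 ≤ freqNorm k ^ (2 * r) := Real.one_le_rpow hk1 (by linarith)
  have e1 : weight a R (τ / 2) (freqNorm k) ^ 2 =
      freqNorm k ^ (2 * R) * Real.exp (τ * freqNorm k ^ a) := by
    rw [weight, mul_pow, ← pow_mul, mul_comm R, ← Real.exp_nat_mul]
    congr 2; push_cast; ring
  have e2 : Real.exp (2 * τ * freqNorm k ^ a) =
      Real.exp (τ * freqNorm k ^ a) * Real.exp (τ * freqNorm k ^ a) := by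
    rw [← Real.exp_add]; congr 1; ring
  rw [e1, ← mul_assoc]
  refine mul_le_mul_of_nonneg_right ?_ (sq_nonneg _)
  calc freqNorm k ^ (2 * R) * Real.exp (τ * freqNorm k ^ a)
      ≤ C * Real.exp (τ * freqNorm k ^ a) * Real.exp (τ * freqNorm k ^ a) := by gcongr
    _ = C * (1 * Real.exp (2 * τ * freqNorm k ^ a)) := by rw [e2]; ring
    _ ≤ C * (freqNorm k ^ (2 * r) * Real.exp (2 * τ * freqNorm k ^ a)) := by gcongr

/-- The spectral problem is solvable up to a time, and with bounds, that depend only on the size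
of the data and of the velocity multiplier. -/
theorem exists_time_spectralSolution (d : ℕ) {s r τ₀ K₀ Cstar : ℝ} (hs : 1 ≤ s) (hr : 0 ≤ r)
    (hτ₀ : 0 < τ₀) (hK₀ : 0 ≤ K₀) (hC : 0 ≤ Cstar) :
    ∃ Tstar M τ : ℝ, 0 < Tstar ∧ 0 ≤ M ∧ 0 < τ ∧ τ ≤ τ₀ ∧
      ∀ T : Fin d → Fin d → (Fin d → ℤ) → ℂ, IsAdmissible T →
      (∀ i j k, k ≠ 0 → ‖derivSymbol T i j k‖ ≤ Cstar) →
      ∀ θ₀ S : (Fin d → ℝ) → ℝ, IsMeanZeroTorusFunction θ₀ → IsMeanZeroTorusFunction S →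
      gevreyNorm s r τ₀ θ₀ ≤ ENNReal.ofReal K₀ → gevreyNorm s r τ₀ S ≤ ENNReal.ofReal K₀ →
      ∀ γ κ : ℝ, 0 ≤ κ → ∃ c, IsSpectralSolution (transportKernel T) (dissipation κ γ)
        (fourierCoef θ₀) (fourierCoef S) Tstar (gevreyDecay M τ (1 / s)) c := by
  have ha : 0 < 1 / s := by positivity
  have ha1 : 1 / s ≤ 1 := by rw [div_le_one (by linarith)]; exact hs
  obtain ⟨C, hC0, hweight⟩ := exists_sum_weight_le ha hr hτ₀ (d + 1 + 2)
  set σ := Real.sqrt (∑' k : Fin d → ℤ, ((freqNorm k ^ (d + 1))⁻¹) ^ 2) with hσdef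
  have hσ : ∀ F : Finset (Fin d → ℤ), (0 : Fin d → ℤ) ∉ F →
      ∑ k ∈ F, ((freqNorm k ^ (d + 1))⁻¹) ^ 2 ≤ σ ^ 2 := fun F _ => by
    rw [hσdef, Real.sq_sqrt (tsum_nonneg fun k => sq_nonneg _)]
    exact summable_inv_freqNorm_pow_sq.sum_le_tsum F fun k _ => sq_nonneg _
  set L := radiusSpeed (d * (d * Cstar)) (τ₀ / 2) σ (C * K₀) (d + 1 + 2) with hL
  have hL0 : 0 < L := by
    have : 0 ≤ 2 * ((d * (d * Cstar)) * (2 * (((d + 1 + 2 : ℕ) : ℝ) * 2 ^ (d + 1 + 2) + τ₀ / 2) +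
      2 * 2 ^ (d + 1 + 2))) * σ * Real.sqrt (2 * (C * K₀) ^ 2 + 1) := by positivity
    rw [hL, radiusSpeed]
    linarith
  -- The radius starts at `τ₀ / 2` after the change of weight and loses at most half of that by the
  -- final time. All these witnesses are fixed before `T`, the data, `γ` and `κ` appear.
  refine ⟨min 1 (τ₀ / 2 / 2 / L), Real.sqrt (2 * (C * K₀) ^ 2 + 1), τ₀ / 2 / 2,
    lt_min one_pos (by positivity), Real.sqrt_nonneg _, by positivity, by linarith,
    fun T hT hCT θ₀ S hθ₀ hS hθ₀K hSK γ κ hκ => ?_⟩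
  refine exists_spectralSolution (isTransportKernel_transportKernel hT hC hCT)
    transportKernel_neg_right ha ha1 (half_pos hτ₀) (n := d + 1) (σ := σ)
    (dissipation_nonneg hκ) (fun k => by simp [dissipation]) (fourierCoef_neg θ₀)
    (fourierCoef_neg S) hθ₀.fourierCoef_zero hS.fourierCoef_zero
    (fun F hF => hweight d F hF _ _ (sum_le_of_gevreyNorm_le hK₀ hθ₀K hF))
    (fun F hF => hweight d F hF _ _ (sum_le_of_gevreyNorm_le hK₀ hSK hF))
    (Real.sqrt_nonneg _) hσ (le_min zero_le_one (by positivity)) (min_le_left _ _) ?_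
    (summable_dissipation_mul_gevreyDecay ha (by positivity) _)
  calc L * min 1 (τ₀ / 2 / 2 / L) ≤ L * (τ₀ / 2 / 2 / L) :=
        mul_le_mul_of_nonneg_left (min_le_right _ _) hL0.le
    _ = τ₀ / 2 / 2 := by field_simp

/-- Gevrey-class solutions are determined by the spectral problem. -/
theorem IsGevreySolution.fourierCoef_eq {θ : ℝ → (Fin d → ℝ) → ℝ}
    (hθ : IsGevreySolution T s r γ κ θ₀ S Tmax θ) (hT : IsAdmissible T) (hCpos : 0 ≤ Cstar)
    (hC : ∀ i j k, k ≠ 0 → ‖derivSymbol T i j k‖ ≤ Cstar) (hs : 0 < s) (hr : 0 ≤ r)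
    (hκ : 0 ≤ κ) (hS : IsMeanZeroTorusFunction S) (hSs : Summable fun k => ‖fourierCoef S k‖)
    {M τ : ℝ} (hM : 0 ≤ M) (hτ : 0 < τ) {c : ℝ → (Fin d → ℤ) → ℂ}
    (hc : IsSpectralSolution (transportKernel T) (dissipation κ γ) (fourierCoef θ₀)
      (fourierCoef S) Tmax (gevreyDecay M τ (1 / s)) c) :
    ∀ t ∈ Ico 0 Tmax, fourierCoef (θ t) = c t := by
  intro t ht
  have ha : 0 < 1 / s := by positivity
  have hq := isTransportKernel_transportKernel hT hCpos hC
  obtain ⟨M', τ', hM', hτ', h'⟩ := hθ.isSpectralSolution hT hCpos hC hs hr hκ hS hSs ht.2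
  -- The given solution brings its own radius, which depends on the time interval; the sum of the
  -- two majorants puts both solutions under one roof.
  set D : (Fin d → ℤ) → ℝ := fun k => gevreyDecay M τ (1 / s) k + gevreyDecay M' τ' (1 / s) k
    with hDdef
  have h₁ : IsSpectralSolution (transportKernel T) (dissipation κ γ) (fourierCoef θ₀)
      (fourierCoef S) t D (fun t => fourierCoef (θ t)) :=
    h'.mono (fun k => le_add_of_nonneg_left (gevreyDecay_nonneg hM k)) le_rfl
  have h₂ : IsSpectralSolution (transportKernel T) (dissipation κ γ) (fourierCoef θ₀)
      (fourierCoef S) t D c :=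
    hc.mono (fun k => le_add_of_nonneg_right (gevreyDecay_nonneg hM' k)) ht.2.le
  have hD : Summable D := (summable_gevreyDecay ha hτ _).add (summable_gevreyDecay ha hτ' _)
  have hD1 : Summable fun k => freqNorm k * D k := by
    simp only [hDdef, mul_add]
    exact (summable_freqNorm_mul_gevreyDecay ha hτ _).add
      (summable_freqNorm_mul_gevreyDecay ha hτ' _)
  have hDlam : Summable fun k => dissipation κ γ k * D k := by
    simp only [hDdef, mul_add]
    exact (summable_dissipation_mul_gevreyDecay ha hτ _).add
      (summable_dissipation_mul_gevreyDecay ha hτ' _)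
  funext k
  have h := h₁.norm_sub_sq_le hq h₂ hD hD1 (dissipation_nonneg hκ) hDlam
    (by simp) t ⟨ht.1, le_rfl⟩ k
  simp only [sub_self, abs_zero, zero_mul, tsum_zero, mul_zero] at h
  have h0 : ‖fourierCoef (θ t) k - c t k‖ = 0 := by
    have := le_antisymm h (sq_nonneg _)
    exact pow_eq_zero_iff two_ne_zero |>.mp this
  exact sub_eq_zero.mp (norm_eq_zero.mp h0)

theorem fourierCoef_sub {f g : (Fin d → ℝ) → ℝ} (hf : Continuous f) (hg : Continuous g)
    (k : Fin d → ℤ) :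
    fourierCoef (fun x => f x - g x) k = fourierCoef f k - fourierCoef g k := by
  have hint : ∀ {f : (Fin d → ℝ) → ℝ}, Continuous f → IntegrableOn
      (fun x => (f x : ℂ) * character (-k) x)
      (Icc (fun _ : Fin d => (0 : ℝ)) (fun _ => 2 * Real.pi)) := fun hf =>
    ((Complex.continuous_ofReal.comp hf).mul
      (continuous_character _)).continuousOn.integrableOn_compact
      isCompact_Icc
  simp only [fourierCoef, Complex.ofReal_sub, sub_mul]
  rw [integral_sub (hint hf) (hint hg), mul_sub]

/-- Smallness in `ℓ²` and uniform Gevrey bounds give smallness in weaker Gevrey norms. -/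
theorem gevreyNorm_le_of_interpolation {f : (Fin d → ℝ) → ℝ} {M τ τ' E : ℝ} (hs : 0 < s)
    (hτ : 2 * τ' < τ) (hE : ∀ k, ‖fourierCoef f k‖ ≤ E)
    (hM : ∀ k, ‖fourierCoef f k‖ ≤ gevreyDecay M τ (1 / s) k) :
    gevreyNorm s r τ' f ≤ ENNReal.ofReal (Real.sqrt
      (E * ∑' k : Fin d → ℤ, freqNorm k ^ (2 * r) * gevreyDecay M (τ - 2 * τ') (1 / s) k)) := by
  have ha : 0 < 1 / s := by positivity
  have hsum := (summable_rpow_mul_gevreyDecay (d := d) ha (sub_pos.mpr hτ) M (2 * r)).mul_left E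
  rw [← tsum_mul_left]
  refine gevreyNorm_le_of_summable hsum fun k => ?_
  have hE0 : 0 ≤ E := (norm_nonneg _).trans (hE k)
  have h1 : ‖fourierCoef f k‖ ^ 2 ≤ E * gevreyDecay M τ (1 / s) k := by
    rw [sq]; exact mul_le_mul (hE k) (hM k) (norm_nonneg _) hE0
  have h2 : Real.exp (2 * τ' * freqNorm k ^ (1 / s)) * gevreyDecay M τ (1 / s) k =
      gevreyDecay M (τ - 2 * τ') (1 / s) k := by
    simp only [gevreyDecay]
    rw [mul_left_comm, ← Real.exp_add]
    congr 2; ring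
  have h3 := Real.rpow_nonneg (freqNorm_nonneg k) (2 * r)
  calc _ ≤ freqNorm k ^ (2 * r) * Real.exp (2 * τ' * freqNorm k ^ (1 / s)) *
        (E * gevreyDecay M τ (1 / s) k) :=
        mul_le_mul_of_nonneg_left h1 (mul_nonneg h3 (Real.exp_pos _).le)
    _ = E * (freqNorm k ^ (2 * r) *
        (Real.exp (2 * τ' * freqNorm k ^ (1 / s)) * gevreyDecay M τ (1 / s) k)) := by ring
    _ = _ := by rw [h2]

end WellPosedness

end ActiveScalar


/-! ### Well-posedness and the vanishing dissipation limit. -/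

open ActiveScalar in
theorem theorem5p4 (d : ℕ) (hd : 2 ≤ d) (s r τ₀ K₀ Cstar : ℝ) (hs : 1 ≤ s)
    (hr : (d : ℝ) / 2 + 5 / 2 < r) (hτ₀ : 0 < τ₀) (hK₀ : 0 < K₀) (hC : 0 < Cstar) :
    ∃ Tstar : ℝ, 0 < Tstar ∧
      ∀ T : Fin d → Fin d → (Fin d → ℤ) → ℂ, ActiveScalar.IsAdmissible T →
      (∀ i j k, k ≠ 0 → ‖ActiveScalar.derivSymbol T i j k‖ ≤ Cstar) →
      ∀ θ₀ S : (Fin d → ℝ) → ℝ,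
      ActiveScalar.IsMeanZeroTorusFunction θ₀ → ActiveScalar.IsMeanZeroTorusFunction S →
      ActiveScalar.gevreyNorm s r τ₀ θ₀ ≤ ENNReal.ofReal K₀ →
      ActiveScalar.gevreyNorm s r τ₀ S ≤ ENNReal.ofReal K₀ →
      ∀ γ : ℝ, 0 < γ → γ ≤ 2 →
        (∀ κ : ℝ, 0 ≤ κ →
          ∃ θ : ℝ → (Fin d → ℝ) → ℝ,
            ActiveScalar.IsGevreySolution T s r γ κ θ₀ S Tstar θ ∧
            ∀ θ' : ℝ → (Fin d → ℝ) → ℝ,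
              ActiveScalar.IsGevreySolution T s r γ κ θ₀ S Tstar θ' →
              ∀ t ∈ Set.Ico 0 Tstar, θ' t = θ t) ∧
        ∃ (t₁ : ℝ) (τ : ℝ → ℝ), 0 < t₁ ∧ t₁ < Tstar ∧ ContinuousOn τ (Set.Icc 0 t₁) ∧
          (∀ t ∈ Set.Icc 0 t₁, 0 < τ t ∧ τ t < τ₀) ∧
          ∀ θ : ℝ → ℝ → (Fin d → ℝ) → ℝ,
            (∀ κ : ℝ, 0 ≤ κ →
              ActiveScalar.IsGevreySolution T s r γ κ θ₀ S Tstar (θ κ)) →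
            ∀ t ∈ Set.Icc 0 t₁,
              Filter.Tendsto
                (fun κ : ℝ => ActiveScalar.gevreyNorm s r (τ t) (fun x => θ κ t x - θ 0 t x))
                (nhdsWithin 0 (Set.Ioi 0)) (nhds 0) := by
  have hs0 : 0 < s := by linarith
  have ha : 0 < 1 / s := by positivity
  have hr0 : 0 ≤ r := by linarith [(Nat.cast_nonneg d : (0 : ℝ) ≤ d)]
  obtain ⟨Tstar, M, τ, hT0, hM, hτ, hττ, hsol⟩ :=
    exists_time_spectralSolution d hs hr0 hτ₀ hK₀.le hC.le
  refine ⟨Tstar, hT0, fun T hT hCT θ₀ S hθ₀ hS hθ₀K hSK γ hγ hγ2 => ?_⟩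
  have hSs : Summable fun k => ‖fourierCoef S k‖ :=
    Summable.of_nonneg_of_le (fun _ => norm_nonneg _)
      (norm_fourierCoef_le_gevreyDecay hr0 hS hK₀.le hSK) (summable_gevreyDecay ha hτ₀ _)
  have hc := hsol T hT hCT θ₀ S hθ₀ hS hθ₀K hSK γ
  -- A constant radius suffices. Interpolation requires twice the target radius to be below the
  -- decay rate `τ`, and `τ / 4` leaves room; since `τ ≤ τ₀`, it is also below `τ₀`.
  refine ⟨fun κ hκ => ?_, Tstar / 2, fun _ => τ / 4, by positivity, by linarith,
    continuousOn_const, fun t _ => ⟨by positivity, by linarith⟩, fun θ hθ t ht => ?_⟩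
  · obtain ⟨c, hc⟩ := hc κ hκ
    obtain ⟨h1, h2⟩ := hc.isGevreySolution (r := r) hM hτ hT0.le hT hC.le hCT hs0 hκ hS hSs hθ₀
    refine ⟨_, h1, fun θ' hθ' t ht => ?_⟩
    have ht' := Set.Ico_subset_Icc_self ht
    have e1 := hθ'.fourierCoef_eq hT hC.le hCT hs0 hr0 hκ hS hSs hM hτ hc t ht
    have hcs : Summable (c t) := Summable.of_norm_bounded (summable_gevreyDecay ha hτ _)
      (hc.norm_le t ht')
    funext x
    have e2 := (hθ'.torus t ht).hasSum (by rw [e1]; exact hcs) x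
    rw [e1] at e2
    rw [e2.tsum_eq, Complex.ofReal_re]
  · have ht' : t ∈ Set.Ico 0 Tstar := ⟨ht.1, ht.2.trans_lt (by linarith)⟩
    have ht'' := Set.Ico_subset_Icc_self ht'
    have hq := isTransportKernel_transportKernel hT hC.le hCT
    set D : (Fin d → ℤ) → ℝ := gevreyDecay M τ (1 / s) with hDdef
    -- Stability with the forcing majorant `κ|k|^γ D k` bounds each squared coefficient of the
    -- difference by `B * κ`, and `B` does not depend on `κ`.
    set B := Real.exp (2 * (d * (d * Cstar)) * (∑' k, freqNorm k * D k) * Tstar) *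
      ((2 + 4 * Tstar) * ∑' k, D k) * ∑' k, freqNorm k ^ γ * D k with hB
    -- The majorant of a difference of two solutions is `2 * D k`, hence the `2 * M`.
    set W := ∑' k : Fin d → ℤ, freqNorm k ^ (2 * r) *
      gevreyDecay (2 * M) (τ - 2 * (τ / 4)) (1 / s) k with hW
    have hlim : Filter.Tendsto (fun κ : ℝ => ENNReal.ofReal
        (Real.sqrt (Real.sqrt (B * κ) * W))) (nhdsWithin 0 (Set.Ioi 0)) (nhds 0) := by
      have hcont : Continuous fun κ : ℝ => ENNReal.ofReal (Real.sqrt (Real.sqrt (B * κ) * W)) :=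
        ENNReal.continuous_ofReal.comp (by fun_prop)
      have := hcont.tendsto 0
      simp only [mul_zero, Real.sqrt_zero, zero_mul, ENNReal.ofReal_zero] at this
      exact this.mono_left nhdsWithin_le_nhds
    refine tendsto_of_tendsto_of_tendsto_of_le_of_le' tendsto_const_nhds hlim
      (Filter.Eventually.of_forall fun _ => bot_le) ?_
    filter_upwards [self_mem_nhdsWithin] with κ hκ
    have hκ0 : 0 ≤ κ := le_of_lt hκ
    obtain ⟨c₁, hc₁⟩ := hc κ hκ0
    obtain ⟨c₂, hc₂⟩ := hc 0 le_rfl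
    have e1 := (hθ κ hκ0).fourierCoef_eq hT hC.le hCT hs0 hr0 hκ0 hS hSs hM hτ hc₁ t ht'
    have e2 := (hθ 0 le_rfl).fourierCoef_eq hT hC.le hCT hs0 hr0 le_rfl hS hSs hM hτ hc₂ t ht'
    have e3 : ∀ k, fourierCoef (fun x => θ κ t x - θ 0 t x) k = c₁ t k - c₂ t k := fun k => by
      rw [fourierCoef_sub ((hθ κ hκ0).torus t ht').continuous
        ((hθ 0 le_rfl).torus t ht').continuous, e1, e2]
    have hdiss : ∀ k : Fin d → ℤ, |dissipation κ γ k - dissipation 0 γ k| * D k =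
        κ * (freqNorm k ^ γ * D k) := fun k => by
      have : dissipation 0 γ k = 0 := by simp [dissipation]
      rw [this, sub_zero, abs_of_nonneg (dissipation_nonneg hκ0 k), dissipation, mul_assoc]
    have hDγ := summable_rpow_mul_gevreyDecay (d := d) ha hτ M γ
    have hstab := hc₁.norm_sub_sq_le hq hc₂ (summable_gevreyDecay ha hτ _)
      (summable_freqNorm_mul_gevreyDecay ha hτ _) (dissipation_nonneg le_rfl)
      (summable_dissipation_mul_gevreyDecay ha hτ _)
      ((hDγ.mul_left κ).congr fun k => (hdiss k).symm) t ht''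
    refine gevreyNorm_le_of_interpolation (M := 2 * M) hs0 (by linarith) (fun k => ?_) (fun k => ?_)
    · rw [e3]
      refine Real.le_sqrt_of_sq_le ((hstab k).trans (le_of_eq ?_))
      rw [tsum_congr hdiss, tsum_mul_left, hB]
      ring
    · rw [e3]
      refine (norm_sub_le _ _).trans ?_
      have h1 := hc₁.norm_le t ht'' k
      have h2 := hc₂.norm_le t ht'' k
      have e : gevreyDecay (2 * M) τ (1 / s) k = 2 * D k := by
        simp only [hDdef, gevreyDecay]
        ring
      rw [e]
      linarith
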